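/- Let $M$ be a smooth manifold of dimension $p+2n$ with a smooth foliation $\mathcal F$ of dimension $p$ (codimension $2n$), and let $\omega$ be a transversely symplectic form for $\mathcal F$, that is, a smooth closed $2$-form on $M$ with $\{X\in T_xM : i(X)\omega=0\}=T_x\mathcal F$ for every $x\in M$. Let $\Omega_B^k(\mathcal F)$ be the space of basic $k$-forms, i.e. smooth $k$-forms $\phi$ on $M$ with $i(X)\phi=0$ and $\theta(X)\phi=0$ for every smooth vector field $X$ tangent to $\mathcal F$, where $\theta(X)$ is the Lie derivative, and let $d_B=d|_{\Omega_B^*(\mathcal F)}$. Let $\Lambda^kQ^*$ denote the $k$-covectors annihilated by $i(X)$ for all $X\in T\mathcal F$, and extend $\omega$ to a bilinear form on $\Lambda^kQ^*$ by $\omega(\phi_1\wedge\dots\wedge\phi_k,\psi_1\wedge\dots\wedge\psi_k)=\det\big(\omega(\phi_i^\sharp,\psi_j^\sharp)\big)$, where $\phi=i(\phi^\sharp)\omega$ for $\phi\in Q^*$ (with $\phi^\sharp$ determined modulo $T\mathcal F$). The transversal symplectic star operator $\bar\star:\Lambda^kQ^*\to\Lambda^{2n-k}Q^*$ is defined by $\phi\wedge\bar\star\psi=\omega(\phi,\psi)\,\omega^n/n!$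 for $\phi,\psi\in\Lambda^kQ^*$. Put $\delta_T=(-1)^k\,\bar\star\, d_B\,\bar\star$ on $\Omega_B^k(\mathcal F)$ (so $\delta_T=0$ on $\Omega^0_B(\mathcal F)$), $L\phi=\omega\wedge\phi$, and $$\mathcal H_{ST}^k(\mathcal F)=\{\phi\in\Omega_B^k(\mathcal F) : d_B\phi=\delta_T\phi=0\}.$$ Then for every integer $0\le r\le n$ the map $L^r$ restricts to an isomorphism of real vector spaces $\mathcal H_{ST}^{n-r}(\mathcal F)\to\mathcal H_{ST}^{n+r}(\mathcal F)$. -/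

import Mathlib

open scoped Manifold ContDiff

noncomputable section

namespace TransverseSymplectic

/-! ### Exterior algebra on one vector space

`V` is a real (topological) vector space, later a tangent space. A `k`-covector on `V` is an
alternating map `V [⋀^Fin k]→L[ℝ] ℝ`. -/

section Pointwise

variable {V : Type*} [AddCommGroup V] [Module ℝ V] [TopologicalSpace V]

/-- Rename the degree of a covector along an equality of degrees. -/
def castDeg {k l : ℕ} (h : k = l) (φ : V [⋀^Fin k]→L[ℝ] ℝ) : V [⋀^Fin l]→L[ℝ] ℝ :=
  h ▸ φ

theorem castDeg_apply {k l : ℕ} (h : k = l) (φ : V [⋀^Fin k]→L[ℝ] ℝ) (u : Fin l → V) :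
    castDeg h φ u = φ (fun i => u (Fin.cast h i)) := by
  subst h
  rfl

/-- The wedge product of two covectors, `(φ ∧ ψ)(u) = ∑ sgn(σ) φ(u_{σ 1}, …, u_{σ k})
ψ(u_{σ (k+1)}, …, u_{σ (k+l)})`, the sum running over the `(k, l)`-shuffles `σ`. -/
def wedge {k l : ℕ} (φ : V [⋀^Fin k]→L[ℝ] ℝ) (ψ : V [⋀^Fin l]→L[ℝ] ℝ) :
    V [⋀^Fin (k + l)]→L[ℝ] ℝ :=
  { ((LinearMap.mul' ℝ ℝ).compAlternatingMap
      (φ.toAlternatingMap.domCoprod ψ.toAlternatingMap)).domDomCongr finSumFinEquiv with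
    cont := by
      have key : ∀ σ : Equiv.Perm.ModSumCongr (Fin k) (Fin l), Continuous fun u : Fin (k + l) → V =>
          LinearMap.mul' ℝ ℝ (AlternatingMap.domCoprod.summand φ.toAlternatingMap
            ψ.toAlternatingMap σ (fun i => u (finSumFinEquiv i))) := by
        intro σ
        induction σ using Quotient.inductionOn' with | _ σ
        have hc : Continuous fun u : Fin (k + l) → V => (Equiv.Perm.sign σ : ℤ) •
            (φ (fun i => u (finSumFinEquiv (σ (Sum.inl i)))) *
              ψ (fun i => u (finSumFinEquiv (σ (Sum.inr i))))) :=
          Continuous.zsmul (Continuous.mul (φ.cont.comp (by fun_prop))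
            (ψ.cont.comp (by fun_prop))) _
        refine hc.congr fun u => ?_
        rw [AlternatingMap.domCoprod.summand_mk'']
        change _ = LinearMap.mul' ℝ ℝ ((Equiv.Perm.sign σ : ℤ) •
          ((MultilinearMap.domCoprod (φ.toAlternatingMap : MultilinearMap ℝ _ ℝ)
            (ψ.toAlternatingMap : MultilinearMap ℝ _ ℝ)).domDomCongr σ)
              fun i => u (finSumFinEquiv i))
        rw [map_zsmul]
        rfl
      have h := continuous_finsetSum Finset.univ (fun σ _ => key σ)
      refine h.congr fun u => ?_
      rw [← map_sum, ← sum_apply]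
      rfl }

/-- The interior product `i(v) φ = φ(v, ·, …, ·)`. -/
def interior {k : ℕ} (v : V) (φ : V [⋀^Fin (k + 1)]→L[ℝ] ℝ) : V [⋀^Fin k]→L[ℝ] ℝ :=
  { φ.toAlternatingMap.curryLeft v with
    cont := φ.cont.comp (continuous_const.matrixVecCons continuous_id) }

theorem interior_apply {k : ℕ} (v : V) (φ : V [⋀^Fin (k + 1)]→L[ℝ] ℝ) (u : Fin k → V) :
    interior v φ u = φ (Matrix.vecCons v u) := rfl

/-- `L φ = Ω ∧ φ` for a `2`-covector `Ω`. -/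
def lef (Ω : V [⋀^Fin 2]→L[ℝ] ℝ) {k : ℕ} (φ : V [⋀^Fin k]→L[ℝ] ℝ) : V [⋀^Fin (k + 2)]→L[ℝ] ℝ :=
  castDeg (Nat.add_comm 2 k) (wedge Ω φ)

/-- The iterated operator `L ^ r`, raising the degree by `2 r`. -/
def lefPow (Ω : V [⋀^Fin 2]→L[ℝ] ℝ) {k : ℕ} (φ : V [⋀^Fin k]→L[ℝ] ℝ) :
    (r : ℕ) → V [⋀^Fin (k + 2 * r)]→L[ℝ] ℝ
  | 0 => φ
  | r + 1 => lef Ω (lefPow Ω φ r)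

/-- The power `Ω ^ n = Ω ∧ ⋯ ∧ Ω`, with `Ω ^ 0 = 1`. -/
def omegaPow (Ω : V [⋀^Fin 2]→L[ℝ] ℝ) : (n : ℕ) → V [⋀^Fin (2 * n)]→L[ℝ] ℝ
  | 0 => ContinuousAlternatingMap.constOfIsEmpty ℝ V (Fin 0) 1
  | n + 1 => lef Ω (omegaPow Ω n)

/-- The transversal volume `ν = Ω ^ n / n!`. -/
def nu (n : ℕ) (Ω : V [⋀^Fin 2]→L[ℝ] ℝ) : V [⋀^Fin (2 * n)]→L[ℝ] ℝ :=
  ((n.factorial : ℝ)⁻¹) • omegaPow Ω n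

/-- `♭(a) = i(a) Ω = Ω(a, ·)`. -/
def flat (Ω : V [⋀^Fin 2]→L[ℝ] ℝ) (a : V) : V →L[ℝ] ℝ :=
  Ω.toContinuousLinearMap ![a, 0] 1

theorem flat_apply (Ω : V [⋀^Fin 2]→L[ℝ] ℝ) (a u : V) : flat Ω a u = Ω ![a, u] := by
  change Ω (Function.update ![a, 0] 1 u) = Ω ![a, u]
  congr 1
  funext i
  fin_cases i <;> rfl

/-- The wedge product `α₁ ∧ ⋯ ∧ αₖ` of `1`-covectors, `u ↦ det (αᵢ(uⱼ))`. -/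
def wedgeFamily {k : ℕ} (α : Fin k → V →L[ℝ] ℝ) : V [⋀^Fin k]→L[ℝ] ℝ :=
  { (Matrix.detRowAlternating (n := Fin k) (R := ℝ)).compLinearMap
      (LinearMap.pi fun i => (α i : V →ₗ[ℝ] ℝ)) with
    cont := by
      change Continuous fun u : Fin k → V => Matrix.det (Matrix.of fun j i => α i (u j))
      exact Continuous.matrix_det (continuous_matrix fun j i =>
        (α i).continuous.comp (continuous_apply j)) }

theorem wedgeFamily_apply {k : ℕ} (α : Fin k → V →L[ℝ] ℝ) (u : Fin k → V) :
    wedgeFamily α u = Matrix.det (Matrix.of fun i j => α i (u j)) := by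
  rw [← Matrix.det_transpose]
  rfl

/-- The space `Λ^k Q*` of transverse `k`-covectors: those that vanish as soon as one of their
arguments lies in the tangent space of the leaf, which is the kernel of `Ω`. -/
def IsTransverse (Ω : V [⋀^Fin 2]→L[ℝ] ℝ) {k : ℕ} (φ : V [⋀^Fin k]→L[ℝ] ℝ) : Prop :=
  ∀ (u : Fin k → V) (i : Fin k), flat Ω (u i) = 0 → φ u = 0

/-- `S` is the transversal symplectic star operator `Λ^k Q* → Λ^l Q*`, `k + l = 2 n`: it is linear,
maps transverse covectors to transverse covectors and satisfies `φ ∧ S ψ = Ω(φ, ψ) ν` for transverse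
`φ, ψ`. Here `Ω(·, ·)` is the bilinear form on `Λ^k Q*` with
`Ω(φ₁ ∧ ⋯ ∧ φₖ, ψ₁ ∧ ⋯ ∧ ψₖ) = det (Ω(φᵢ♯, ψⱼ♯))`; the elements of `Q*` are the `♭(a)`, with
`♭(a)♯ = a` modulo the kernel of `Ω`, and the identity is bilinear in `(φ, ψ)`, so it is imposed for
`φ = ♭(a₁) ∧ ⋯ ∧ ♭(aₖ)` and `ψ = ♭(b₁) ∧ ⋯ ∧ ♭(bₖ)`, which span `Λ^k Q*`. This determines `S` on
`Λ^k Q*`. -/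
structure IsSymplecticStar (n : ℕ) (Ω : V [⋀^Fin 2]→L[ℝ] ℝ) {k l : ℕ} (h : k + l = 2 * n)
    (S : (V [⋀^Fin k]→L[ℝ] ℝ) →ₗ[ℝ] (V [⋀^Fin l]→L[ℝ] ℝ)) : Prop where
  transverse : ∀ ψ, IsTransverse Ω ψ → IsTransverse Ω (S ψ)
  wedge_eq : ∀ a b : Fin k → V,
    castDeg h (wedge (wedgeFamily fun i => flat Ω (a i)) (S (wedgeFamily fun i => flat Ω (b i)))) =
      Matrix.det (Matrix.of fun i j => Ω ![a i, b j]) • nu n Ω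

open Classical in
/-- The transversal symplectic star operator from degree `k` to degree `l`. It is meaningful for
`k + l = 2 n`, on transverse covectors; it is set to `0` in the other degrees. -/
def symplecticStar (n : ℕ) (Ω : V [⋀^Fin 2]→L[ℝ] ℝ) (k l : ℕ) :
    (V [⋀^Fin k]→L[ℝ] ℝ) →ₗ[ℝ] (V [⋀^Fin l]→L[ℝ] ℝ) :=
  if h : ∃ (hd : k + l = 2 * n) (S : (V [⋀^Fin k]→L[ℝ] ℝ) →ₗ[ℝ] (V [⋀^Fin l]→L[ℝ] ℝ)),
      IsSymplecticStar n Ω hd S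
  then h.choose_spec.choose else 0

end Pointwise

/-! ### Differential forms on a manifold -/

section Manifold

variable {m : ℕ} {M : Type*} [TopologicalSpace M] [ChartedSpace (EuclideanSpace ℝ (Fin m)) M]

variable (m M) in
/-- Differential forms of degree `k` on `M`, without any regularity. -/
abbrev DForm (k : ℕ) : Type _ :=
  ∀ x : M, TangentSpace (𝓡 m) x [⋀^Fin k]→L[ℝ] ℝ

variable (m M) in
/-- Vector fields on `M`, without any regularity. -/
abbrev VField : Type _ :=
  ∀ x : M, TangentSpace (𝓡 m) x

/-- A vector field is smooth if it is a smooth section of the tangent bundle. -/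
def IsSmoothField [IsManifold (𝓡 m) ∞ M] (X : VField m M) : Prop :=
  ContMDiff (𝓡 m) (𝓡 m).tangent ∞ (fun x => (⟨x, X x⟩ : TangentBundle (𝓡 m) M))

/-- The expression of a form in the chart `e`: its pullback under `e.symm`. -/
def inChart (e : OpenPartialHomeomorph M (EuclideanSpace ℝ (Fin m))) {k : ℕ} (φ : DForm m M k)
    (y : EuclideanSpace ℝ (Fin m)) : EuclideanSpace ℝ (Fin m) [⋀^Fin k]→L[ℝ] ℝ :=
  (φ (e.symm y)).compContinuousLinearMap
    (mfderiv (𝓡 m) (𝓡 m) e.symm y : EuclideanSpace ℝ (Fin m) →L[ℝ] TangentSpace (𝓡 m) (e.symm y))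

/-- A form is smooth if its expression in every chart of the atlas is smooth. -/
def IsSmoothForm {k : ℕ} (φ : DForm m M k) : Prop :=
  ∀ e ∈ atlas (EuclideanSpace ℝ (Fin m)) M, ContDiffOn ℝ ∞ (inChart e φ) e.target

/-- The exterior derivative, computed at `x` in the preferred chart at `x`. -/
def extD {k : ℕ} (φ : DForm m M k) : DForm m M (k + 1) := fun x =>
  (extDeriv (inChart (chartAt (EuclideanSpace ℝ (Fin m)) x) φ)
      (chartAt (EuclideanSpace ℝ (Fin m)) x x)).compContinuousLinearMap
    (mfderiv (𝓡 m) (𝓡 m) (chartAt (EuclideanSpace ℝ (Fin m)) x) x :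
      TangentSpace (𝓡 m) x →L[ℝ] EuclideanSpace ℝ (Fin m))

/-- The interior product `i(X) φ` of a form with a vector field. -/
def contract {k : ℕ} (X : VField m M) (φ : DForm m M (k + 1)) : DForm m M k :=
  fun x => interior (X x) (φ x)

/-- The Lie derivative of forms, `θ(X) = d i(X) + i(X) d`. -/
def lieD (X : VField m M) : {k : ℕ} → DForm m M k → DForm m M k
  | 0, φ => contract X (extD φ)
  | _ + 1, φ => extD (contract X φ) + contract X (extD φ)

/-- The operator `L ^ r φ = Ω ^ r ∧ φ` on forms. -/
def lefschetzPow (Ω : DForm m M 2) {k : ℕ} (r : ℕ) (φ : DForm m M k) : DForm m M (k + 2 * r) :=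
  fun x => lefPow (Ω x) (φ x) r

/-- The transversal symplectic star operator on forms, from degree `k` to degree `l`. -/
def starForm (n : ℕ) (Ω : DForm m M 2) {k : ℕ} (l : ℕ) (φ : DForm m M k) : DForm m M l :=
  fun x => symplecticStar n (Ω x) k l (φ x)

/-- The operator `δ_T = (-1) ^ k ⋆ d ⋆` on forms of degree `k`, through the degrees
`k → 2 n - k → 2 n - k + 1 → k - 1`. (For `k = 0` the middle form has degree `2 n + 1`, and
the result is `0`.) -/
def deltaT (n : ℕ) (Ω : DForm m M 2) {k : ℕ} (φ : DForm m M k) : DForm m M (k - 1) :=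
  ((-1 : ℝ) ^ k) • starForm n Ω (k - 1) (extD (starForm n Ω (2 * n - k) φ))

end Manifold

/-! ### Foliations -/

section Foliation

/-- A smooth foliation of dimension `p` and codimension `q` on a manifold of dimension `p + q`, given
by its tangent distribution `T𝓕`: around every point there is a smooth chart (a foliated chart) in
which the leaves are the slices on which the last `q` coordinates are constant, so that `T𝓕` consists
there of the vectors along which the last `q` coordinates have derivative zero. -/
structure Foliation (p q : ℕ) (M : Type*) [TopologicalSpace M]
    [ChartedSpace (EuclideanSpace ℝ (Fin (p + q))) M] [IsManifold (𝓡 (p + q)) ∞ M] where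
  tangent : ∀ x : M, Submodule ℝ (TangentSpace (𝓡 (p + q)) x)
  exists_foliated_chart : ∀ x₀ : M, ∃ e ∈ IsManifold.maximalAtlas (𝓡 (p + q)) ∞ M,
    x₀ ∈ e.source ∧ ∀ x ∈ e.source, ∀ v : TangentSpace (𝓡 (p + q)) x,
      v ∈ tangent x ↔ ∀ j : Fin q,
        (show EuclideanSpace ℝ (Fin (p + q)) from mfderiv (𝓡 (p + q)) (𝓡 (p + q)) e x v)
          (Fin.natAdd p j) = 0

variable {p q : ℕ} {M : Type*} [TopologicalSpace M]
  [ChartedSpace (EuclideanSpace ℝ (Fin (p + q))) M] [IsManifold (𝓡 (p + q)) ∞ M]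

/-- The condition `i(X) φ = 0` in all degrees; for functions it is void. -/
def contractVanishes (X : VField (p + q) M) : {k : ℕ} → DForm (p + q) M k → Prop
  | 0, _ => True
  | _ + 1, φ => contract X φ = 0

/-- `φ` is a basic form: it is smooth, and `i(X) φ = θ(X) φ = 0` for all smooth vector fields `X`
tangent to the foliation. -/
structure IsBasic (F : Foliation p q M) {k : ℕ} (φ : DForm (p + q) M k) : Prop where
  smooth : IsSmoothForm φ
  contract_eq : ∀ X : VField (p + q) M, IsSmoothField X → (∀ x, X x ∈ F.tangent x) →
    contractVanishes X φ
  lie_eq : ∀ X : VField (p + q) M, IsSmoothField X → (∀ x, X x ∈ F.tangent x) → lieD X φ = 0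

/-- `Ω` is transversely symplectic with respect to the foliation: a smooth closed `2`-form whose
kernel at each point is the tangent space of the leaf. -/
structure IsTransverselySymplectic (F : Foliation p q M) (Ω : DForm (p + q) M 2) : Prop where
  smooth : IsSmoothForm Ω
  closed : extD Ω = 0
  ker_eq : ∀ (x : M) (v : TangentSpace (𝓡 (p + q)) x),
    v ∈ F.tangent x ↔ flat (Ω x) v = 0

/-- The normally symplectic harmonic forms of degree `k`: the basic forms with
`d_B φ = δ_T φ = 0`. -/
def harmonicST {n : ℕ} {M : Type*} [TopologicalSpace M]
    [ChartedSpace (EuclideanSpace ℝ (Fin (p + 2 * n))) M] [IsManifold (𝓡 (p + 2 * n)) ∞ M]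
    (F : Foliation p (2 * n) M) (Ω : DForm (p + 2 * n) M 2) (k : ℕ) :
    Set (DForm (p + 2 * n) M k) :=
  {φ | IsBasic F φ ∧ extD φ = 0 ∧ deltaT n Ω φ = 0}

end Foliation

end TransverseSymplectic

end

/-! The theorem is hard Lefschetz for a space stable under the Lefschetz `sl₂`-action. At each point
take a frame `x, y` of a complement of the leaf direction, dual under `Ω` (`IsFrame`), and put `Λ =
½ ∑ i(yᵢ) i(xᵢ)`. On transverse covectors `[Λ, L] = n - deg` (`IsFrame.lamOp_lefOp`), so `L`, `Λ`
and the degree generate `sl₂`.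

The central identity is `δ_T = [d, Λ]` on basic forms (`IsLefschetzDifferential.star_d_star`). It is
checked on `L ^ j ψ` with `ψ` primitive of degree `m`. There, with `N = n - m - j`, the star
operator gives `(-1) ^ (m (m - 1) / 2) (j! / N!) L ^ N ψ` (`IsFrame.starAux_lefPow`), while `d ψ = α
+ L β` with `α`, `β` primitive, because `d` commutes with `L`. Hence a basic form of pure degree is
harmonic exactly when `d φ = 0` and `d Λ φ = 0`. This condition is stable under `L` by the
commutation relation, and under `Λ` because `[d, Λ]` commutes with `Λ`
(`IsLefschetzDifferential.d_lower_lower`).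

Injectivity of `L ^ r` from degree `n - r` to `n + r` is already true pointwise. For surjectivity, a
harmonic `ψ` has a pointwise preimage `φ` without any regularity. The division lemma
`IsLefschetzTriple.mem_of_pow_mem` repairs this: an `L`- and `Λ`-stable subspace that contains `L ^
r φ`, with `deg φ + r ≤ n`, contains `φ`. It is applied first to smooth transverse forms and then to
harmonic forms.

The geometric input is that `Λ` does not depend on the frame and so preserves smoothness
(`isSmoothForm_lamOp`), that basic forms are the smooth forms transverse together with their
differential (`isBasic_iff`), and that the kernel of a closed form is involutive
(`interior_interior_extD`), which makes basicness divisible by `L ^ r`. Operators act on families of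
forms of all degrees, so that operators of different degrees can be composed without casts. -/

noncomputable section

namespace TransverseSymplectic

/-! ### Exterior multiplication, contraction, and graded forms -/

section Graded

variable {V : Type*} [AddCommGroup V] [Module ℝ V] [TopologicalSpace V]

/-- Exterior multiplication `φ ↦ α ∧ φ` by a `1`-covector. -/
def extMul (α : V →L[ℝ] ℝ) (k : ℕ) :
    (V [⋀^Fin k]→L[ℝ] ℝ) →ₗ[ℝ] (V [⋀^Fin (k + 1)]→L[ℝ] ℝ) where
  toFun φ :=
    { AlternatingMap.alternatizeUncurryFin
        ((α : V →ₗ[ℝ] ℝ).smulRight φ.toAlternatingMap) with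
      cont := by
        have h : Continuous fun u : Fin (k + 1) → V =>
            ∑ i : Fin (k + 1), (-1 : ℤ) ^ (i : ℕ) • (α (u i) * φ (i.removeNth u)) := by
          refine continuous_finsetSum _ fun i _ => ?_
          refine Continuous.zsmul (Continuous.mul (α.continuous.comp (continuous_apply i))
            (φ.cont.comp ?_)) _
          exact continuous_pi fun j => continuous_apply _
        exact h.congr fun u => (AlternatingMap.alternatizeUncurryFin_apply
          ((α : V →ₗ[ℝ] ℝ).smulRight φ.toAlternatingMap) u).symm }
  map_add' φ ψ := by
    apply ContinuousAlternatingMap.toAlternatingMap_injective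
    change AlternatingMap.alternatizeUncurryFin _ = AlternatingMap.alternatizeUncurryFin _ +
      AlternatingMap.alternatizeUncurryFin _
    rw [← AlternatingMap.alternatizeUncurryFin_add]
    congr 1
    ext v w
    simp
  map_smul' c φ := by
    refine ContinuousAlternatingMap.ext fun u => ?_
    change AlternatingMap.alternatizeUncurryFin ((α : V →ₗ[ℝ] ℝ).smulRight
        (c • φ.toAlternatingMap)) u =
      c * AlternatingMap.alternatizeUncurryFin ((α : V →ₗ[ℝ] ℝ).smulRight φ.toAlternatingMap) u
    rw [AlternatingMap.alternatizeUncurryFin_apply, AlternatingMap.alternatizeUncurryFin_apply,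
      Finset.mul_sum]
    refine Finset.sum_congr rfl fun i _ => ?_
    simp [mul_left_comm]

theorem extMul_apply (α : V →L[ℝ] ℝ) {k : ℕ} (φ : V [⋀^Fin k]→L[ℝ] ℝ) (u : Fin (k + 1) → V) :
    extMul α k φ u = ∑ i : Fin (k + 1), (-1) ^ (i : ℕ) * (α (u i) * φ (i.removeNth u)) := by
  refine (AlternatingMap.alternatizeUncurryFin_apply _ u).trans ?_
  refine Finset.sum_congr rfl fun i _ => ?_
  simp

theorem extMul_add_left (α β : V →L[ℝ] ℝ) (k : ℕ) : extMul (α + β) k = extMul α k + extMul β k := by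
  ext φ u
  simp [extMul_apply, add_mul, mul_add, Finset.sum_add_distrib]

theorem extMul_smul_left (c : ℝ) (α : V →L[ℝ] ℝ) (k : ℕ) : extMul (c • α) k = c • extMul α k := by
  ext φ u
  simp [extMul_apply, Finset.mul_sum, mul_left_comm, mul_assoc]

/-- The interior product as a linear map. -/
def interiorₗ (v : V) (k : ℕ) : (V [⋀^Fin (k + 1)]→L[ℝ] ℝ) →ₗ[ℝ] (V [⋀^Fin k]→L[ℝ] ℝ) where
  toFun := interior v
  map_add' _ _ := rfl
  map_smul' _ _ := rfl

theorem interior_add_left (v w : V) {k : ℕ} (φ : V [⋀^Fin (k + 1)]→L[ℝ] ℝ) :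
    interior (v + w) φ = interior v φ + interior w φ := by
  ext u
  exact φ.vecCons_add u v w

theorem interior_smul_left (c : ℝ) (v : V) {k : ℕ} (φ : V [⋀^Fin (k + 1)]→L[ℝ] ℝ) :
    interior (c • v) φ = c • interior v φ := by
  ext u
  exact φ.vecCons_smul u c v

theorem interior_extMul_zero (v : V) (α : V →L[ℝ] ℝ) (φ : V [⋀^Fin 0]→L[ℝ] ℝ) :
    interior v (extMul α 0 φ) = α v • φ := by
  refine ContinuousAlternatingMap.ext fun u => ?_
  rw [interior_apply, extMul_apply, ContinuousAlternatingMap.smul_apply, Fin.sum_univ_one]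
  simp only [Fin.val_zero, pow_zero, one_mul, Matrix.cons_val_zero, smul_eq_mul]
  congr 2

/-- In the sum defining `α ∧ φ` at `(v, u)`, the first term feeds `v` to `α`. All others keep `v` as
the first argument of `φ`, and the index shift by one flips their sign. -/
theorem interior_extMul_succ (v : V) (α : V →L[ℝ] ℝ) {k : ℕ} (φ : V [⋀^Fin (k + 1)]→L[ℝ] ℝ) :
    interior v (extMul α (k + 1) φ) = α v • φ - extMul α k (interior v φ) := by
  refine ContinuousAlternatingMap.ext fun u => ?_
  rw [interior_apply, extMul_apply, Fin.sum_univ_succ]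
  rw [ContinuousAlternatingMap.sub_apply, ContinuousAlternatingMap.smul_apply, extMul_apply,
    sub_eq_add_neg, ← Finset.sum_neg_distrib]
  congr 1
  · simp
  · refine Finset.sum_congr rfl fun i _ => ?_
    have : (i.succ.removeNth (Matrix.vecCons v u) : Fin (k + 1) → V) =
        Matrix.vecCons v (i.removeNth u) := by
      funext j
      refine Fin.cases ?_ (fun j => ?_) j
      · simp [Fin.removeNth]
      · simp [Fin.removeNth]
    rw [this, interior_apply]
    simp [pow_succ]

theorem interior_interior (v w : V) {k : ℕ} (φ : V [⋀^Fin (k + 2)]→L[ℝ] ℝ) :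
    interior v (interior w φ) = -interior w (interior v φ) := by
  ext u
  have h := φ.toAlternatingMap.map_swap (Matrix.vecCons v (Matrix.vecCons w u))
    (i := 0) (j := 1) (by simp)
  have h2 : (Matrix.vecCons v (Matrix.vecCons w u) : Fin (k + 2) → V) ∘ Equiv.swap 0 1 =
      Matrix.vecCons w (Matrix.vecCons v u) := by
    funext j
    refine Fin.cases ?_ (fun j => ?_) j
    · simp
    · refine Fin.cases ?_ (fun j => ?_) j
      · simp
      · have : Equiv.swap (0 : Fin (k + 2)) 1 j.succ.succ = j.succ.succ :=
          Equiv.swap_apply_of_ne_of_ne (Fin.succ_ne_zero _) (by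
            rw [← Fin.succ_zero_eq_one]
            exact fun h => Fin.succ_ne_zero _ (Fin.succ_injective _ h))
        simp [this]
  rw [h2] at h
  exact h

variable (V) in
/-- Inhomogeneous forms: families of covectors, one in every degree. -/
abbrev GForm : Type _ := ∀ k : ℕ, V [⋀^Fin k]→L[ℝ] ℝ

instance : Ring (Module.End ℝ (GForm V)) :=
  @Module.End.instRing ℝ (GForm V) _ inferInstance _

/-- A covector as an inhomogeneous form. -/
def gr (k : ℕ) : (V [⋀^Fin k]→L[ℝ] ℝ) →ₗ[ℝ] GForm V := LinearMap.single ℝ (fun k => V [⋀^Fin k]→L[ℝ] ℝ) k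

theorem gr_same (k : ℕ) (φ : V [⋀^Fin k]→L[ℝ] ℝ) : gr k φ k = φ := by
  simp [gr]

theorem gr_of_ne {k l : ℕ} (h : l ≠ k) (φ : V [⋀^Fin k]→L[ℝ] ℝ) : gr k φ l = 0 := by
  simp [gr, h]

theorem gr_injective (k : ℕ) : Function.Injective (gr k : _ →ₗ[ℝ] GForm V) := by
  intro φ ψ h
  rw [← gr_same k φ, h, gr_same]

/-- Casts between propositionally equal degrees disappear in `GForm`; identities between covectors
of different degree expressions are therefore proved after applying the injective map `gr`. -/
theorem gr_castDeg {k l : ℕ} (h : k = l) (φ : V [⋀^Fin k]→L[ℝ] ℝ) : gr l (castDeg h φ) = gr k φ := by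
  subst h
  rfl

/-- Exterior multiplication by a `1`-covector on inhomogeneous forms. -/
def eps (α : V →L[ℝ] ℝ) : Module.End ℝ (GForm V) where
  toFun Φ
    | 0 => 0
    | k + 1 => extMul α k (Φ k)
  map_add' Φ Ψ := by
    funext k
    cases k with
    | zero => exact (add_zero (0 : V [⋀^Fin 0]→L[ℝ] ℝ)).symm
    | succ k => exact map_add (extMul α k) _ _
  map_smul' c Φ := by
    funext k
    cases k with
    | zero => exact (smul_zero (A := V [⋀^Fin 0]→L[ℝ] ℝ) c).symm
    | succ k => exact map_smul (extMul α k) _ _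

theorem eps_zero (α : V →L[ℝ] ℝ) (Φ : GForm V) : eps α Φ 0 = 0 := rfl

theorem eps_succ (α : V →L[ℝ] ℝ) (Φ : GForm V) (k : ℕ) :
    eps α Φ (k + 1) = extMul α k (Φ k) := rfl

theorem eps_gr (α : V →L[ℝ] ℝ) {k : ℕ} (φ : V [⋀^Fin k]→L[ℝ] ℝ) :
    eps α (gr k φ) = gr (k + 1) (extMul α k φ) := by
  funext l
  cases l with
  | zero => rw [eps_zero, gr_of_ne (by simp)]
  | succ l =>
    rw [eps_succ]
    by_cases h : l = k
    · subst h
      rw [gr_same, gr_same]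
    · rw [gr_of_ne h, gr_of_ne (by simpa using h), map_zero]

/-- Contraction with a vector on inhomogeneous forms. -/
def iota (v : V) : Module.End ℝ (GForm V) where
  toFun Φ k := interior v (Φ (k + 1))
  map_add' _ _ := rfl
  map_smul' _ _ := rfl

theorem iota_apply (v : V) (Φ : GForm V) (k : ℕ) : iota v Φ k = interior v (Φ (k + 1)) := rfl

theorem iota_gr (v : V) {k : ℕ} (φ : V [⋀^Fin (k + 1)]→L[ℝ] ℝ) :
    iota v (gr (k + 1) φ) = gr k (interior v φ) := by
  funext l
  rw [iota_apply]
  by_cases h : l = k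
  · subst h
    rw [gr_same, gr_same]
  · rw [gr_of_ne h, gr_of_ne (by simpa using h)]
    exact map_zero (interiorₗ v l)

theorem iota_gr_zero (v : V) (φ : V [⋀^Fin 0]→L[ℝ] ℝ) : iota v (gr 0 φ) = 0 := by
  funext l
  rw [iota_apply, gr_of_ne (by simp)]
  exact map_zero (interiorₗ v l)

theorem eps_add (α β : V →L[ℝ] ℝ) : eps (α + β) = eps α + eps β := by
  refine LinearMap.ext fun Φ => funext fun k => ?_
  cases k with
  | zero => exact (add_zero (0 : V [⋀^Fin 0]→L[ℝ] ℝ)).symm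
  | succ k => simp [eps_succ, extMul_add_left]

theorem eps_smul (c : ℝ) (α : V →L[ℝ] ℝ) : eps (c • α) = c • eps α := by
  refine LinearMap.ext fun Φ => funext fun k => ?_
  cases k with
  | zero => exact (smul_zero (A := V [⋀^Fin 0]→L[ℝ] ℝ) c).symm
  | succ k => simp [eps_succ, extMul_smul_left]

/-- `eps` as a linear map. -/
def epsₗ : (V →L[ℝ] ℝ) →ₗ[ℝ] Module.End ℝ (GForm V) where
  toFun := eps
  map_add' := eps_add
  map_smul' := eps_smul

/-- `iota` as a linear map. -/
def iotaₗ : V →ₗ[ℝ] Module.End ℝ (GForm V) where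
  toFun := iota
  map_add' v w := LinearMap.ext fun Φ => funext fun k => interior_add_left v w (Φ (k + 1))
  map_smul' c v := LinearMap.ext fun Φ => funext fun k => interior_smul_left c v (Φ (k + 1))

/-- The Clifford relation between contraction and exterior multiplication. -/
theorem iota_mul_eps (v : V) (α : V →L[ℝ] ℝ) : iota v * eps α = α v • 1 - eps α * iota v := by
  refine LinearMap.ext fun Φ => funext fun k => ?_
  cases k with
  | zero => exact (interior_extMul_zero v α (Φ 0)).trans (sub_zero _).symm
  | succ k => exact interior_extMul_succ v α (Φ (k + 1))

theorem iota_mul_iota (v w : V) : iota v * iota w = -(iota w * iota v) :=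
  LinearMap.ext fun Φ => funext fun k => interior_interior v w (Φ (k + 2))

end Graded

/-! ### The wedge product in terms of exterior multiplication -/

section Wedge

variable {V : Type*} [AddCommGroup V] [Module ℝ V] [TopologicalSpace V]

theorem wedge_apply {k l : ℕ} (φ : V [⋀^Fin k]→L[ℝ] ℝ) (ψ : V [⋀^Fin l]→L[ℝ] ℝ)
    (u : Fin (k + l) → V) :
    wedge φ ψ u = LinearMap.mul' ℝ ℝ
      (AlternatingMap.domCoprod' (φ.toAlternatingMap ⊗ₜ[ℝ] ψ.toAlternatingMap)
        (fun i => u (finSumFinEquiv i))) := rfl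

/-- The wedge product as a bilinear map. -/
def wedgeₗ (k l : ℕ) : (V [⋀^Fin k]→L[ℝ] ℝ) →ₗ[ℝ] (V [⋀^Fin l]→L[ℝ] ℝ) →ₗ[ℝ]
    (V [⋀^Fin (k + l)]→L[ℝ] ℝ) :=
  LinearMap.mk₂ ℝ wedge
    (fun φ φ' ψ => ContinuousAlternatingMap.ext fun u => by
      simp only [ContinuousAlternatingMap.add_apply, wedge_apply,
        ContinuousAlternatingMap.toAlternatingMap_add, TensorProduct.add_tmul, map_add,
        AlternatingMap.add_apply])
    (fun c φ ψ => ContinuousAlternatingMap.ext fun u => by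
      simp only [ContinuousAlternatingMap.smul_apply, wedge_apply,
        ContinuousAlternatingMap.toAlternatingMap_smul, map_smul, ← TensorProduct.smul_tmul',
        AlternatingMap.smul_apply])
    (fun φ ψ ψ' => ContinuousAlternatingMap.ext fun u => by
      simp only [ContinuousAlternatingMap.add_apply, wedge_apply,
        ContinuousAlternatingMap.toAlternatingMap_add, TensorProduct.tmul_add, map_add,
        AlternatingMap.add_apply])
    (fun c φ ψ => ContinuousAlternatingMap.ext fun u => by
      simp only [ContinuousAlternatingMap.smul_apply, wedge_apply,
        ContinuousAlternatingMap.toAlternatingMap_smul, TensorProduct.tmul_smul, map_smul,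
        AlternatingMap.smul_apply])

theorem wedgeₗ_apply {k l : ℕ} (φ : V [⋀^Fin k]→L[ℝ] ℝ) (ψ : V [⋀^Fin l]→L[ℝ] ℝ) :
    wedgeₗ k l φ ψ = wedge φ ψ := rfl

/-- The decomposable multilinear map `u ↦ ∏ i, α i (u i)`. -/
def prodMultilinear {ι : Type*} [Fintype ι] (α : ι → V →L[ℝ] ℝ) :
    MultilinearMap ℝ (fun _ : ι => V) ℝ :=
  (MultilinearMap.mkPiAlgebra ℝ ι ℝ).compLinearMap fun i => (α i : V →ₗ[ℝ] ℝ)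

theorem prodMultilinear_apply {ι : Type*} [Fintype ι] (α : ι → V →L[ℝ] ℝ) (u : ι → V) :
    prodMultilinear α u = ∏ i, α i (u i) := by
  simp [prodMultilinear]

theorem alternatization_prodMultilinear {ι : Type*} [Fintype ι] [DecidableEq ι]
    (α : ι → V →L[ℝ] ℝ) (u : ι → V) :
    MultilinearMap.alternatization (prodMultilinear α) u =
      Matrix.det (Matrix.of fun i j => α i (u j)) := by
  rw [MultilinearMap.alternatization_apply, ← Matrix.det_transpose, Matrix.det_apply]
  refine Finset.sum_congr rfl fun σ _ => ?_
  simp [prodMultilinear_apply]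

theorem wedgeFamily_toAlternatingMap {k : ℕ} (α : Fin k → V →L[ℝ] ℝ) :
    (wedgeFamily α).toAlternatingMap = MultilinearMap.alternatization (prodMultilinear α) :=
  AlternatingMap.ext fun u =>
    (wedgeFamily_apply α u).trans (alternatization_prodMultilinear α u).symm

/-- A determinant is the alternatization of a product of functionals, and the shuffle product of two
alternatizations is the alternatization of the product, without factorial factors. -/
theorem wedge_wedgeFamily {k l : ℕ} (α : Fin k → V →L[ℝ] ℝ) (β : Fin l → V →L[ℝ] ℝ) :
    wedge (wedgeFamily α) (wedgeFamily β) = wedgeFamily (Fin.append α β) := by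
  refine ContinuousAlternatingMap.ext fun u => ?_
  rw [wedge_apply, wedgeFamily_toAlternatingMap, wedgeFamily_toAlternatingMap,
    AlternatingMap.domCoprod'_apply, ← MultilinearMap.domCoprod_alternization,
    MultilinearMap.alternatization_apply, map_sum, wedgeFamily_apply,
    ← Matrix.det_submatrix_equiv_self finSumFinEquiv, ← Matrix.det_transpose, Matrix.det_apply]
  refine Finset.sum_congr rfl fun σ _ => ?_
  rw [Units.smul_def, Units.smul_def, map_zsmul]
  congr 1
  rw [Fintype.prod_sum_type]
  simp [prodMultilinear_apply, MultilinearMap.domCoprod_apply]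

theorem extMul_wedgeFamily {k : ℕ} (α : V →L[ℝ] ℝ) (β : Fin k → V →L[ℝ] ℝ) :
    extMul α k (wedgeFamily β) = wedgeFamily (Fin.cons α β) := by
  refine ContinuousAlternatingMap.ext fun u => ?_
  rw [extMul_apply, wedgeFamily_apply, Matrix.det_succ_row_zero]
  refine Finset.sum_congr rfl fun i _ => ?_
  rw [wedgeFamily_apply]
  simp only [Matrix.of_apply, Fin.cons_zero, mul_assoc]
  rfl

variable (V) in
/-- The constant form `1`. -/
def oneForm : GForm V := gr 0 (ContinuousAlternatingMap.constOfIsEmpty ℝ V (Fin 0) 1)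

/-- The composition of the exterior multiplications by the members of a family. -/
def epsProd {k : ℕ} (α : Fin k → V →L[ℝ] ℝ) : Module.End ℝ (GForm V) :=
  (List.ofFn fun i => eps (α i)).prod

theorem epsProd_zero (α : Fin 0 → V →L[ℝ] ℝ) : epsProd α = 1 := by
  simp [epsProd]

theorem epsProd_succ {k : ℕ} (α : Fin (k + 1) → V →L[ℝ] ℝ) :
    epsProd α = eps (α 0) * epsProd (fun i => α i.succ) := by
  simp [epsProd, List.ofFn_succ]

theorem epsProd_append {k l : ℕ} (α : Fin k → V →L[ℝ] ℝ) (β : Fin l → V →L[ℝ] ℝ) :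
    epsProd (Fin.append α β) = epsProd α * epsProd β := by
  rw [epsProd, epsProd, epsProd, ← List.prod_append, ← List.ofFn_fin_append]
  congr 2
  funext i
  refine Fin.addCases (fun i => ?_) (fun i => ?_) i <;> simp

theorem gr_wedgeFamily {k : ℕ} (α : Fin k → V →L[ℝ] ℝ) :
    gr k (wedgeFamily α) = epsProd α (oneForm V) := by
  induction k with
  | zero =>
    rw [epsProd_zero, oneForm, Module.End.one_apply]
    congr 1
    refine ContinuousAlternatingMap.ext fun u => ?_
    rw [wedgeFamily_apply]
    simp
  | succ k ih =>
    rw [epsProd_succ, Module.End.mul_apply, ← ih, eps_gr, extMul_wedgeFamily]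
    congr 2
    exact (Fin.cons_self_tail α).symm

end Wedge

/-! ### Spanning by decomposable covectors, and associativity of the wedge product -/

section FiniteDimensional

variable {V : Type*} [AddCommGroup V] [Module ℝ V] [TopologicalSpace V]

/-- If `v ↦ ∑ ξᵢ(v) xᵢ` acts as the identity on the arguments of `φ`, then `∑ ξᵢ ∧ i(xᵢ) φ` is the
degree of `φ` times `φ`. -/
theorem sum_extMul_interior {ι : Type*} [Fintype ι] (ξ : ι → V →L[ℝ] ℝ) (x : ι → V) {k : ℕ}
    (φ : V [⋀^Fin (k + 1)]→L[ℝ] ℝ)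
    (h : ∀ v, interior v φ = interior (∑ i, ξ i v • x i) φ) :
    ∑ i, extMul (ξ i) k (interior (x i) φ) = ((k : ℝ) + 1) • φ := by
  refine ContinuousAlternatingMap.ext fun u => ?_
  rw [ContinuousAlternatingMap.sum_apply]
  simp only [extMul_apply]
  rw [Finset.sum_comm]
  -- Moving the `j`-th argument to the front costs `(-1) ^ j`, which cancels the sign of the `j`-th
  -- term. Each of the `k + 1` positions contributes one copy of `φ u`.
  have key : ∀ j : Fin (k + 1), ∑ i, (-1 : ℝ) ^ (j : ℕ) *
      (ξ i (u j) * interior (x i) φ (j.removeNth u)) = φ u := by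
    intro j
    rw [← Finset.mul_sum]
    have h1 : ∑ i, ξ i (u j) * interior (x i) φ (j.removeNth u) =
        interior (u j) φ (j.removeNth u) := by
      rw [h (u j)]
      have h2 : interior (∑ i, ξ i (u j) • x i) φ = ∑ i, ξ i (u j) • interior (x i) φ := by
        let f : V →ₗ[ℝ] (V [⋀^Fin k]→L[ℝ] ℝ) :=
          { toFun := fun v => interior v φ
            map_add' := fun v w => interior_add_left v w φ
            map_smul' := fun c v => interior_smul_left c v φ }
        change f _ = ∑ i, ξ i (u j) • f (x i)
        simp
      rw [h2, ContinuousAlternatingMap.sum_apply]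
      rfl
    have h3 := AlternatingMap.neg_one_pow_smul_map_insertNth φ.toAlternatingMap j (u j)
      (j.removeNth u)
    rw [Fin.insertNth_self_removeNth] at h3
    rw [h1, interior_apply]
    have h4 : φ (Matrix.vecCons (u j) (j.removeNth u)) = (-1 : ℝ) ^ (j : ℕ) * φ u := by
      refine Eq.trans h3.symm ?_
      simp
    rw [h4, ← mul_assoc, ← mul_pow]
    simp
  rw [Finset.sum_congr rfl fun j _ => key j]
  simp

/-- Covectors are spanned by products of the functionals `ξ`, in a class of covectors on which
`∑ ξᵢ(·) xᵢ` acts as the identity. -/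
theorem mem_span_wedgeFamily_comp {ι : Type*} [Fintype ι] (ξ : ι → V →L[ℝ] ℝ) (x : ι → V)
    (S : ∀ k, Submodule ℝ (V [⋀^Fin k]→L[ℝ] ℝ))
    (hS : ∀ k φ i, φ ∈ S (k + 1) → interior (x i) φ ∈ S k)
    (h : ∀ k, ∀ φ ∈ S (k + 1), ∀ v, interior v φ = interior (∑ i, ξ i v • x i) φ)
    {k : ℕ} {φ : V [⋀^Fin k]→L[ℝ] ℝ} (hφ : φ ∈ S k) :
    φ ∈ Submodule.span ℝ (Set.range fun f : Fin k → ι => wedgeFamily fun i => ξ (f i)) := by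
  induction k with
  | zero =>
    have : φ = φ ![] • wedgeFamily (fun i : Fin 0 => ξ (Fin.elim0 i)) := by
      refine ContinuousAlternatingMap.ext fun u => ?_
      rw [ContinuousAlternatingMap.smul_apply, wedgeFamily_apply, Subsingleton.elim u ![]]
      simp
    rw [this]
    exact Submodule.smul_mem _ _ (Submodule.subset_span ⟨fun i => Fin.elim0 i, rfl⟩)
  | succ k ih =>
    have h1 := sum_extMul_interior ξ x φ (h k φ hφ)
    have hk : ((k : ℝ) + 1) ≠ 0 := by positivity
    -- The degree formula solved for `φ` writes it through products `ξᵢ ∧ χ` with `χ` of lower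
    -- degree in the class, which drives the induction.
    have h2 : φ = ((k : ℝ) + 1)⁻¹ • ∑ i, extMul (ξ i) k (interior (x i) φ) := by
      rw [h1, smul_smul, inv_mul_cancel₀ hk, one_smul]
    rw [h2]
    refine Submodule.smul_mem _ _ (Submodule.sum_mem _ fun i _ => ?_)
    have h3 := ih (hS k φ i hφ)
    generalize interior (x i) φ = ψ at h3
    induction h3 using Submodule.span_induction with
    | mem ψ hψ =>
      obtain ⟨f, rfl⟩ := hψ
      refine Submodule.subset_span ⟨Fin.cons i f, ?_⟩
      rw [extMul_wedgeFamily]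
      dsimp only
      congr 1
      funext j
      refine Fin.cases ?_ (fun j => ?_) j <;> simp
    | zero => simp
    | add ψ χ _ _ h1 h2 => rw [map_add]; exact Submodule.add_mem _ h1 h2
    | smul c ψ _ h1 => rw [map_smul]; exact Submodule.smul_mem _ _ h1

theorem span_wedgeFamily_comp {d : ℕ} (ξ : Fin d → V →L[ℝ] ℝ)
    (x : Fin d → V) (h : ∀ v, ∑ i, ξ i v • x i = v) (k : ℕ) :
    Submodule.span ℝ (Set.range fun f : Fin k → Fin d =>
      wedgeFamily fun i => ξ (f i)) = ⊤ :=
  eq_top_iff.2 fun _ _ => mem_span_wedgeFamily_comp ξ x (fun _ => ⊤) (fun _ _ _ _ => trivial)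
    (fun _ _ _ v => by rw [h v]) trivial

variable [IsTopologicalAddGroup V] [ContinuousSMul ℝ V] [T2Space V] [FiniteDimensional ℝ V]

variable (V) in
/-- Coordinates with respect to a fixed basis, as continuous linear functionals. -/
theorem exists_coordinates : ∃ (ξ : Fin (Module.finrank ℝ V) → V →L[ℝ] ℝ)
    (x : Fin (Module.finrank ℝ V) → V), ∀ v, ∑ i, ξ i v • x i = v := by
  let b := Module.finBasis ℝ V
  exact ⟨fun i => LinearMap.toContinuousLinearMap (b.coord i), b, fun v => b.sum_repr v⟩

theorem span_wedgeFamily (k : ℕ) :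
    Submodule.span ℝ (Set.range (wedgeFamily : (Fin k → V →L[ℝ] ℝ) → _)) = ⊤ := by
  obtain ⟨ξ, x, h⟩ := exists_coordinates V
  rw [eq_top_iff, ← span_wedgeFamily_comp ξ x h k]
  exact Submodule.span_mono (by rintro _ ⟨f, rfl⟩; exact ⟨_, rfl⟩)

instance finiteDimensional_covectors (k : ℕ) : FiniteDimensional ℝ (V [⋀^Fin k]→L[ℝ] ℝ) := by
  obtain ⟨ξ, x, h⟩ := exists_coordinates V
  exact ⟨(Submodule.fg_def.2 ⟨_, Set.finite_range _, span_wedgeFamily_comp ξ x h k⟩)⟩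

/-- Two linear maps on covectors agree if they agree on decomposable covectors. -/
theorem covector_hom_ext {W : Type*} [AddCommGroup W] [Module ℝ W] {k : ℕ}
    {f g : (V [⋀^Fin k]→L[ℝ] ℝ) →ₗ[ℝ] W} (h : ∀ α, f (wedgeFamily α) = g (wedgeFamily α)) :
    f = g :=
  LinearMap.ext_on (span_wedgeFamily k) (by rintro _ ⟨α, rfl⟩; exact h α)

theorem covector_induction {k : ℕ} {p : (V [⋀^Fin k]→L[ℝ] ℝ) → Prop}
    (wedgeFamily : ∀ α, p (wedgeFamily α)) (zero : p 0) (add : ∀ φ ψ, p φ → p ψ → p (φ + ψ))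
    (smul : ∀ (c : ℝ) φ, p φ → p (c • φ)) (φ : V [⋀^Fin k]→L[ℝ] ℝ) : p φ := by
  have h : φ ∈ Submodule.span ℝ
      (Set.range (TransverseSymplectic.wedgeFamily : (Fin k → V →L[ℝ] ℝ) → _)) := by
    rw [span_wedgeFamily]
    trivial
  induction h using Submodule.span_induction with
  | mem ψ hψ => obtain ⟨α, rfl⟩ := hψ; exact wedgeFamily α
  | zero => exact zero
  | add ψ χ _ _ h1 h2 => exact add _ _ h1 h2
  | smul c ψ _ h1 => exact smul _ _ h1

/-- Both sides are linear in `ψ`. For decomposable `ψ` they are the product over the concatenated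
family, so associativity of the wedge is associativity of composition. -/
theorem gr_wedge_wedgeFamily {k l : ℕ} (α : Fin k → V →L[ℝ] ℝ) (ψ : V [⋀^Fin l]→L[ℝ] ℝ) :
    gr (k + l) (wedge (wedgeFamily α) ψ) = epsProd α (gr l ψ) := by
  have : gr (k + l) ∘ₗ wedgeₗ k l (wedgeFamily α) = epsProd α ∘ₗ gr l := by
    refine covector_hom_ext fun β => ?_
    simp only [LinearMap.comp_apply, wedgeₗ_apply]
    rw [wedge_wedgeFamily, gr_wedgeFamily, gr_wedgeFamily, epsProd_append]
    rfl
  exact LinearMap.congr_fun this ψ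

theorem gr_wedge_extMul {k l : ℕ} (α : V →L[ℝ] ℝ) (φ : V [⋀^Fin k]→L[ℝ] ℝ)
    (ψ : V [⋀^Fin l]→L[ℝ] ℝ) :
    gr (k + 1 + l) (wedge (extMul α k φ) ψ) = eps α (gr (k + l) (wedge φ ψ)) := by
  have : gr (k + 1 + l) ∘ₗ (wedgeₗ (k + 1) l).flip ψ ∘ₗ extMul α k =
      eps α ∘ₗ gr (k + l) ∘ₗ (wedgeₗ k l).flip ψ := by
    refine covector_hom_ext fun β => ?_
    simp only [LinearMap.comp_apply, LinearMap.flip_apply, wedgeₗ_apply]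
    rw [extMul_wedgeFamily, gr_wedge_wedgeFamily, gr_wedge_wedgeFamily, epsProd_succ]
    rfl
  exact LinearMap.congr_fun this φ

end FiniteDimensional

/-! ### The Lefschetz operator and its adjoint -/

section Lefschetz

variable {V : Type*} [AddCommGroup V] [Module ℝ V] [TopologicalSpace V]

theorem flat_swap (Ω : V [⋀^Fin 2]→L[ℝ] ℝ) (a b : V) : flat Ω a b = -flat Ω b a := by
  rw [flat_apply, flat_apply]
  have h := DFunLike.congr_fun (interior_interior b a Ω) ![]
  exact h

/-- `flat` as a linear map. -/
def flatₗ (Ω : V [⋀^Fin 2]→L[ℝ] ℝ) : V →ₗ[ℝ] V →L[ℝ] ℝ where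
  toFun := flat Ω
  map_add' a b := by
    ext u
    rw [add_apply, flat_swap, map_add, flat_swap Ω a, flat_swap Ω b]
    ring
  map_smul' c a := by
    ext u
    rw [smul_apply, flat_swap, map_smul, RingHom.id_apply, flat_swap Ω a]
    simp

theorem flatₗ_apply (Ω : V [⋀^Fin 2]→L[ℝ] ℝ) (a : V) : flatₗ Ω a = flat Ω a := rfl

theorem flat_neg (Ω : V [⋀^Fin 2]→L[ℝ] ℝ) (a : V) : flat Ω (-a) = -flat Ω a :=
  map_neg (flatₗ Ω) a

theorem gr_lef (Ω : V [⋀^Fin 2]→L[ℝ] ℝ) {k : ℕ} (φ : V [⋀^Fin k]→L[ℝ] ℝ) :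
    gr (k + 2) (lef Ω φ) = gr (2 + k) (wedge Ω φ) :=
  gr_castDeg _ _

/-- `lef` as a bilinear map. -/
def lefₗ (k : ℕ) : (V [⋀^Fin 2]→L[ℝ] ℝ) →ₗ[ℝ] (V [⋀^Fin k]→L[ℝ] ℝ) →ₗ[ℝ]
    (V [⋀^Fin (k + 2)]→L[ℝ] ℝ) :=
  LinearMap.mk₂ ℝ (fun Ω φ => lef Ω φ)
    (fun Ω Ω' φ => gr_injective _ (by
      rw [map_add, gr_lef, gr_lef, gr_lef, ← map_add]
      exact congrArg _ (LinearMap.map_add₂ (wedgeₗ 2 k) Ω Ω' φ)))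
    (fun c Ω φ => gr_injective _ (by
      rw [map_smul, gr_lef, gr_lef, ← map_smul]
      exact congrArg _ (LinearMap.map_smul₂ (wedgeₗ 2 k) c Ω φ)))
    (fun Ω φ φ' => gr_injective _ (by
      rw [map_add, gr_lef, gr_lef, gr_lef, ← map_add]
      exact congrArg _ (map_add (wedgeₗ 2 k Ω) φ φ')))
    (fun c Ω φ => gr_injective _ (by
      rw [map_smul, gr_lef, gr_lef, ← map_smul]
      exact congrArg _ (map_smul (wedgeₗ 2 k Ω) c φ)))

theorem lefₗ_apply (k : ℕ) (Ω : V [⋀^Fin 2]→L[ℝ] ℝ) (φ : V [⋀^Fin k]→L[ℝ] ℝ) :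
    lefₗ k Ω φ = lef Ω φ := rfl

/-- The Lefschetz operator `Φ ↦ Ω ∧ Φ` on inhomogeneous forms. -/
def lefOp : (V [⋀^Fin 2]→L[ℝ] ℝ) →ₗ[ℝ] Module.End ℝ (GForm V) :=
  LinearMap.mk₂ ℝ
    (fun Ω Φ k => match k with
      | 0 => 0
      | 1 => 0
      | k + 2 => lefₗ k Ω (Φ k))
    (fun Ω Ω' Φ => by
      funext k
      match k with
      | 0 => exact (add_zero (0 : V [⋀^Fin 0]→L[ℝ] ℝ)).symm
      | 1 => exact (add_zero (0 : V [⋀^Fin 1]→L[ℝ] ℝ)).symm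
      | k + 2 => exact LinearMap.map_add₂ (lefₗ k) Ω Ω' (Φ k))
    (fun c Ω Φ => by
      funext k
      match k with
      | 0 => exact (smul_zero (A := V [⋀^Fin 0]→L[ℝ] ℝ) c).symm
      | 1 => exact (smul_zero (A := V [⋀^Fin 1]→L[ℝ] ℝ) c).symm
      | k + 2 => exact LinearMap.map_smul₂ (lefₗ k) c Ω (Φ k))
    (fun Ω Φ Φ' => by
      funext k
      match k with
      | 0 => exact (add_zero (0 : V [⋀^Fin 0]→L[ℝ] ℝ)).symm
      | 1 => exact (add_zero (0 : V [⋀^Fin 1]→L[ℝ] ℝ)).symm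
      | k + 2 => exact map_add (lefₗ k Ω) (Φ k) (Φ' k))
    (fun c Ω Φ => by
      funext k
      match k with
      | 0 => exact (smul_zero (A := V [⋀^Fin 0]→L[ℝ] ℝ) c).symm
      | 1 => exact (smul_zero (A := V [⋀^Fin 1]→L[ℝ] ℝ) c).symm
      | k + 2 => exact map_smul (lefₗ k Ω) c (Φ k))

theorem lefOp_zero (Ω : V [⋀^Fin 2]→L[ℝ] ℝ) (Φ : GForm V) : lefOp Ω Φ 0 = 0 := rfl

theorem lefOp_one (Ω : V [⋀^Fin 2]→L[ℝ] ℝ) (Φ : GForm V) : lefOp Ω Φ 1 = 0 := rfl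

theorem lefOp_add_two (Ω : V [⋀^Fin 2]→L[ℝ] ℝ) (Φ : GForm V) (k : ℕ) :
    lefOp Ω Φ (k + 2) = lef Ω (Φ k) := rfl

theorem lefOp_gr (Ω : V [⋀^Fin 2]→L[ℝ] ℝ) {k : ℕ} (φ : V [⋀^Fin k]→L[ℝ] ℝ) :
    lefOp Ω (gr k φ) = gr (k + 2) (lef Ω φ) := by
  funext l
  match l with
  | 0 => rw [lefOp_zero, gr_of_ne (by simp)]
  | 1 => rw [lefOp_one, gr_of_ne (by simp)]
  | l + 2 =>
    rw [lefOp_add_two]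
    by_cases h : l = k
    · subst h
      rw [gr_same, gr_same]
    · rw [gr_of_ne h, gr_of_ne (by simpa using h), ← lefₗ_apply, map_zero]

theorem lefOp_pow_gr (Ω : V [⋀^Fin 2]→L[ℝ] ℝ) {k : ℕ} (φ : V [⋀^Fin k]→L[ℝ] ℝ) (r : ℕ) :
    (lefOp Ω ^ r) (gr k φ) = gr (k + 2 * r) (lefPow Ω φ r) := by
  induction r with
  | zero => rfl
  | succ r ih =>
    rw [pow_succ', Module.End.mul_apply, ih, lefOp_gr]
    rfl

theorem lefOp_pow_oneForm (Ω : V [⋀^Fin 2]→L[ℝ] ℝ) (r : ℕ) :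
    (lefOp Ω ^ r) (oneForm V) = gr (2 * r) (omegaPow Ω r) := by
  induction r with
  | zero => rfl
  | succ r ih =>
    rw [pow_succ', Module.End.mul_apply, ih, lefOp_gr]
    rfl

/-- Inhomogeneous forms annihilated by the contractions with the kernel of `Ω`. -/
def transverse (Ω : V [⋀^Fin 2]→L[ℝ] ℝ) : Submodule ℝ (GForm V) where
  carrier := {Φ | ∀ v, flat Ω v = 0 → iota v Φ = 0}
  add_mem' h1 h2 v hv := by rw [map_add, h1 v hv, h2 v hv, add_zero]
  zero_mem' v _ := map_zero _
  smul_mem' c Φ h v hv := by rw [map_smul, h v hv, smul_zero]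

theorem gr_mem_transverse {Ω : V [⋀^Fin 2]→L[ℝ] ℝ} {k : ℕ} {φ : V [⋀^Fin k]→L[ℝ] ℝ} :
    gr k φ ∈ transverse Ω ↔ IsTransverse Ω φ := by
  cases k with
  | zero => exact ⟨fun _ _ i => Fin.elim0 i, fun _ v _ => iota_gr_zero v φ⟩
  | succ k =>
    constructor
    · intro h u i hi
      have h1 := AlternatingMap.neg_one_pow_smul_map_insertNth φ.toAlternatingMap i (u i)
        (i.removeNth u)
      have h2 := h (u i) hi
      rw [iota_gr] at h2
      have h3 : interior (u i) φ = 0 := gr_injective k (h2.trans (map_zero _).symm)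
      rw [Fin.insertNth_self_removeNth] at h1
      have h4 : φ.toAlternatingMap (Matrix.vecCons (u i) (i.removeNth u)) = 0 :=
        DFunLike.congr_fun h3 (i.removeNth u)
      rw [h4] at h1
      have h5 : φ.toAlternatingMap u = 0 := by
        simpa using h1
      exact h5
    · intro h v hv
      rw [iota_gr]
      have : interior v φ = 0 :=
        ContinuousAlternatingMap.ext fun u => h (Matrix.vecCons v u) 0 hv
      rw [this, map_zero]

theorem apply_mem_transverse {Ω : V [⋀^Fin 2]→L[ℝ] ℝ} {Φ : GForm V} (h : Φ ∈ transverse Ω)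
    (k : ℕ) : IsTransverse Ω (Φ k) := by
  rw [← gr_mem_transverse]
  intro v hv
  cases k with
  | zero => exact iota_gr_zero v _
  | succ k =>
    rw [iota_gr]
    have : interior v (Φ (k + 1)) = 0 := congrFun (h v hv) k
    rw [this, map_zero]

theorem eps_flat_mem_transverse {Ω : V [⋀^Fin 2]→L[ℝ] ℝ} (a : V) {Φ : GForm V}
    (h : Φ ∈ transverse Ω) : eps (flat Ω a) Φ ∈ transverse Ω := by
  intro v hv
  have := LinearMap.congr_fun (iota_mul_eps v (flat Ω a)) Φ
  refine this.trans ?_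
  rw [LinearMap.sub_apply, Module.End.mul_apply, h v hv, map_zero, flat_swap, hv]
  simp

theorem iota_mem_transverse {Ω : V [⋀^Fin 2]→L[ℝ] ℝ} (a : V) {Φ : GForm V}
    (h : Φ ∈ transverse Ω) : iota a Φ ∈ transverse Ω := by
  intro v hv
  have := LinearMap.congr_fun (iota_mul_iota v a) Φ
  refine this.trans ?_
  rw [LinearMap.neg_apply, Module.End.mul_apply, h v hv, map_zero, neg_zero]

theorem oneForm_mem_transverse (Ω : V [⋀^Fin 2]→L[ℝ] ℝ) : oneForm V ∈ transverse Ω :=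
  fun v _ => iota_gr_zero v _

/-- Contraction on transverse forms only depends on the class of the vector modulo the kernel. -/
theorem iota_congr {Ω : V [⋀^Fin 2]→L[ℝ] ℝ} {v w : V} (hvw : flat Ω (v - w) = 0) {Φ : GForm V}
    (h : Φ ∈ transverse Ω) : iota v Φ = iota w Φ := by
  have h1 := h _ hvw
  have h2 : iota (v - w) = iota v - iota w := map_sub iotaₗ v w
  rw [h2, LinearMap.sub_apply] at h1
  exact sub_eq_zero.1 h1

/-- The degree operator. -/
def degOp : Module.End ℝ (GForm V) :=
  LinearMap.pi fun k => (k : ℝ) • LinearMap.proj k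

theorem degOp_apply (Φ : GForm V) (k : ℕ) : degOp Φ k = (k : ℝ) • Φ k := rfl

theorem degOp_gr {k : ℕ} (φ : V [⋀^Fin k]→L[ℝ] ℝ) : degOp (gr k φ) = (k : ℝ) • gr k φ := by
  funext l
  rw [degOp_apply, Pi.smul_apply]
  by_cases h : l = k
  · rw [h]
  · rw [gr_of_ne h, smul_zero, smul_zero]

variable {n : ℕ}

/-- `x` and `y` are `Ω`-dual families whose members span a complement of the kernel of `Ω`. -/
structure IsFrame (Ω : V [⋀^Fin 2]→L[ℝ] ℝ) (x y : Fin (2 * n) → V) : Prop where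
  dual : ∀ i j, flat Ω (x i) (y j) = if i = j then 1 else 0
  expand : ∀ v, flat Ω (v - ∑ i, flat Ω v (y i) • x i) = 0

/-- The remainder `w` is `Ω`-orthogonal to every `xⱼ`, and the `xⱼ` span modulo the kernel, so `w`
is orthogonal to everything. -/
theorem IsFrame.swap {Ω : V [⋀^Fin 2]→L[ℝ] ℝ} {x y : Fin (2 * n) → V} (h : IsFrame Ω x y) :
    IsFrame Ω y (fun i => -x i) where
  dual i j := by
    rw [map_neg, ← flat_swap, h.dual]
    simp only [eq_comm]
  expand v := by
    set w := v - ∑ i, flat Ω v (-x i) • y i with hw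
    have h1 : ∀ j, flat Ω w (x j) = 0 := by
      intro j
      rw [hw, flat_swap, map_sub, map_sum]
      simp only [map_smul, h.dual, map_neg, smul_eq_mul, mul_ite, mul_one, mul_zero,
        Finset.sum_ite_eq, Finset.mem_univ, if_true]
      rw [flat_swap]
      ring
    ext u
    have h2 : flat Ω w u = flat Ω w (∑ i, flat Ω u (y i) • x i) := by
      have h3 := DFunLike.congr_fun (h.expand u) w
      rw [flat_swap, map_sub] at h3
      have h4 : flat Ω w u - flat Ω w (∑ i, flat Ω u (y i) • x i) = 0 := by
        have h5 : -(flat Ω w u - flat Ω w (∑ i, flat Ω u (y i) • x i)) = 0 := h3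
        linarith
      linarith
    rw [h2, map_sum]
    simp [h1]

/-- The adjoint of the Lefschetz operator, computed in a frame. -/
def lamOp (x y : Fin (2 * n) → V) : Module.End ℝ (GForm V) :=
  (2⁻¹ : ℝ) • ∑ i, iota (y i) * iota (x i)

theorem lamOp_apply (x y : Fin (2 * n) → V) (Φ : GForm V) :
    lamOp x y Φ = (2⁻¹ : ℝ) • ∑ i, iota (y i) (iota (x i) Φ) := by
  simp [lamOp, LinearMap.sum_apply]

theorem lamOp_mem_transverse {Ω : V [⋀^Fin 2]→L[ℝ] ℝ} (x y : Fin (2 * n) → V) {Φ : GForm V}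
    (h : Φ ∈ transverse Ω) : lamOp x y Φ ∈ transverse Ω := by
  rw [lamOp_apply]
  exact Submodule.smul_mem _ _ (Submodule.sum_mem _ fun i _ =>
    iota_mem_transverse _ (iota_mem_transverse _ h))

theorem iota_mul_lamOp (x y : Fin (2 * n) → V) (v : V) :
    iota v * lamOp x y = lamOp x y * iota v := by
  rw [lamOp, mul_smul_comm, smul_mul_assoc, Finset.mul_sum, Finset.sum_mul]
  congr 1
  refine Finset.sum_congr rfl fun i _ => ?_
  rw [← mul_assoc, iota_mul_iota v, neg_mul, mul_assoc, iota_mul_iota v, mul_neg, neg_neg,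
    mul_assoc]

theorem lamOp_apply_apply (x y : Fin (2 * n) → V) (Φ : GForm V) (k : ℕ) :
    lamOp x y Φ k = (2⁻¹ : ℝ) • ∑ i, interior (y i) (interior (x i) (Φ (k + 2))) := by
  rw [lamOp_apply, Pi.smul_apply, Finset.sum_apply]
  rfl

theorem lamOp_mul_eps (x y : Fin (2 * n) → V) (α : V →L[ℝ] ℝ) :
    lamOp x y * eps α = eps α * lamOp x y +
      (2⁻¹ : ℝ) • (iota (∑ i, α (x i) • y i) - iota (∑ i, α (y i) • x i)) := by
  have h1 : iota (∑ i, α (x i) • y i) = ∑ i, α (x i) • iota (y i) := by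
    change iotaₗ _ = ∑ i, α (x i) • iotaₗ (y i)
    simp
  have h2 : iota (∑ i, α (y i) • x i) = ∑ i, α (y i) • iota (x i) := by
    change iotaₗ _ = ∑ i, α (y i) • iotaₗ (x i)
    simp
  rw [h1, h2, lamOp, smul_mul_assoc, mul_smul_comm, ← smul_add, Finset.mul_sum, Finset.sum_mul,
    ← Finset.sum_sub_distrib (fun i => α (x i) • iota (y i)) (fun i => α (y i) • iota (x i)),
    ← Finset.sum_add_distrib]
  congr 1
  refine Finset.sum_congr rfl fun i _ => ?_
  rw [mul_assoc, iota_mul_eps, mul_sub, ← mul_assoc, iota_mul_eps]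
  simp only [mul_smul_comm, mul_one, sub_mul, smul_mul_assoc, one_mul, mul_assoc]
  abel

/-- The functionals `♭(-yᵢ) = Ω(·, yᵢ)` are the coordinates dual to the `xᵢ`; transverse forms
cannot see the part of `v` in the kernel. This is the hypothesis of `sum_extMul_interior`. -/
theorem IsFrame.interior_eq {Ω : V [⋀^Fin 2]→L[ℝ] ℝ} {x y : Fin (2 * n) → V}
    (h : IsFrame Ω x y) {k : ℕ} {φ : V [⋀^Fin (k + 1)]→L[ℝ] ℝ} (hφ : IsTransverse Ω φ) (v : V) :
    interior v φ = interior (∑ i, flat Ω (-y i) v • x i) φ := by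
  have h1 := iota_congr (v := v) (w := ∑ i, flat Ω v (y i) • x i) (h.expand v)
    (gr_mem_transverse.2 hφ)
  rw [iota_gr, iota_gr] at h1
  rw [gr_injective k h1]
  congr 1
  refine Finset.sum_congr rfl fun i _ => ?_
  rw [flat_swap, flat_neg]
  rfl

/-- In a frame, `∑ ♭(-yᵢ) ∧ i(xᵢ)` is the degree operator on transverse forms. -/
theorem IsFrame.sum_eps_iota {Ω : V [⋀^Fin 2]→L[ℝ] ℝ} {x y : Fin (2 * n) → V}
    (h : IsFrame Ω x y) {Φ : GForm V} (hΦ : Φ ∈ transverse Ω) :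
    ∑ i, eps (flat Ω (-y i)) (iota (x i) Φ) = degOp Φ := by
  funext k
  rw [Finset.sum_apply]
  cases k with
  | zero =>
    rw [degOp_apply]
    simp [eps_zero]
  | succ k =>
    simp only [eps_succ, iota_apply]
    rw [sum_extMul_interior _ _ _ (h.interior_eq (apply_mem_transverse hΦ (k + 1))), degOp_apply]
    simp

/-- The Clifford relation is summed over the frame: each of the `2 n` pairs contributes the
identity, minus the degree operator. -/
theorem IsFrame.sum_iota_eps {Ω : V [⋀^Fin 2]→L[ℝ] ℝ} {x y : Fin (2 * n) → V}
    (h : IsFrame Ω x y) {Φ : GForm V} (hΦ : Φ ∈ transverse Ω) :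
    ∑ i, iota (x i) (eps (flat Ω (-y i)) Φ) = (2 * n : ℝ) • Φ - degOp Φ := by
  have h1 : ∀ i, iota (x i) (eps (flat Ω (-y i)) Φ) =
      Φ - eps (flat Ω (-y i)) (iota (x i) Φ) := by
    intro i
    refine (LinearMap.congr_fun (iota_mul_eps (x i) (flat Ω (-y i))) Φ).trans ?_
    rw [flat_neg]
    have : (-flat Ω (y i)) (x i) = 1 := by
      rw [neg_apply, ← flat_swap, h.dual, if_pos rfl]
    rw [this]
    simp
  simp only [h1]
  rw [Finset.sum_sub_distrib, h.sum_eps_iota hΦ, Finset.sum_const, Finset.card_univ,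
    Fintype.card_fin, ← Nat.cast_smul_eq_nsmul ℝ]
  simp

/-- Transverse covectors are spanned by products of the functionals `♭(a)`. -/
theorem IsFrame.mem_span {Ω : V [⋀^Fin 2]→L[ℝ] ℝ} {x y : Fin (2 * n) → V}
    (h : IsFrame Ω x y) {k : ℕ} {φ : V [⋀^Fin k]→L[ℝ] ℝ} (hφ : IsTransverse Ω φ) :
    φ ∈ Submodule.span ℝ (Set.range fun f : Fin k → Fin (2 * n) =>
      wedgeFamily fun i => flat Ω (-y (f i))) := by
  refine mem_span_wedgeFamily_comp (fun i => flat Ω (-y i)) x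
    (fun k => (transverse Ω).comap (gr k)) ?_ ?_ (Submodule.mem_comap.2 (gr_mem_transverse.2 hφ))
  · intro k φ i hφ
    rw [Submodule.mem_comap] at hφ ⊢
    rw [← iota_gr]
    exact iota_mem_transverse _ hφ
  · intro k φ hφ v
    exact h.interior_eq (gr_mem_transverse.1 hφ) v

/-- Transverse covectors vanish above the rank of `Ω`. -/
theorem IsFrame.eq_zero_of_lt {Ω : V [⋀^Fin 2]→L[ℝ] ℝ} {x y : Fin (2 * n) → V}
    (h : IsFrame Ω x y) {k : ℕ} (hk : 2 * n < k) {φ : V [⋀^Fin k]→L[ℝ] ℝ}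
    (hφ : IsTransverse Ω φ) : φ = 0 := by
  have h1 := h.mem_span hφ
  have h2 : Submodule.span ℝ (Set.range fun f : Fin k → Fin (2 * n) =>
      wedgeFamily fun i => flat Ω (-y (f i))) = ⊥ := by
    rw [Submodule.span_eq_bot]
    rintro _ ⟨f, rfl⟩
    obtain ⟨i, j, hij, hf⟩ := Fintype.exists_ne_map_eq_of_card_lt f (by simpa using hk)
    refine ContinuousAlternatingMap.ext fun u => ?_
    dsimp only
    rw [wedgeFamily_apply]
    exact Matrix.det_zero_of_row_eq hij (by funext j; simp [hf])
  rw [h2] at h1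
  exact (Submodule.mem_bot ℝ).1 h1

/-- `[Λ, ♭(a) ∧ ·] = -i(a)` on transverse forms. -/
theorem IsFrame.lamOp_eps_flat {Ω : V [⋀^Fin 2]→L[ℝ] ℝ} {x y : Fin (2 * n) → V}
    (h : IsFrame Ω x y) (a : V) {Φ : GForm V} (hΦ : Φ ∈ transverse Ω) :
    lamOp x y (eps (flat Ω a) Φ) = eps (flat Ω a) (lamOp x y Φ) - iota a Φ := by
  have h1 := LinearMap.congr_fun (lamOp_mul_eps x y (flat Ω a)) Φ
  refine h1.trans ?_
  rw [LinearMap.add_apply, LinearMap.smul_apply, LinearMap.sub_apply, Module.End.mul_apply]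
  have h2 : iota (∑ i, flat Ω a (y i) • x i) Φ = iota a Φ := (iota_congr (h.expand a) hΦ).symm
  have h3 : iota (∑ i, flat Ω a (x i) • y i) Φ = -iota a Φ := by
    have h4 := iota_congr (h.swap.expand a) hΦ
    have h5 : ∑ i, flat Ω a (-x i) • y i = -∑ i, flat Ω a (x i) • y i := by
      simp [Finset.sum_neg_distrib]
    have h6 : iota (-∑ i, flat Ω a (x i) • y i) = -iota (∑ i, flat Ω a (x i) • y i) :=
      map_neg iotaₗ _
    rw [h4, h5, h6, LinearMap.neg_apply, neg_neg]
  rw [h2, h3, sub_eq_add_neg (eps (flat Ω a) (lamOp x y Φ))]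
  congr 1
  module

theorem lamOp_gr_zero (x y : Fin (2 * n) → V) (φ : V [⋀^Fin 0]→L[ℝ] ℝ) :
    lamOp x y (gr 0 φ) = 0 := by
  simp [lamOp_apply, iota_gr_zero]

/-- On transverse forms, the adjoint of the Lefschetz operator does not depend on the frame. -/
theorem IsFrame.lamOp_eq {Ω : V [⋀^Fin 2]→L[ℝ] ℝ} {x y x' y' : Fin (2 * n) → V}
    (h : IsFrame Ω x y) (h' : IsFrame Ω x' y') {Φ : GForm V} (hΦ : Φ ∈ transverse Ω) :
    lamOp x y Φ = lamOp x' y' Φ := by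
  have key : ∀ (k : ℕ) (φ : V [⋀^Fin k]→L[ℝ] ℝ), IsTransverse Ω φ →
      lamOp x y (gr k φ) = lamOp x' y' (gr k φ) := by
    intro k
    induction k with
    | zero => intro φ _; rw [lamOp_gr_zero, lamOp_gr_zero]
    | succ k ih =>
      intro φ hφ
      -- Both candidates for `Λ` have the same commutator with every `♭(a) ∧ ·`. Writing `(k + 1) φ`
      -- as a sum of products `♭(-yᵢ) ∧ i(xᵢ) φ` thus reduces equality to degree `k`.
      have h1 := h.sum_eps_iota (gr_mem_transverse.2 hφ)
      rw [degOp_gr] at h1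
      have h2 : ∀ i, lamOp x y (eps (flat Ω (-y i)) (iota (x i) (gr (k + 1) φ))) =
          lamOp x' y' (eps (flat Ω (-y i)) (iota (x i) (gr (k + 1) φ))) := by
        intro i
        have h3 := iota_mem_transverse (x i) (gr_mem_transverse.2 hφ)
        rw [h.lamOp_eps_flat _ h3, h'.lamOp_eps_flat _ h3, iota_gr,
          ih _ (by rw [← gr_mem_transverse, ← iota_gr]; exact h3)]
      have h4 : lamOp x y (((k + 1 : ℕ) : ℝ) • gr (k + 1) φ) =
          lamOp x' y' (((k + 1 : ℕ) : ℝ) • gr (k + 1) φ) := by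
        rw [← h1, map_sum, map_sum]
        exact Finset.sum_congr rfl fun i _ => h2 i
      rw [map_smul, map_smul] at h4
      exact smul_right_injective _ (by positivity : ((k + 1 : ℕ) : ℝ) ≠ 0) h4
  funext k
  have h1 := congrFun (key (k + 2) (Φ (k + 2)) (apply_mem_transverse hΦ _)) k
  rw [lamOp_apply_apply, lamOp_apply_apply, gr_same] at h1
  rw [lamOp_apply_apply, lamOp_apply_apply, h1]

theorem flat_wedgeFamily (α : Fin 2 → V →L[ℝ] ℝ) (v : V) :
    flat (wedgeFamily α) v = α 0 v • α 1 - α 1 v • α 0 := by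
  ext u
  rw [flat_apply, wedgeFamily_apply, Matrix.det_fin_two]
  simp
  ring

variable [IsTopologicalAddGroup V] [ContinuousSMul ℝ V] [T2Space V] [FiniteDimensional ℝ V]

theorem extMul_extMul (α β : V →L[ℝ] ℝ) {k : ℕ} (φ : V [⋀^Fin k]→L[ℝ] ℝ) :
    extMul α (k + 1) (extMul β k φ) = -extMul β (k + 1) (extMul α k φ) := by
  have : extMul α (k + 1) ∘ₗ extMul β k = -(extMul β (k + 1) ∘ₗ extMul α k) := by
    refine covector_hom_ext fun γ => ?_
    rw [LinearMap.neg_apply, LinearMap.comp_apply, LinearMap.comp_apply, extMul_wedgeFamily,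
      extMul_wedgeFamily, extMul_wedgeFamily, extMul_wedgeFamily]
    refine ContinuousAlternatingMap.ext fun u => ?_
    rw [ContinuousAlternatingMap.neg_apply, wedgeFamily_apply, wedgeFamily_apply]
    have h := Matrix.det_permute (Equiv.swap (0 : Fin (k + 2)) 1)
      (Matrix.of fun i j => (Fin.cons β (Fin.cons α γ : Fin (k + 1) → V →L[ℝ] ℝ) :
        Fin (k + 2) → V →L[ℝ] ℝ) i (u j))
    rw [Equiv.Perm.sign_swap (by simp)] at h
    simp only [Units.val_neg, Units.val_one, Int.cast_neg, Int.cast_one, neg_mul, one_mul] at h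
    rw [← h]
    congr 1
    ext i j
    refine Fin.cases ?_ (fun i => ?_) i
    · simp
    · refine Fin.cases ?_ (fun i => ?_) i
      · simp
      · have : Equiv.swap (0 : Fin (k + 2)) 1 i.succ.succ = i.succ.succ :=
          Equiv.swap_apply_of_ne_of_ne (Fin.succ_ne_zero _) (by
            rw [← Fin.succ_zero_eq_one]
            exact fun h => Fin.succ_ne_zero _ (Fin.succ_injective _ h))
        simp [this]
  exact LinearMap.congr_fun this φ

theorem eps_mul_eps (α β : V →L[ℝ] ℝ) : eps α * eps β = -(eps β * eps α) := by
  refine LinearMap.ext fun Φ => funext fun k => ?_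
  match k with
  | 0 => exact (neg_zero (G := V [⋀^Fin 0]→L[ℝ] ℝ)).symm
  | 1 =>
    change extMul α 0 0 = -extMul β 0 0
    simp
  | k + 2 => exact extMul_extMul α β (Φ k)

theorem lefOp_wedgeFamily (α : Fin 2 → V →L[ℝ] ℝ) :
    lefOp (wedgeFamily α) = eps (α 0) * eps (α 1) := by
  refine LinearMap.ext fun Φ => funext fun k => ?_
  match k with
  | 0 => rfl
  | 1 => exact (map_zero (extMul (α 0) 0)).symm
  | k + 2 =>
    refine gr_injective _ ?_
    rw [lefOp_add_two, gr_lef, gr_wedge_wedgeFamily, epsProd_succ, epsProd_succ, epsProd_zero,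
      mul_one, Module.End.mul_apply, eps_gr, eps_gr]
    rfl

theorem lefOp_mul_eps (Ω : V [⋀^Fin 2]→L[ℝ] ℝ) (α : V →L[ℝ] ℝ) :
    lefOp Ω * eps α = eps α * lefOp Ω := by
  induction Ω using covector_induction with
  | wedgeFamily β =>
    rw [lefOp_wedgeFamily, mul_assoc, eps_mul_eps _ α, mul_neg, ← mul_assoc, eps_mul_eps _ α,
      neg_mul, neg_neg, mul_assoc]
  | zero => rw [map_zero, zero_mul, mul_zero]
  | add φ ψ h1 h2 => rw [map_add, add_mul, mul_add, h1, h2]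
  | smul c φ h => rw [map_smul, smul_mul_assoc, mul_smul_comm, h]

/-- Contraction is a graded derivation with `i(v) Ω = ♭(v)`. For `Ω = β₀ ∧ β₁` this is the Clifford
relation used twice; the general case is linear in `Ω`. -/
theorem iota_mul_lefOp (Ω : V [⋀^Fin 2]→L[ℝ] ℝ) (v : V) :
    iota v * lefOp Ω = eps (flat Ω v) + lefOp Ω * iota v := by
  have flat_eq : ∀ Ω : V [⋀^Fin 2]→L[ℝ] ℝ, eps (flat Ω v) =
      (epsₗ ∘ₗ
        { toFun := fun Ω => flat Ω v
          map_add' := fun Ω Ω' => by ext u; simp [flat_apply]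
          map_smul' := fun c Ω => by ext u; simp [flat_apply] }) Ω := fun _ => rfl
  induction Ω using covector_induction with
  | wedgeFamily β =>
    have h1 : eps (β 0 v • β 1 - β 1 v • β 0) = β 0 v • eps (β 1) - β 1 v • eps (β 0) := by
      change epsₗ _ = β 0 v • epsₗ _ - β 1 v • epsₗ _
      simp
    rw [lefOp_wedgeFamily, flat_wedgeFamily, h1, ← mul_assoc, iota_mul_eps, sub_mul, mul_assoc,
      iota_mul_eps, mul_sub, mul_assoc]
    simp only [smul_mul_assoc, one_mul, mul_smul_comm, mul_one]
    abel
  | zero => rw [flat_eq, map_zero, map_zero, zero_mul, mul_zero, add_zero]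
  | add φ ψ h1 h2 =>
    rw [flat_eq] at h1 h2 ⊢
    rw [map_add, map_add, add_mul, mul_add, h1, h2]
    abel
  | smul c φ h =>
    rw [flat_eq] at h ⊢
    rw [map_smul, map_smul, smul_mul_assoc, mul_smul_comm, h, smul_add]

theorem lefOp_mem_transverse {Ω : V [⋀^Fin 2]→L[ℝ] ℝ} {Φ : GForm V}
    (h : Φ ∈ transverse Ω) : lefOp Ω Φ ∈ transverse Ω := by
  intro v hv
  have h1 := LinearMap.congr_fun (iota_mul_lefOp Ω v) Φ
  have h2 : eps (0 : V →L[ℝ] ℝ) = 0 := map_zero epsₗ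
  rw [hv, h2, zero_add] at h1
  refine h1.trans ?_
  rw [Module.End.mul_apply, h v hv, map_zero]

/-- In a frame, `Ω = ½ ∑ ♭(xᵢ) ∧ ♭(yᵢ)`. -/
theorem IsFrame.lefOp_eq {Ω : V [⋀^Fin 2]→L[ℝ] ℝ} {x y : Fin (2 * n) → V} (h : IsFrame Ω x y) :
    lefOp Ω = (2⁻¹ : ℝ) • ∑ i, eps (flat Ω (x i)) * eps (flat Ω (y i)) := by
  have hΩ : IsTransverse Ω Ω := by
    rw [← gr_mem_transverse]
    intro v hv
    rw [iota_gr]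
    have : interior v Ω = 0 := by
      refine ContinuousAlternatingMap.ext fun u => ?_
      have h1 := DFunLike.congr_fun hv (u 0)
      rw [flat_apply] at h1
      rw [interior_apply]
      refine Eq.trans (congrArg Ω ?_) h1
      funext i
      fin_cases i <;> rfl
    rw [this, map_zero]
  -- The degree formula for `Ω` itself reads `2 Ω = ∑ ♭(-yᵢ) ∧ ♭(xᵢ)`, since `i(xᵢ) Ω = ♭(xᵢ)`.
  have h1 := sum_extMul_interior (fun i => flat Ω (-y i)) x Ω (h.interior_eq hΩ)
  have h2 : ∀ i, extMul (flat Ω (-y i)) 1 (interior (x i) Ω) =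
      wedgeFamily ![flat Ω (-y i), flat Ω (x i)] := by
    intro i
    have h3 : interior (x i) Ω = wedgeFamily ![flat Ω (x i)] := by
      refine ContinuousAlternatingMap.ext fun u => ?_
      rw [interior_apply, wedgeFamily_apply, Matrix.det_fin_one]
      simp only [Matrix.of_apply, Matrix.cons_val_zero]
      rw [flat_apply]
      congr 1
      funext i
      fin_cases i <;> rfl
    rw [h3, extMul_wedgeFamily]
    rfl
  simp only [h2] at h1
  have h3 := congrArg lefOp h1
  rw [map_sum, map_smul] at h3
  have h4 : (2 : ℝ) • lefOp Ω = ∑ i, eps (flat Ω (x i)) * eps (flat Ω (y i)) := by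
    have h5 : (((1 : ℕ) : ℝ) + 1) = 2 := by norm_num
    rw [h5] at h3
    rw [← h3]
    refine Finset.sum_congr rfl fun i _ => ?_
    rw [lefOp_wedgeFamily]
    simp only [Matrix.cons_val_zero, Matrix.cons_val_one]
    have h6 : eps (flat Ω (-y i)) = -eps (flat Ω (y i)) := by
      rw [flat_neg]
      exact map_neg epsₗ _
    rw [h6, neg_mul, ← eps_mul_eps]
  rw [← h4, smul_smul]
  norm_num

/-- The commutation relation `[Λ, L] = n - deg` on transverse forms. -/
theorem IsFrame.lamOp_lefOp {Ω : V [⋀^Fin 2]→L[ℝ] ℝ} {x y : Fin (2 * n) → V}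
    (h : IsFrame Ω x y) {Φ : GForm V} (hΦ : Φ ∈ transverse Ω) :
    lamOp x y (lefOp Ω Φ) = lefOp Ω (lamOp x y Φ) + ((n : ℝ) • Φ - degOp Φ) := by
  have hL : ∀ Ψ, lefOp Ω Ψ = (2⁻¹ : ℝ) • ∑ i, eps (flat Ω (x i)) (eps (flat Ω (y i)) Ψ) := by
    intro Ψ
    rw [h.lefOp_eq]
    simp [LinearMap.sum_apply]
  have h1 : ∀ i, lamOp x y (eps (flat Ω (x i)) (eps (flat Ω (y i)) Φ)) =
      eps (flat Ω (x i)) (eps (flat Ω (y i)) (lamOp x y Φ)) -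
        eps (flat Ω (x i)) (iota (y i) Φ) + iota (x i) (eps (flat Ω (-y i)) Φ) := by
    intro i
    have h6 : eps (flat Ω (-y i)) = -eps (flat Ω (y i)) := by
      rw [flat_neg]
      exact map_neg epsₗ _
    rw [h.lamOp_eps_flat _ (eps_flat_mem_transverse _ hΦ), h.lamOp_eps_flat _ hΦ, map_sub, h6,
      LinearMap.neg_apply, map_neg, sub_eq_add_neg]
  rw [hL Φ, hL (lamOp x y Φ), map_smul, map_sum]
  simp only [h1]
  -- The correction terms are `∑ i(xᵢ) ♭(-yᵢ) ∧ · = 2 n - deg`, and `∑ ♭(xᵢ) ∧ i(yᵢ) = deg` from the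
  -- swapped frame. Half of their difference is `n - deg`.
  rw [Finset.sum_add_distrib, Finset.sum_sub_distrib, h.sum_iota_eps hΦ]
  have h2 := h.swap.sum_eps_iota hΦ
  simp only [neg_neg] at h2
  rw [h2]
  module

end Lefschetz

/-! ### Graded spaces with a Lefschetz operator and its adjoint -/

section LefschetzTriple

variable {E : Type*} [AddCommGroup E] [Module ℝ E]

theorem end_pow_succ_apply (L : E →ₗ[ℝ] E) (r : ℕ) (φ : E) :
    (L ^ (r + 1)) φ = L ((L ^ r) φ) := by
  rw [pow_succ', Module.End.mul_apply]

/-- Operators `L` and `Λ` of degrees `2` and `-2` on a family of subspaces `G k`, with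
`[Λ, L] = n - k` on `G k` and `G k = 0` for `k < 0`. -/
structure IsLefschetzTriple (L Λ : E →ₗ[ℝ] E) (G : ℤ → Submodule ℝ E) (n : ℤ) : Prop where
  raise : ∀ {k φ}, φ ∈ G k → L φ ∈ G (k + 2)
  lower : ∀ {k φ}, φ ∈ G k → Λ φ ∈ G (k - 2)
  comm : ∀ {k φ}, φ ∈ G k → Λ (L φ) = L (Λ φ) + ((n : ℝ) - k) • φ
  eq_zero_of_neg : ∀ {k φ}, k < 0 → φ ∈ G k → φ = 0

namespace IsLefschetzTriple

variable {L Λ : E →ₗ[ℝ] E} {G : ℤ → Submodule ℝ E} {n : ℤ}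

theorem pow_mem (h : IsLefschetzTriple L Λ G n) {k : ℤ} {φ : E} (hφ : φ ∈ G k) (r : ℕ) :
    (L ^ r) φ ∈ G (k + 2 * r) := by
  induction r with
  | zero => simpa using hφ
  | succ r ih =>
    rw [pow_succ', Module.End.mul_apply]
    have := h.raise ih
    convert this using 2
    push_cast
    ring

/-- Passing `Λ` through `r + 1` factors `L` collects `n - k - 2 i` for `i = 0, …, r`, with sum `(r +
1) (n - k - r)`. -/
theorem lower_pow_succ (h : IsLefschetzTriple L Λ G n) {k : ℤ} {φ : E} (hφ : φ ∈ G k) (r : ℕ) :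
    Λ ((L ^ (r + 1)) φ) = (L ^ (r + 1)) (Λ φ) +
      (((r : ℝ) + 1) * ((n : ℝ) - k - r)) • (L ^ r) φ := by
  induction r with
  | zero => simpa using h.comm hφ
  | succ r ih =>
    rw [pow_succ' L (r + 1), Module.End.mul_apply, h.comm (h.pow_mem hφ (r + 1)), ih, map_add,
      map_smul, ← Module.End.mul_apply L (L ^ r), ← pow_succ', add_assoc, ← add_smul,
      Module.End.mul_apply]
    congr 2
    push_cast
    ring

/-- A subspace stable under `L` and `Λ` contains `φ` as soon as it contains `L ^ r φ`, below the
middle degree. -/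
theorem mem_of_pow_mem (h : IsLefschetzTriple L Λ G n) {H : Submodule ℝ E}
    (hL : ∀ k, ∀ φ ∈ H, φ ∈ G k → L φ ∈ H) (hΛ : ∀ k, ∀ φ ∈ H, φ ∈ G k → Λ φ ∈ H) {k : ℤ} {r : ℕ}
    (hkr : k + r ≤ n) {φ : E} (hφ : φ ∈ G k) (hH : (L ^ r) φ ∈ H) : φ ∈ H := by
  have key : ∀ N : ℕ, ∀ k : ℤ, k < N → ∀ r : ℕ, k + r ≤ n → ∀ φ ∈ G k, (L ^ r) φ ∈ H → φ ∈ H := by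
    intro N
    induction N with
    | zero =>
      intro k hk r _ φ hφ _
      rw [h.eq_zero_of_neg (by simpa using hk) hφ]
      exact H.zero_mem
    | succ N ihN =>
      intro k hk r
      induction r with
      | zero => intro _ φ _ hH; simpa using hH
      | succ r ihr =>
        intro hkr φ hφ hH
        push_cast at hkr
        have hc : ((r : ℝ) + 1) * ((n : ℝ) - k - r) ≠ 0 := by
          have h1 : (k : ℝ) + (r + 1) ≤ n := by exact_mod_cast hkr
          have h2 : (0 : ℝ) < (n : ℝ) - k - r := by linarith
          positivity
        -- Applying `Λ` and then `L` to `L ^ (r + 1) φ` isolates `L ^ (r + 2) Λ φ` modulo `H`. Here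
        -- `Λ φ` has degree `k - 2` and satisfies the same bound, so it lies in `H` by the outer
        -- induction. What then remains of `Λ L ^ (r + 1) φ` is a nonzero multiple of `L ^ r φ`.
        have h1 := hΛ _ _ hH (h.pow_mem hφ _)
        have h2 := hL _ _ h1 (h.lower (h.pow_mem hφ _))
        rw [h.lower_pow_succ hφ] at h1 h2
        rw [map_add, map_smul, ← end_pow_succ_apply, ← end_pow_succ_apply] at h2
        have h3 : (L ^ (r + 2)) (Λ φ) ∈ H :=
          (Submodule.add_mem_iff_left _ (H.smul_mem _ hH)).1 h2
        have h4 : Λ φ ∈ H := ihN (k - 2) (by push_cast at hk; omega) (r + 2) (by push_cast; omega) _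
          (h.lower hφ) h3
        have h5 : ∀ s : ℕ, (L ^ s) (Λ φ) ∈ H := by
          intro s
          induction s with
          | zero => exact h4
          | succ s ihs => rw [pow_succ', Module.End.mul_apply]; exact hL _ _ ihs (h.pow_mem (h.lower hφ) s)
        have h6 := (Submodule.add_mem_iff_right _ (h5 (r + 1))).1 h1
        have h7 : (L ^ r) φ ∈ H := by
          have := H.smul_mem (((r : ℝ) + 1) * ((n : ℝ) - k - r))⁻¹ h6
          rwa [smul_smul, inv_mul_cancel₀ hc, one_smul] at this
        exact ihr (by omega) φ hφ h7
  exact key (k.toNat + 1) k (by push_cast; have := Int.self_le_toNat k; omega) r hkr φ hφ hH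

theorem eq_zero_of_pow_eq_zero (h : IsLefschetzTriple L Λ G n) {k : ℤ} {r : ℕ}
    (hkr : k + r ≤ n) {φ : E} (hφ : φ ∈ G k) (h0 : (L ^ r) φ = 0) : φ = 0 := by
  have := h.mem_of_pow_mem (H := ⊥) (by simp) (by simp) hkr hφ (by simp [h0])
  simpa using this

/-- Exchanging `L` and `Λ`. -/
theorem symm (h : IsLefschetzTriple L Λ G n) (h0 : ∀ {k φ}, 2 * n < k → φ ∈ G k → φ = 0) :
    IsLefschetzTriple Λ L (fun k => G (2 * n - k)) n where
  raise {k φ} hφ := by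
    have := h.lower hφ
    rwa [show 2 * n - k - 2 = 2 * n - (k + 2) by ring] at this
  lower {k φ} hφ := by
    have := h.raise hφ
    rwa [show 2 * n - k + 2 = 2 * n - (k - 2) by ring] at this
  comm {k φ} hφ := by
    rw [h.comm hφ]
    push_cast
    module
  eq_zero_of_neg {k φ} hk hφ := h0 (by omega) hφ

/-- In degree `k = n + 1 - r` the commutator coefficient vanishes, so `Λ` commutes with `L ^ r`
there. Then `L ^ r` kills `Λ φ`, and it is injective in degree `k - 2`. -/
theorem lower_eq_zero_of_pow_eq_zero (h : IsLefschetzTriple L Λ G n) {k : ℤ} {r : ℕ}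
    (hkr : k + r = n + 1) {φ : E} (hφ : φ ∈ G k) (h0 : (L ^ r) φ = 0) : Λ φ = 0 := by
  have h2 : (L ^ r) (Λ φ) = 0 := by
    cases r with
    | zero =>
      have : φ = 0 := by simpa using h0
      simp [this]
    | succ r =>
      have h1 := h.lower_pow_succ hφ r
      have h3 : (n : ℝ) - k - r = 0 := by
        have : (k : ℝ) + (r + 1) = n + 1 := by exact_mod_cast hkr
        linarith
      rw [h0, map_zero, h3, mul_zero, zero_smul, add_zero] at h1
      exact h1.symm
  exact h.eq_zero_of_pow_eq_zero (r := r) (by omega) (h.lower hφ) h2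

/-- By the same vanishing coefficient `Λ` kills `L ^ r φ`, which has degree `n + 1 + r`. Above the
middle degree `Λ` is injective, by the triple with `L` and `Λ` exchanged. -/
theorem pow_eq_zero_of_lower_eq_zero (h : IsLefschetzTriple L Λ G n)
    (hs : ∀ {k φ}, 2 * n < k → φ ∈ G k → φ = 0) {k : ℤ} {r : ℕ}
    (hk : k ≤ n + 1) (hkr : k + r = n + 1) {φ : E} (hφ : φ ∈ G k) (h0 : Λ φ = 0) :
    (L ^ r) φ = 0 := by
  have h2 : Λ ((L ^ r) φ) = 0 := by
    cases r with
    | zero => simpa using h0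
    | succ r =>
      have h1 := h.lower_pow_succ hφ r
      have h3 : (n : ℝ) - k - r = 0 := by
        have : (k : ℝ) + (r + 1) = n + 1 := by exact_mod_cast hkr
        linarith
      rw [h0, map_zero, h3, mul_zero, zero_smul, add_zero] at h1
      exact h1
  have h4 : (L ^ r) φ ∈ G (2 * n - (2 * n - (k + 2 * r))) := by
    rw [sub_sub_cancel]
    exact h.pow_mem hφ r
  exact (h.symm hs).eq_zero_of_pow_eq_zero (k := 2 * n - (k + 2 * r)) (r := 1)
    (by push_cast; omega) h4 (by simpa using h2)

/-- If `L ^ (r + 1)` kills `χ`, where `χ` has degree `n + 1 - r`, then `χ = α + L β` with `α` and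
`β = (r + 1)⁻¹ Λ χ` primitive. -/
theorem lower_lower_eq_zero (h : IsLefschetzTriple L Λ G n) {k : ℤ} {r : ℕ}
    (hkr : k + r = n + 1) {χ : E} (hχ : χ ∈ G k) (h0 : (L ^ (r + 1)) χ = 0) :
    Λ (Λ χ) = 0 := by
  -- Each application of `Λ` costs one more power of `L`. Two applications leave `L ^ (r + 3)`
  -- killing `Λ² χ` of degree `k - 4`, and `(k - 4) + (r + 3) = n` is exactly the limit of
  -- injectivity.
  have step : ∀ {k : ℤ} {φ : E} {s : ℕ}, φ ∈ G k → (L ^ (s + 1)) φ = 0 →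
      (L ^ (s + 2)) (Λ φ) = 0 := by
    intro k φ s hφ h0
    have h1 := congrArg L (h.lower_pow_succ hφ s)
    rw [h0, map_zero, map_zero, map_add, map_smul, ← end_pow_succ_apply, ← end_pow_succ_apply, h0,
      smul_zero, add_zero] at h1
    exact h1.symm
  have h1 := step hχ h0
  have h2 := step (h.lower hχ) h1
  exact h.eq_zero_of_pow_eq_zero (k := k - 2 - 2) (r := r + 3) (by push_cast; omega)
    (h.lower (h.lower hχ)) h2

/-- Lefschetz decomposition of a subspace that is stable under `L` and under division by `L ^ r`. -/
theorem mem_span_primitive (h : IsLefschetzTriple L Λ G n) {S : Submodule ℝ E}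
    (hL : ∀ φ ∈ S, L φ ∈ S)
    (hdiv : ∀ (k : ℤ) (r : ℕ) (φ : E), k + r ≤ n → φ ∈ G k → (L ^ r) φ ∈ S → φ ∈ S)
    (hsurj : ∀ (r : ℕ) (ψ : E), ψ ∈ G (n + r) → ∃ φ ∈ G (n - r), (L ^ r) φ = ψ)
    {k : ℤ} {φ : E} (hφ : φ ∈ G k) (hS : φ ∈ S) :
    φ ∈ Submodule.span ℝ {χ | ∃ (m : ℤ) (j : ℕ) (ψ : E), m + 2 * j = k ∧ 0 ≤ m ∧ m ≤ n ∧
      ψ ∈ S ∧ ψ ∈ G m ∧ Λ ψ = 0 ∧ χ = (L ^ j) ψ} := by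
  have hpow : ∀ (s : ℕ) (φ : E), φ ∈ S → (L ^ s) φ ∈ S := by
    intro s φ hφ
    induction s with
    | zero => exact hφ
    | succ s ihs => rw [pow_succ', Module.End.mul_apply]; exact hL _ ihs
  have map_span : ∀ (k : ℤ) (s : ℕ) (φ : E),
      φ ∈ Submodule.span ℝ {χ | ∃ (m : ℤ) (j : ℕ) (ψ : E), m + 2 * j = k ∧ 0 ≤ m ∧ m ≤ n ∧
        ψ ∈ S ∧ ψ ∈ G m ∧ Λ ψ = 0 ∧ χ = (L ^ j) ψ} →
      (L ^ s) φ ∈ Submodule.span ℝ {χ | ∃ (m : ℤ) (j : ℕ) (ψ : E), m + 2 * j = k + 2 * s ∧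
        0 ≤ m ∧ m ≤ n ∧ ψ ∈ S ∧ ψ ∈ G m ∧ Λ ψ = 0 ∧ χ = (L ^ j) ψ} := by
    intro k s φ hφ
    induction hφ using Submodule.span_induction with
    | mem χ hχ =>
      obtain ⟨m, j, ψ, h1, h2, h3, h4, h5, h6, rfl⟩ := hχ
      refine Submodule.subset_span ⟨m, s + j, ψ, ?_, h2, h3, h4, h5, h6, ?_⟩
      · push_cast
        omega
      · rw [pow_add, Module.End.mul_apply]
    | zero => rw [map_zero]; exact Submodule.zero_mem _
    | add _ _ _ _ h1 h2 => rw [map_add]; exact Submodule.add_mem _ h1 h2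
    | smul c _ _ h1 => rw [map_smul]; exact Submodule.smul_mem _ _ h1
  have low : ∀ N : ℕ, ∀ k : ℤ, k < N → k ≤ n → ∀ φ ∈ G k, φ ∈ S →
      φ ∈ Submodule.span ℝ {χ | ∃ (m : ℤ) (j : ℕ) (ψ : E), m + 2 * j = k ∧ 0 ≤ m ∧ m ≤ n ∧
        ψ ∈ S ∧ ψ ∈ G m ∧ Λ ψ = 0 ∧ χ = (L ^ j) ψ} := by
    intro N
    induction N with
    | zero =>
      intro k hk _ φ hφ _
      rw [h.eq_zero_of_neg (by simpa using hk) hφ]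
      exact Submodule.zero_mem _
    | succ N ih =>
      intro k hk hkn φ hφ hS
      by_cases hk0 : k < 0
      · rw [h.eq_zero_of_neg hk0 hφ]
        exact Submodule.zero_mem _
      -- With `s = n - k`, hard Lefschetz provides `χ` of degree `k - 2` with `L ^ (s + 2) χ = L ^
      -- (s + 1) φ`. Then `φ - L χ` is killed by `L ^ (s + 1)`, hence primitive, and `χ` is treated
      -- by induction.
      obtain ⟨s, hs⟩ : ∃ s : ℕ, (s : ℤ) = n - k := ⟨(n - k).toNat, Int.toNat_of_nonneg (by omega)⟩
      have h1 : (L ^ (s + 1)) φ ∈ G (n + (s + 2 : ℕ)) := by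
        have := h.pow_mem hφ (s + 1)
        convert this using 2
        push_cast
        omega
      obtain ⟨χ, hχ, hχ2⟩ := hsurj _ _ h1
      have hχ3 : χ ∈ G (k - 2) := by
        convert hχ using 2
        push_cast
        omega
      have hχS : χ ∈ S := hdiv (k - 2) (s + 2) χ (by push_cast; omega) hχ3
        (by rw [hχ2]; exact hpow _ _ hS)
      have h2 := map_span (k - 2) 1 χ (ih (k - 2) (by push_cast at hk; omega) (by omega) χ hχ3 hχS)
      have hLχ : L χ ∈ G k := by
        have := h.raise hχ3
        rwa [sub_add_cancel] at this
      have h3 : (L ^ (s + 1)) (φ - L χ) = 0 := by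
        rw [map_sub, ← Module.End.mul_apply, ← pow_succ, hχ2, sub_self]
      have h4 : Λ (φ - L χ) = 0 := h.lower_eq_zero_of_pow_eq_zero (k := k) (r := s + 1)
        (by push_cast; omega) (Submodule.sub_mem _ hφ hLχ) h3
      have h5 : φ - L χ ∈ Submodule.span ℝ {χ | ∃ (m : ℤ) (j : ℕ) (ψ : E), m + 2 * j = k ∧ 0 ≤ m ∧
          m ≤ n ∧ ψ ∈ S ∧ ψ ∈ G m ∧ Λ ψ = 0 ∧ χ = (L ^ j) ψ} :=
        Submodule.subset_span ⟨k, 0, φ - L χ, by simp, by omega, hkn,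
          Submodule.sub_mem _ hS (hL _ hχS), Submodule.sub_mem _ hφ hLχ, h4, by simp⟩
      have h6 : (L ^ 1) χ ∈ Submodule.span ℝ {χ | ∃ (m : ℤ) (j : ℕ) (ψ : E), m + 2 * j = k ∧ 0 ≤ m ∧
          m ≤ n ∧ ψ ∈ S ∧ ψ ∈ G m ∧ Λ ψ = 0 ∧ χ = (L ^ j) ψ} := by
        simpa using h2
      have := Submodule.add_mem _ h5 h6
      rwa [pow_one, sub_add_cancel] at this
  by_cases hkn : k ≤ n
  · exact low (k.toNat + 1) k (by push_cast; have := Int.self_le_toNat k; omega) hkn φ hφ hS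
  · obtain ⟨s, hs⟩ : ∃ s : ℕ, (s : ℤ) = k - n := ⟨(k - n).toNat, Int.toNat_of_nonneg (by omega)⟩
    obtain ⟨χ, hχ, rfl⟩ := hsurj s φ (by rwa [hs, add_sub_cancel])
    have hχS := hdiv _ s χ (by omega) hχ hS
    have h1 := low ((n - s).toNat + 1) _ (by push_cast; have := Int.self_le_toNat (n - s); omega)
      (by omega) χ hχ hχS
    have h2 := map_span _ s χ h1
    rwa [show n - (s : ℤ) + 2 * s = k by omega] at h2

end IsLefschetzTriple

end LefschetzTriple

/-! ### The symplectic star operator in terms of the Lefschetz operators -/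

section Star

variable {V : Type*} [AddCommGroup V] [Module ℝ V] [TopologicalSpace V]

variable (V) in
/-- Inhomogeneous forms concentrated in degree `k`. -/
def homog (k : ℤ) : Submodule ℝ (GForm V) where
  carrier := {Φ | ∀ j : ℕ, (j : ℤ) ≠ k → Φ j = 0}
  add_mem' h1 h2 j hj := by rw [Pi.add_apply, h1 j hj, h2 j hj, add_zero]
  zero_mem' _ _ := rfl
  smul_mem' c Φ h j hj := by rw [Pi.smul_apply, h j hj, smul_zero]

theorem gr_mem_homog {k : ℕ} (φ : V [⋀^Fin k]→L[ℝ] ℝ) : gr k φ ∈ homog V k :=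
  fun _ hj => gr_of_ne (by exact_mod_cast hj) φ

theorem eq_gr_of_mem_homog {k : ℕ} {Φ : GForm V} (h : Φ ∈ homog V k) : Φ = gr k (Φ k) := by
  funext l
  by_cases hl : l = k
  · subst hl
    rw [gr_same]
  · rw [gr_of_ne hl, h l (by exact_mod_cast hl)]

theorem eq_zero_of_mem_homog_neg {k : ℤ} (hk : k < 0) {Φ : GForm V} (h : Φ ∈ homog V k) :
    Φ = 0 :=
  funext fun l => h l (by omega)

theorem degOp_of_mem_homog {k : ℤ} {Φ : GForm V} (h : Φ ∈ homog V k) :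
    degOp Φ = (k : ℝ) • Φ := by
  funext l
  rw [degOp_apply, Pi.smul_apply]
  by_cases hl : (l : ℤ) = k
  · rw [← hl]
    simp
  · rw [h l hl, smul_zero, smul_zero]

theorem eps_mem_homog (α : V →L[ℝ] ℝ) {k : ℤ} {Φ : GForm V} (h : Φ ∈ homog V k) :
    eps α Φ ∈ homog V (k + 1) := by
  intro j hj
  cases j with
  | zero => rfl
  | succ j => rw [eps_succ, h j (fun hc => hj (by push_cast; omega)), map_zero]

theorem iota_mem_homog (v : V) {k : ℤ} {Φ : GForm V} (h : Φ ∈ homog V k) :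
    iota v Φ ∈ homog V (k - 1) := by
  intro j hj
  rw [iota_apply, h (j + 1) (fun hc => hj (by push_cast at hc; omega))]
  exact map_zero (interiorₗ v j)

theorem lefOp_mem_homog (Ω : V [⋀^Fin 2]→L[ℝ] ℝ) {k : ℤ} {Φ : GForm V} (h : Φ ∈ homog V k) :
    lefOp Ω Φ ∈ homog V (k + 2) := by
  intro j hj
  match j with
  | 0 => rfl
  | 1 => rfl
  | j + 2 =>
    rw [lefOp_add_two, h j (fun hc => hj (by push_cast; omega)), ← lefₗ_apply, map_zero]

variable {n : ℕ}

theorem lamOp_mem_homog (x y : Fin (2 * n) → V) {k : ℤ} {Φ : GForm V} (h : Φ ∈ homog V k) :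
    lamOp x y Φ ∈ homog V (k - 2) := by
  rw [lamOp_apply]
  refine Submodule.smul_mem _ _ (Submodule.sum_mem _ fun i _ => ?_)
  have := iota_mem_homog (y i) (iota_mem_homog (x i) h)
  rwa [sub_sub, one_add_one_eq_two] at this

/-- Transverse forms of degree `k`. -/
def transverseDeg (Ω : V [⋀^Fin 2]→L[ℝ] ℝ) (k : ℤ) : Submodule ℝ (GForm V) :=
  homog V k ⊓ transverse Ω

theorem gr_mem_transverseDeg {Ω : V [⋀^Fin 2]→L[ℝ] ℝ} {k : ℕ} {φ : V [⋀^Fin k]→L[ℝ] ℝ}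
    (h : IsTransverse Ω φ) : gr k φ ∈ transverseDeg Ω k :=
  ⟨gr_mem_homog φ, gr_mem_transverse.2 h⟩

theorem IsFrame.transverseDeg_eq_zero {Ω : V [⋀^Fin 2]→L[ℝ] ℝ} {x y : Fin (2 * n) → V}
    (h : IsFrame Ω x y) {k : ℤ} {Φ : GForm V} (hk : 2 * (n : ℤ) < k)
    (hΦ : Φ ∈ transverseDeg Ω k) : Φ = 0 := by
  lift k to ℕ using by omega
  have h1 := eq_gr_of_mem_homog hΦ.1
  rw [h1, h.eq_zero_of_lt (by omega) (apply_mem_transverse hΦ.2 k), map_zero]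

theorem iota_mem_transverseDeg {Ω : V [⋀^Fin 2]→L[ℝ] ℝ} (v : V) {k : ℤ} {Φ : GForm V}
    (hΦ : Φ ∈ transverseDeg Ω k) : iota v Φ ∈ transverseDeg Ω (k - 1) :=
  ⟨iota_mem_homog _ hΦ.1, iota_mem_transverse _ hΦ.2⟩

theorem eps_flat_mem_transverseDeg {Ω : V [⋀^Fin 2]→L[ℝ] ℝ} (v : V) {k : ℤ} {Φ : GForm V}
    (hΦ : Φ ∈ transverseDeg Ω k) : eps (flat Ω v) Φ ∈ transverseDeg Ω (k + 1) :=
  ⟨eps_mem_homog _ hΦ.1, eps_flat_mem_transverse _ hΦ.2⟩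

/-- Contracting the products `♭(-yᵢ) ∧ Φ` with `xᵢ` and summing returns `(2 n - k) Φ`. -/
theorem IsFrame.eq_zero_of_eps_eq_zero {Ω : V [⋀^Fin 2]→L[ℝ] ℝ} {x y : Fin (2 * n) → V}
    (h : IsFrame Ω x y) {k : ℤ} (hk : k ≠ 2 * n) {Φ : GForm V} (hΦ : Φ ∈ transverseDeg Ω k)
    (h0 : ∀ a, eps (flat Ω a) Φ = 0) : Φ = 0 := by
  have h1 := h.sum_iota_eps hΦ.2
  simp only [h0, map_zero, Finset.sum_const_zero] at h1
  rw [degOp_of_mem_homog hΦ.1] at h1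
  replace h1 : 0 = ((2 * n : ℝ) - k) • Φ := h1.trans (sub_smul _ _ Φ).symm
  have h2 : (2 * n : ℝ) - k ≠ 0 := by
    intro hc
    apply hk
    have : (k : ℝ) = 2 * n := by linarith
    exact_mod_cast this
  exact (smul_eq_zero.1 h1.symm).resolve_left h2

/-- The star operator in degree `k`, by recursion on `k`. -/
def starAux (x y : Fin (2 * n) → V) (ν : GForm V) :
    (k : ℕ) → (V [⋀^Fin k]→L[ℝ] ℝ) →ₗ[ℝ] GForm V
  | 0 => LinearMap.smulRight
      { toFun := fun φ => φ ![]
        map_add' := fun _ _ => rfl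
        map_smul' := fun _ _ => rfl } ν
  -- The formula is forced by the rule `⋆ (♭(a) ∧ χ) = (-1) ^ k i(a) ⋆ χ` applied to `φ = (k + 1)⁻¹
  -- ∑ ♭(-yᵢ) ∧ i(xᵢ) φ`.
  | k + 1 => ((-1 : ℝ) ^ k * ((k : ℝ) + 1)⁻¹) •
      ∑ i, iota (-y i) ∘ₗ starAux x y ν k ∘ₗ interiorₗ (x i) k

theorem starAux_zero (x y : Fin (2 * n) → V) (ν : GForm V) (φ : V [⋀^Fin 0]→L[ℝ] ℝ) :
    starAux x y ν 0 φ = φ ![] • ν := rfl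

theorem starAux_succ (x y : Fin (2 * n) → V) (ν : GForm V) (k : ℕ)
    (φ : V [⋀^Fin (k + 1)]→L[ℝ] ℝ) :
    starAux x y ν (k + 1) φ = ((-1 : ℝ) ^ k * ((k : ℝ) + 1)⁻¹) •
      ∑ i, iota (-y i) (starAux x y ν k (interior (x i) φ)) := by
  rw [starAux, LinearMap.smul_apply, LinearMap.sum_apply]
  rfl

theorem starAux_mem {Ω : V [⋀^Fin 2]→L[ℝ] ℝ} (x y : Fin (2 * n) → V) {ν : GForm V}
    (hν : ν ∈ transverseDeg Ω (2 * n)) (k : ℕ) (φ : V [⋀^Fin k]→L[ℝ] ℝ) :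
    starAux x y ν k φ ∈ transverseDeg Ω (2 * n - k) := by
  induction k with
  | zero =>
    rw [starAux_zero]
    simpa using Submodule.smul_mem _ _ hν
  | succ k ih =>
    rw [starAux_succ]
    refine Submodule.smul_mem _ _ (Submodule.sum_mem _ fun i _ => ?_)
    have := iota_mem_transverseDeg (-y i) (ih (interior (x i) φ))
    rwa [sub_sub, ← Nat.cast_succ] at this

/-- `⋆ (♭(a) ∧ χ) = (-1) ^ k i(a) ⋆ χ`. -/
theorem IsFrame.starAux_extMul {Ω : V [⋀^Fin 2]→L[ℝ] ℝ} {x y : Fin (2 * n) → V}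
    (h : IsFrame Ω x y) {ν : GForm V} (hν : ν ∈ transverseDeg Ω (2 * n)) (a : V) {k : ℕ}
    (χ : V [⋀^Fin k]→L[ℝ] ℝ) :
    starAux x y ν (k + 1) (extMul (flat Ω a) k χ) = (-1 : ℝ) ^ k • iota a (starAux x y ν k χ) := by
  have expand : ∀ Ψ ∈ transverse Ω, ∑ i, flat Ω a (x i) • iota (-y i) Ψ = iota a Ψ := by
    intro Ψ hΨ
    rw [iota_congr (h.swap.expand a) hΨ]
    have : iota (∑ i, flat Ω a (-x i) • y i) = ∑ i, flat Ω a (-x i) • iota (y i) := by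
      change iotaₗ _ = ∑ i, _ • iotaₗ _
      simp
    rw [this, LinearMap.sum_apply]
    refine Finset.sum_congr rfl fun i _ => ?_
    have h2 : iota (-y i) = -iota (y i) := map_neg iotaₗ _
    rw [h2, LinearMap.neg_apply, LinearMap.smul_apply, map_neg, smul_neg, neg_smul]
  induction k with
  | zero =>
    rw [starAux_succ]
    simp only [interior_extMul_zero, map_smul]
    rw [expand _ (starAux_mem x y hν _ _).2]
    simp
  | succ k ih =>
    rw [starAux_succ]
    simp only [interior_extMul_succ, map_sub, map_smul, ih]
    rw [Finset.sum_sub_distrib, expand _ (starAux_mem x y hν _ _).2]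
    have h1 : ∀ i, iota (-y i) (iota a (starAux x y ν k (interior (x i) χ))) =
        -iota a (iota (-y i) (starAux x y ν k (interior (x i) χ))) := fun i =>
      LinearMap.congr_fun (iota_mul_iota (-y i) a) _
    simp only [h1]
    rw [← Finset.smul_sum, Finset.sum_neg_distrib, ← map_sum]
    have h2 := starAux_succ x y ν k χ
    have hk : ((k : ℝ) + 1) ≠ 0 := by positivity
    have hs : ((-1 : ℝ) ^ k) * (-1) ^ k = 1 := by rw [← mul_pow]; simp
    -- The recursion is read backwards: the sum is `± (k + 1) ⋆ χ`. Together with the first term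
    -- this gives `k + 2` equal copies, which cancel the factor `1 / (k + 2)`.
    have h3 : ∑ i, iota (-y i) (starAux x y ν k (interior (x i) χ)) =
        ((-1 : ℝ) ^ k * ((k : ℝ) + 1)) • starAux x y ν (k + 1) χ := by
      rw [h2, smul_smul]
      have : (-1 : ℝ) ^ k * ((k : ℝ) + 1) * ((-1) ^ k * ((k : ℝ) + 1)⁻¹) = 1 := by
        field_simp
        linear_combination hs
      rw [this, one_smul]
    rw [h3, map_smul, smul_neg, sub_neg_eq_add, smul_smul, ← mul_assoc, hs, one_mul]
    have hk2 : ((k + 1 : ℕ) : ℝ) + 1 ≠ 0 := by positivity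
    have h4 : ∀ Ψ : GForm V, Ψ + ((k : ℝ) + 1) • Ψ = (1 + ((k : ℝ) + 1)) • Ψ := by
      intro Ψ
      module
    rw [h4, smul_smul]
    congr 1
    push_cast at hk2 ⊢
    field_simp
    ring

/-- `♭(a) ∧ ⋆ ψ = (-1) ^ (k + 1) ⋆ i(a) ψ` for transverse `ψ` of degree `k + 1`. -/
theorem IsFrame.eps_starAux {Ω : V [⋀^Fin 2]→L[ℝ] ℝ} {x y : Fin (2 * n) → V}
    (h : IsFrame Ω x y) {ν : GForm V} (hν : ν ∈ transverseDeg Ω (2 * n)) (a : V) {k : ℕ}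
    (ψ : V [⋀^Fin (k + 1)]→L[ℝ] ℝ) (hψ : IsTransverse Ω ψ) :
    eps (flat Ω a) (starAux x y ν (k + 1) ψ) =
      (-1 : ℝ) ^ (k + 1) • starAux x y ν k (interior a ψ) := by
  have eps_iota : ∀ b Φ, eps (flat Ω a) (iota b Φ) =
      flat Ω a b • Φ - iota b (eps (flat Ω a) Φ) := by
    intro b Φ
    have := LinearMap.congr_fun (iota_mul_eps b (flat Ω a)) Φ
    rw [LinearMap.sub_apply, LinearMap.smul_apply, Module.End.mul_apply, Module.End.mul_apply,
      Module.End.one_apply] at this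
    rw [this]
    abel
  -- By the degree formula a transverse covector is a combination of products `♭(b) ∧ χ` with `χ`
  -- transverse, so linear identities need checking only there.
  have reduce : ∀ {k : ℕ} (f g : (V [⋀^Fin (k + 1)]→L[ℝ] ℝ) →ₗ[ℝ] GForm V),
      (∀ b χ, IsTransverse Ω χ → f (extMul (flat Ω b) k χ) = g (extMul (flat Ω b) k χ)) →
      ∀ ψ, IsTransverse Ω ψ → f ψ = g ψ := by
    intro k f g hfg ψ hψ
    have h1 := sum_extMul_interior _ _ _ (h.interior_eq hψ)
    have hk : ((k : ℝ) + 1) ≠ 0 := by positivity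
    refine smul_right_injective _ hk ?_
    dsimp only
    rw [← map_smul, ← map_smul, ← h1, map_sum, map_sum]
    refine Finset.sum_congr rfl fun i _ => hfg _ _ ?_
    rw [← gr_mem_transverse, ← iota_gr]
    exact iota_mem_transverse _ (gr_mem_transverse.2 hψ)
  induction k with
  | zero =>
    refine reduce (eps (flat Ω a) ∘ₗ starAux x y ν 1)
      (((-1 : ℝ) ^ (0 + 1)) • (starAux x y ν 0 ∘ₗ interiorₗ a 0)) ?_ ψ hψ
    intro b χ _
    change eps (flat Ω a) (starAux x y ν (0 + 1) _) =
      (-1 : ℝ) ^ (0 + 1) • starAux x y ν 0 (interior a _)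
    -- The product has degree `2 n + 1`, above the rank of `Ω`.
    have h0 : eps (flat Ω a) (starAux x y ν 0 χ) = 0 :=
      h.transverseDeg_eq_zero (k := 2 * n - (0 : ℕ) + 1) (by simp)
        (eps_flat_mem_transverseDeg a (starAux_mem x y hν 0 χ))
    rw [h.starAux_extMul hν, map_smul, eps_iota, h0, interior_extMul_zero, map_smul,
      flat_swap Ω b a]
    simp only [pow_zero, one_smul, sub_zero, map_zero, zero_add, pow_one]
    module
  | succ k ih =>
    refine reduce (eps (flat Ω a) ∘ₗ starAux x y ν (k + 2))
      (((-1 : ℝ) ^ (k + 2)) • (starAux x y ν (k + 1) ∘ₗ interiorₗ a (k + 1))) ?_ ψ hψ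
    intro b χ hχ
    change eps (flat Ω a) (starAux x y ν (k + 1 + 1) _) =
      (-1 : ℝ) ^ (k + 1 + 1) • starAux x y ν (k + 1) (interior a _)
    rw [h.starAux_extMul hν, map_smul, eps_iota, ih χ hχ, interior_extMul_succ, map_sub, map_smul,
      map_smul, h.starAux_extMul hν, flat_swap Ω b a]
    have hs : ((-1 : ℝ) ^ k) * (-1) ^ k = 1 := by rw [← mul_pow]; simp
    simp only [smul_sub, smul_smul, pow_succ]
    congr 1
    · congr 1
      linear_combination (0 : ℝ) * hs
    · congr 1
      ring

/-- The sign relating the star operator to the Lefschetz operator on primitive covectors. -/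
def starSign : ℕ → ℝ
  | 0 => 1
  | m + 1 => (-1) ^ m * starSign m

theorem starSign_succ (m : ℕ) : starSign (m + 1) = (-1) ^ m * starSign m := rfl

theorem starSign_mul_self (m : ℕ) : starSign m * starSign m = 1 := by
  induction m with
  | zero => simp [starSign]
  | succ m ih =>
    have hs : ((-1 : ℝ) ^ m) * (-1) ^ m = 1 := by rw [← mul_pow]; simp
    rw [starSign_succ]
    linear_combination ((-1 : ℝ) ^ m * (-1) ^ m) * ih + hs

/-- The transversal volume as an inhomogeneous form. -/
def volForm (n : ℕ) (Ω : V [⋀^Fin 2]→L[ℝ] ℝ) : GForm V := gr (2 * n) (nu n Ω)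

theorem volForm_eq (n : ℕ) (Ω : V [⋀^Fin 2]→L[ℝ] ℝ) :
    volForm n Ω = ((n.factorial : ℝ)⁻¹) • (lefOp Ω ^ n) (oneForm V) := by
  rw [lefOp_pow_oneForm, volForm, nu, map_smul]

variable [IsTopologicalAddGroup V] [ContinuousSMul ℝ V] [T2Space V] [FiniteDimensional ℝ V]

theorem IsFrame.triple {Ω : V [⋀^Fin 2]→L[ℝ] ℝ} {x y : Fin (2 * n) → V} (h : IsFrame Ω x y) :
    IsLefschetzTriple (lefOp Ω) (lamOp x y) (transverseDeg Ω) n where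
  raise hφ := ⟨lefOp_mem_homog Ω hφ.1, lefOp_mem_transverse hφ.2⟩
  lower hφ := ⟨lamOp_mem_homog x y hφ.1, lamOp_mem_transverse x y hφ.2⟩
  comm hφ := by
    rw [h.lamOp_lefOp hφ.2, degOp_of_mem_homog hφ.1, sub_smul]
    simp
  eq_zero_of_neg hk hφ := eq_zero_of_mem_homog_neg hk hφ.1

/-- Pointwise hard Lefschetz property. -/
theorem IsFrame.exists_pow_eq {Ω : V [⋀^Fin 2]→L[ℝ] ℝ} {x y : Fin (2 * n) → V}
    (h : IsFrame Ω x y) (r : ℕ) (Ψ : GForm V) (hΨ : Ψ ∈ transverseDeg Ω (n + r)) :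
    ∃ Φ ∈ transverseDeg Ω (n - r), (lefOp Ω ^ r) Φ = Ψ := by
  have ht := h.triple
  have hs := ht.symm (fun hk hφ => h.transverseDeg_eq_zero hk hφ)
  let W := transverseDeg Ω ((n : ℤ) + r)
  have hlow : ∀ Φ ∈ W, (lamOp x y ^ r) Φ ∈ transverseDeg Ω (n - r) := by
    intro Φ hΦ
    have h1 : Φ ∈ transverseDeg Ω (2 * (n : ℤ) - (n - r)) := by
      convert hΦ using 2
      ring
    have h2 := hs.pow_mem h1 r
    convert h2 using 2
    ring
  have hinj : ∀ Φ ∈ W, (lefOp Ω ^ r) ((lamOp x y ^ r) Φ) = 0 → Φ = 0 := by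
    intro Φ hΦ h0
    have h1 := ht.eq_zero_of_pow_eq_zero (by omega) (hlow Φ hΦ) h0
    have h2 : Φ ∈ transverseDeg Ω (2 * (n : ℤ) - (n - r)) := by
      convert hΦ using 2
      ring
    exact hs.eq_zero_of_pow_eq_zero (by omega) h2 h1
  have hW : ∀ Φ ∈ W, (lefOp Ω ^ r) ((lamOp x y ^ r) Φ) ∈ W := by
    intro Φ hΦ
    have := ht.pow_mem (hlow Φ hΦ) r
    convert this using 2
    ring
  -- The operator `L ^ r Λ ^ r` on degree `n + r` is injective, since both factors are injective in
  -- their ranges. In finite dimension it is onto, and `Λ ^ r` of a `T`-preimage is the form sought.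
  let T : W →ₗ[ℝ] W := ((lefOp Ω ^ r) ∘ₗ (lamOp x y ^ r)).restrict hW
  have : FiniteDimensional ℝ W := by
    let f : W →ₗ[ℝ] (V [⋀^Fin (n + r)]→L[ℝ] ℝ) :=
      { toFun := fun Φ => Φ.1 (n + r)
        map_add' := fun _ _ => rfl
        map_smul' := fun _ _ => rfl }
    refine FiniteDimensional.of_injective f ?_
    intro Φ Φ' hf
    have h1 : ∀ Φ : W, Φ.1 = gr (n + r) (Φ.1 (n + r)) := fun Φ =>
      eq_gr_of_mem_homog (by have := Φ.2.1; push_cast; exact this)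
    refine Subtype.ext ?_
    rw [h1 Φ, h1 Φ']
    exact congrArg _ hf
  have hT : Function.Injective T := by
    intro Φ Φ' h0
    refine Subtype.ext (sub_eq_zero.1 (hinj _ (Submodule.sub_mem _ Φ.2 Φ'.2) ?_))
    rw [map_sub, map_sub, sub_eq_zero]
    exact congrArg Subtype.val h0
  obtain ⟨Φ, hΦ⟩ :=
    (LinearMap.injective_iff_surjective (K := ℝ) (V := W) (f := T)).1 hT ⟨Ψ, hΨ⟩
  exact ⟨_, hlow Φ.1 Φ.2, congrArg Subtype.val hΦ⟩

/-- `⋆ L = Λ ⋆`. -/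
theorem IsFrame.starAux_lef {Ω : V [⋀^Fin 2]→L[ℝ] ℝ} {x y : Fin (2 * n) → V}
    (h : IsFrame Ω x y) {ν : GForm V} (hν : ν ∈ transverseDeg Ω (2 * n)) {k : ℕ}
    (φ : V [⋀^Fin k]→L[ℝ] ℝ) :
    starAux x y ν (k + 2) (lef Ω φ) = lamOp x y (starAux x y ν k φ) := by
  have h1 : lef Ω φ =
      (2⁻¹ : ℝ) • ∑ i, extMul (flat Ω (x i)) (k + 1) (extMul (flat Ω (y i)) k φ) := by
    refine gr_injective _ ?_
    rw [← lefOp_gr, h.lefOp_eq, map_smul, map_sum]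
    simp [LinearMap.sum_apply, eps_gr]
  rw [h1, map_smul, map_sum, lamOp_apply]
  congr 1
  refine Finset.sum_congr rfl fun i _ => ?_
  rw [h.starAux_extMul hν, h.starAux_extMul hν, map_smul, smul_smul]
  have h2 : iota (x i) (iota (y i) (starAux x y ν k φ)) =
      -iota (y i) (iota (x i) (starAux x y ν k φ)) :=
    LinearMap.congr_fun (iota_mul_iota (x i) (y i)) _
  have h3 : (-1 : ℝ) ^ (k + 1) * (-1) ^ k = -1 := by
    rw [← pow_add]
    exact Odd.neg_one_pow ⟨k, by ring⟩
  rw [h2, h3]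
  simp

/-- The derivation rule applied to `Ω ^ (r + 1) ∧ Φ`: each of the `r + 1` factors contributes the
same term `♭(a) ∧ Ω ^ r ∧ Φ`. -/
theorem iota_lefOp_pow_succ (Ω : V [⋀^Fin 2]→L[ℝ] ℝ) (a : V) (r : ℕ) (Φ : GForm V) :
    iota a ((lefOp Ω ^ (r + 1)) Φ) = (lefOp Ω ^ (r + 1)) (iota a Φ) +
      ((r : ℝ) + 1) • eps (flat Ω a) ((lefOp Ω ^ r) Φ) := by
  have h1 : ∀ Φ, iota a (lefOp Ω Φ) = eps (flat Ω a) Φ + lefOp Ω (iota a Φ) := fun Φ =>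
    LinearMap.congr_fun (iota_mul_lefOp Ω a) Φ
  have h2 : ∀ Φ, lefOp Ω (eps (flat Ω a) Φ) = eps (flat Ω a) (lefOp Ω Φ) := fun Φ =>
    LinearMap.congr_fun (lefOp_mul_eps Ω (flat Ω a)) Φ
  induction r with
  | zero =>
    simp [h1, add_comm]
  | succ r ih =>
    rw [end_pow_succ_apply, h1, ih, map_add, map_smul, h2, ← end_pow_succ_apply,
      ← end_pow_succ_apply]
    push_cast
    module

theorem lefOp_pow_mem_transverseDeg {Ω : V [⋀^Fin 2]→L[ℝ] ℝ} {k : ℤ} {Φ : GForm V}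
    (h : Φ ∈ transverseDeg Ω k) (r : ℕ) : (lefOp Ω ^ r) Φ ∈ transverseDeg Ω (k + 2 * r) := by
  induction r with
  | zero => simpa using h
  | succ r ih =>
    rw [end_pow_succ_apply]
    have : lefOp Ω ((lefOp Ω ^ r) Φ) ∈ transverseDeg Ω (k + 2 * r + 2) :=
      ⟨lefOp_mem_homog Ω ih.1, lefOp_mem_transverse ih.2⟩
    convert this using 2
    push_cast
    ring

theorem volForm_mem (n : ℕ) (Ω : V [⋀^Fin 2]→L[ℝ] ℝ) : volForm n Ω ∈ transverseDeg Ω (2 * n) := by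
  rw [volForm_eq]
  refine Submodule.smul_mem _ _ ?_
  have h1 : oneForm V ∈ transverseDeg Ω (0 : ℕ) :=
    ⟨gr_mem_homog _, oneForm_mem_transverse Ω⟩
  have := lefOp_pow_mem_transverseDeg h1 n
  simpa using this

/-- The star operator on primitive covectors. -/
theorem IsFrame.starAux_primitive {Ω : V [⋀^Fin 2]→L[ℝ] ℝ} {x y : Fin (2 * n) → V}
    (h : IsFrame Ω x y) {m N : ℕ} (hN : m + N = n) (φ : V [⋀^Fin m]→L[ℝ] ℝ)
    (hφ : IsTransverse Ω φ) (hprim : lamOp x y (gr m φ) = 0) :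
    starAux x y (volForm n Ω) m φ =
      (starSign m * (N.factorial : ℝ)⁻¹) • (lefOp Ω ^ N) (gr m φ) := by
  induction m generalizing N with
  | zero =>
    obtain rfl : N = n := by omega
    rw [starAux_zero, volForm_eq, starSign, one_mul, smul_comm, ← map_smul]
    congr 2
    rw [oneForm, ← map_smul]
    congr 1
    refine ContinuousAlternatingMap.ext fun u => ?_
    rw [Subsingleton.elim u ![]]
    simp
  | succ m ih =>
    have hν := volForm_mem n Ω
    have hT := gr_mem_transverseDeg hφ
    -- The degree `2 n - (m + 1)` is below `2 n`, so it suffices to compare products with every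
    -- `♭(a)`. On the star side this passes to the contraction `i(a) φ`, which is again primitive
    -- and of lower degree.
    refine sub_eq_zero.1 (h.eq_zero_of_eps_eq_zero (k := 2 * n - (m + 1 : ℕ))
      (by push_cast; omega) (Submodule.sub_mem _ (starAux_mem x y hν _ φ)
        (Submodule.smul_mem _ _ ?_)) fun a => ?_)
    · have := h.triple.pow_mem hT N
      convert this using 2
      push_cast
      omega
    · have hprim' : lamOp x y (gr m (interior a φ)) = 0 := by
        rw [← iota_gr]
        have := LinearMap.congr_fun (iota_mul_lamOp x y a) (gr (m + 1) φ)
        rw [Module.End.mul_apply, Module.End.mul_apply, hprim, map_zero] at this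
        exact this.symm
      have hφ' : IsTransverse Ω (interior a φ) := by
        rw [← gr_mem_transverse, ← iota_gr]
        exact iota_mem_transverse _ hT.2
      -- Contracting this vanishing power with `a` expresses `L ^ (N + 1) i(a) φ` as `-(N + 1) ♭(a)
      -- ∧ L ^ N φ`; the factor turns `1 / (N + 1)!` into `1 / N!`.
      have h0 : (lefOp Ω ^ (N + 1)) (gr (m + 1) φ) = 0 :=
        h.triple.pow_eq_zero_of_lower_eq_zero (fun hk hφ => h.transverseDeg_eq_zero hk hφ)
          (k := (m + 1 : ℕ)) (by push_cast; omega) (by push_cast; omega) hT hprim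
      have h1 := iota_lefOp_pow_succ Ω a N (gr (m + 1) φ)
      rw [h0, map_zero, iota_gr] at h1
      have h2 : (lefOp Ω ^ (N + 1)) (gr m (interior a φ)) =
          -(((N : ℝ) + 1) • eps (flat Ω a) ((lefOp Ω ^ N) (gr (m + 1) φ))) :=
        eq_neg_of_add_eq_zero_left h1.symm
      rw [map_sub, map_smul, h.eps_starAux hν a φ hφ, ih (N := N + 1) (by omega) _ hφ' hprim', h2,
        smul_neg, smul_neg, smul_smul, smul_smul, starSign_succ, sub_eq_zero]
      refine (neg_smul _ _).symm.trans ?_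
      congr 1
      rw [Nat.factorial_succ]
      have hN1 : ((N : ℝ) + 1) ≠ 0 := by positivity
      have hN2 : (N.factorial : ℝ) ≠ 0 := by positivity
      push_cast
      field_simp
      ring

/-- The star operator on `L ^ j φ`, `φ` primitive. -/
theorem IsFrame.starAux_lefPow {Ω : V [⋀^Fin 2]→L[ℝ] ℝ} {x y : Fin (2 * n) → V}
    (h : IsFrame Ω x y) {m j N : ℕ} (hN : m + j + N = n) (φ : V [⋀^Fin m]→L[ℝ] ℝ)
    (hφ : IsTransverse Ω φ) (hprim : lamOp x y (gr m φ) = 0) :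
    starAux x y (volForm n Ω) (m + 2 * j) (lefPow Ω φ j) =
      (starSign m * (j.factorial : ℝ) * (N.factorial : ℝ)⁻¹) • (lefOp Ω ^ N) (gr m φ) := by
  induction j generalizing N with
  | zero =>
    have := h.starAux_primitive (by omega : m + N = n) φ hφ hprim
    simpa [lefPow] using this
  | succ j ih =>
    have h1 := h.starAux_lef (volForm_mem n Ω) (lefPow Ω φ j)
    refine h1.trans ?_
    -- Lowering `L ^ (N + 1) φ` gives the coefficient `(N + 1) (n - m - N) = (N + 1) (j + 1)`, which
    -- adjusts both factorials.
    rw [ih (N := N + 1) (by omega), map_smul,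
      h.triple.lower_pow_succ (gr_mem_transverseDeg hφ), hprim, map_zero, zero_add, smul_smul]
    congr 1
    rw [Nat.factorial_succ, Nat.factorial_succ]
    have hN1 : ((N : ℝ) + 1) ≠ 0 := by positivity
    have hN2 : (N.factorial : ℝ) ≠ 0 := by positivity
    have h2 : (n : ℝ) = m + (j + 1) + N := by exact_mod_cast hN.symm
    push_cast
    rw [h2]
    field_simp
    ring

theorem epsProd_mul_eps {k : ℕ} (α : Fin k → V →L[ℝ] ℝ) (β : V →L[ℝ] ℝ) :
    eps β * epsProd α = (-1 : ℝ) ^ k • (epsProd α * eps β) := by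
  induction k with
  | zero => simp [epsProd_zero]
  | succ k ih =>
    rw [epsProd_succ, ← mul_assoc, eps_mul_eps, neg_mul, mul_assoc, ih, mul_smul_comm, pow_succ,
      mul_neg_one, neg_smul, mul_assoc]

/-- Transverse forms whose products with all `♭(a₁) ∧ ⋯ ∧ ♭(aₖ)` vanish are zero. -/
theorem IsFrame.eq_zero_of_epsProd {Ω : V [⋀^Fin 2]→L[ℝ] ℝ} {x y : Fin (2 * n) → V}
    (h : IsFrame Ω x y) {k l : ℕ} (hkl : k + l = 2 * n) {Φ : GForm V}
    (hΦ : Φ ∈ transverseDeg Ω l)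
    (h0 : ∀ a : Fin k → V, epsProd (fun i => flat Ω (a i)) Φ = 0) : Φ = 0 := by
  induction k generalizing l Φ with
  | zero => simpa [epsProd_zero] using h0 ![]
  | succ k ih =>
    refine h.eq_zero_of_eps_eq_zero (k := l) (by omega) hΦ fun b => ?_
    refine ih (l := l + 1) (by omega) ?_ fun a => ?_
    · push_cast
      exact eps_flat_mem_transverseDeg b hΦ
    · have h1 := h0 (Fin.cons b a)
      rw [epsProd_succ] at h1
      simp only [Fin.cons_zero, Fin.cons_succ] at h1
      rw [epsProd_mul_eps, LinearMap.smul_apply] at h1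
      exact (smul_eq_zero.1 h1).resolve_left (by simp)

/-- Moving `♭(a 0)` next to the star converts it into a contraction of `ψ`. Each factor thus inserts
one vector into `ψ`, until only the volume form is left. -/
theorem IsFrame.epsProd_flat_starAux {Ω : V [⋀^Fin 2]→L[ℝ] ℝ} {x y : Fin (2 * n) → V}
    (h : IsFrame Ω x y) {ν : GForm V} (hν : ν ∈ transverseDeg Ω (2 * n)) {k : ℕ} (a : Fin k → V)
    (ψ : V [⋀^Fin k]→L[ℝ] ℝ) (hψ : IsTransverse Ω ψ) :
    epsProd (fun i => flat Ω (a i)) (starAux x y ν k ψ) = ((-1 : ℝ) ^ k * ψ a) • ν := by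
  induction k with
  | zero =>
    rw [epsProd_zero, starAux_zero, Subsingleton.elim a ![]]
    simp
  | succ k ih =>
    have h1 : IsTransverse Ω (interior (a 0) ψ) := by
      rw [← gr_mem_transverse, ← iota_gr]
      exact iota_mem_transverse _ (gr_mem_transverse.2 hψ)
    rw [epsProd_succ, epsProd_mul_eps, LinearMap.smul_apply, Module.End.mul_apply,
      h.eps_starAux hν _ ψ hψ, map_smul, ih _ _ h1, smul_smul, smul_smul, interior_apply]
    have hs : ((-1 : ℝ) ^ k) * (-1) ^ k = 1 := by rw [← mul_pow]; simp
    have h2 : (Matrix.vecCons (a 0) fun i => a i.succ) = a := Fin.cons_self_tail a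
    rw [h2]
    congr 1
    rw [pow_succ]
    linear_combination (-(-1 : ℝ) ^ k * ψ a) * hs

/-- The star operator of a frame satisfies the defining property of the symplectic star. -/
theorem IsFrame.isSymplecticStar {Ω : V [⋀^Fin 2]→L[ℝ] ℝ} {x y : Fin (2 * n) → V}
    (h : IsFrame Ω x y) {k l : ℕ} (hkl : k + l = 2 * n) :
    IsSymplecticStar n Ω hkl (LinearMap.proj l ∘ₗ starAux x y (volForm n Ω) k) where
  transverse ψ _ := apply_mem_transverse (starAux_mem x y (volForm_mem n Ω) k ψ).2 l
  wedge_eq a b := by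
    refine gr_injective _ ?_
    have hψ : IsTransverse Ω (wedgeFamily fun i => flat Ω (b i)) := by
      intro u i hi
      rw [wedgeFamily_apply]
      refine Matrix.det_eq_zero_of_column_eq_zero i fun j => ?_
      rw [Matrix.of_apply, flat_swap, hi]
      simp
    have hmem := starAux_mem x y (volForm_mem n Ω) k (wedgeFamily fun i => flat Ω (b i))
    have hl : (2 * (n : ℤ) - k) = l := by omega
    rw [hl] at hmem
    rw [gr_castDeg, gr_wedge_wedgeFamily, map_smul, LinearMap.comp_apply, LinearMap.proj_apply,
      ← eq_gr_of_mem_homog hmem.1, h.epsProd_flat_starAux (volForm_mem n Ω) a _ hψ]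
    change _ = _ • volForm n Ω
    congr 1
    rw [wedgeFamily_apply, ← Matrix.det_transpose]
    -- The sign `(-1) ^ k` of `epsProd_flat_starAux` cancels against `Ω(bᵢ, aⱼ) = -Ω(aⱼ, bᵢ)`,
    -- applied in all `k` rows.
    have h1 := Matrix.det_neg (Matrix.of fun i j => Ω ![a i, b j])
    have h2 : (Matrix.of fun i j => flat Ω (b i) (a j)).transpose =
        -(Matrix.of fun i j => Ω ![a i, b j]) := by
      ext i j
      simp only [Matrix.transpose_apply, Matrix.of_apply, Matrix.neg_apply]
      rw [flat_swap, flat_apply]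
    have hs : ((-1 : ℝ) ^ k) * (-1) ^ k = 1 := by rw [← mul_pow]; simp
    rw [h2, h1, Fintype.card_fin, ← mul_assoc, hs, one_mul]

/-- The symplectic star operator is the star operator of any frame. -/
theorem IsFrame.gr_symplecticStar {Ω : V [⋀^Fin 2]→L[ℝ] ℝ} {x y : Fin (2 * n) → V}
    (h : IsFrame Ω x y) {k l : ℕ} (hkl : k + l = 2 * n) {φ : V [⋀^Fin k]→L[ℝ] ℝ}
    (hφ : IsTransverse Ω φ) :
    gr l (symplecticStar n Ω k l φ) = starAux x y (volForm n Ω) k φ := by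
  have hex : ∃ (hd : k + l = 2 * n) (S : (V [⋀^Fin k]→L[ℝ] ℝ) →ₗ[ℝ] (V [⋀^Fin l]→L[ℝ] ℝ)),
      IsSymplecticStar n Ω hd S := ⟨hkl, _, h.isSymplecticStar hkl⟩
  have hS : IsSymplecticStar n Ω hkl (symplecticStar n Ω k l) := by
    rw [symplecticStar, dif_pos hex]
    exact hex.choose_spec.choose_spec
  have hS' := h.isSymplecticStar hkl
  have hmem := starAux_mem x y (volForm_mem n Ω) k φ
  have hl : (2 * (n : ℤ) - k) = l := by omega
  rw [hl] at hmem
  rw [eq_gr_of_mem_homog hmem.1]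
  -- Uniqueness of the star: the defining identity fixes the product of `S φ` with every `♭(a₁) ∧ ⋯
  -- ∧ ♭(aₖ)` for `φ` in a spanning set, and these products determine a transverse form.
  refine sub_eq_zero.1 (h.eq_zero_of_epsProd hkl (Submodule.sub_mem _
    (gr_mem_transverseDeg (hS.transverse φ hφ)) (gr_mem_transverseDeg (hS'.transverse φ hφ)))
    fun a => ?_)
  rw [map_sub, sub_eq_zero]
  have h1 := h.mem_span hφ
  have h2 : ∀ φ, epsProd (fun i => flat Ω (a i)) (gr l (starAux x y (volForm n Ω) k φ l)) =
      (epsProd (fun i => flat Ω (a i)) ∘ₗ gr l ∘ₗ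
        (LinearMap.proj l ∘ₗ starAux x y (volForm n Ω) k)) φ := fun _ => rfl
  have h3 : ∀ φ, epsProd (fun i => flat Ω (a i)) (gr l (symplecticStar n Ω k l φ)) =
      (epsProd (fun i => flat Ω (a i)) ∘ₗ gr l ∘ₗ symplecticStar n Ω k l) φ := fun _ => rfl
  rw [h2, h3]
  refine LinearMap.eqOn_span (s := Set.range fun f : Fin k → Fin (2 * n) =>
      wedgeFamily fun i => flat Ω (-y (f i))) ?_ h1
  rintro _ ⟨f, rfl⟩
  have h4 := hS.wedge_eq a (fun i => -y (f i))
  rw [← hS'.wedge_eq] at h4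
  have h5 := congrArg (gr (2 * n)) h4
  rw [gr_castDeg, gr_castDeg, gr_wedge_wedgeFamily, gr_wedge_wedgeFamily] at h5
  exact h5

end Star

/-! ### A differential commuting with the Lefschetz operator -/

section LefschetzDifferential

variable {E : Type*} [AddCommGroup E] [Module ℝ E]

/-- A differential `d` on a subspace `B` stable under `L` and under division by `L`, commuting with
`L`, together with an operator `S` given on `L ^ j φ`, `φ` primitive, by the formula for the
symplectic star operator. -/
structure IsLefschetzDifferential (L Λ S : E →ₗ[ℝ] E) (G : ℤ → Submodule ℝ E) (n : ℕ)
    (B : Submodule ℝ E) (d : E → E) : Prop where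
  triple : IsLefschetzTriple L Λ G n
  surj : ∀ (r : ℕ) (ψ : E), ψ ∈ G (n + r) → ∃ φ ∈ G (n - r), (L ^ r) φ = ψ
  raise_mem : ∀ φ ∈ B, L φ ∈ B
  div_mem : ∀ (k : ℤ) (r : ℕ) (φ : E), k + r ≤ n → φ ∈ G k → (L ^ r) φ ∈ B → φ ∈ B
  deg : ∀ {k φ}, φ ∈ B → φ ∈ G k → d φ ∈ G (k + 1)
  map_add : ∀ {φ ψ}, φ ∈ B → ψ ∈ B → d (φ + ψ) = d φ + d ψ
  map_smul : ∀ (c : ℝ) {φ}, φ ∈ B → d (c • φ) = c • d φ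
  map_raise : ∀ {φ}, φ ∈ B → d (L φ) = L (d φ)
  star : ∀ {m j N : ℕ}, m + j + N = n → ∀ {φ}, φ ∈ G m → Λ φ = 0 →
    S ((L ^ j) φ) = (starSign m * j.factorial * (N.factorial : ℝ)⁻¹) • (L ^ N) φ

namespace IsLefschetzDifferential

variable {L Λ S : E →ₗ[ℝ] E} {G : ℤ → Submodule ℝ E} {n : ℕ} {B : Submodule ℝ E} {d : E → E}

theorem map_zero' (h : IsLefschetzDifferential L Λ S G n B d) : d 0 = 0 := by
  simpa using h.map_smul 0 B.zero_mem

theorem pow_mem (h : IsLefschetzDifferential L Λ S G n B d) {φ : E} (hφ : φ ∈ B) (j : ℕ) :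
    (L ^ j) φ ∈ B := by
  induction j with
  | zero => simpa using hφ
  | succ j ih => rw [end_pow_succ_apply]; exact h.raise_mem _ ih

theorem map_pow (h : IsLefschetzDifferential L Λ S G n B d) {φ : E} (hφ : φ ∈ B) (j : ℕ) :
    d ((L ^ j) φ) = (L ^ j) (d φ) := by
  induction j with
  | zero => simp
  | succ j ih => rw [end_pow_succ_apply, h.map_raise (h.pow_mem hφ j), ih, ← end_pow_succ_apply]

theorem pow_succ_eq_zero (h : IsLefschetzDifferential L Λ S G n B d)
    (hs : ∀ {k φ}, 2 * (n : ℤ) < k → φ ∈ G k → φ = 0) {m N : ℕ} (hmN : m + N = n) {ψ : E}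
    (hψ : ψ ∈ G m) (h0 : Λ ψ = 0) : (L ^ (N + 1)) ψ = 0 :=
  h.triple.pow_eq_zero_of_lower_eq_zero hs (by omega) (by push_cast; omega) hψ h0

/-- An induction principle over the Lefschetz decomposition of `B ∩ G k`. -/
theorem primitive_induction (h : IsLefschetzDifferential L Λ S G n B d)
    (hs : ∀ {k φ}, 2 * (n : ℤ) < k → φ ∈ G k → φ = 0) {k : ℤ} {P : E → Prop}
    (hprim : ∀ (m j N : ℕ) (ψ : E), (m : ℤ) + 2 * j = k → m + j + N = n → ψ ∈ B → ψ ∈ G m →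
      Λ ψ = 0 → P ((L ^ j) ψ))
    (hadd : ∀ φ ψ, φ ∈ B → ψ ∈ B → φ ∈ G k → ψ ∈ G k → P φ → P ψ → P (φ + ψ))
    (hsmul : ∀ (c : ℝ) φ, φ ∈ B → φ ∈ G k → P φ → P (c • φ)) (hzero : P 0)
    {φ : E} (hφ : φ ∈ G k) (hB : φ ∈ B) : P φ := by
  have key := h.triple.mem_span_primitive h.raise_mem h.div_mem h.surj hφ hB
  suffices hk : φ ∈ B ∧ φ ∈ G k ∧ P φ from hk.2.2
  clear hφ hB
  induction key using Submodule.span_induction with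
  | mem χ hχ =>
    obtain ⟨m, j, ψ, hk, hm0, hmn, hψB, hψG, hψ0, rfl⟩ := hχ
    refine ⟨h.pow_mem hψB j, hk ▸ h.triple.pow_mem hψG j, ?_⟩
    lift m to ℕ using hm0
    by_cases hj : m + j ≤ n
    · exact hprim m j (n - (m + j)) ψ hk (by omega) hψB hψG hψ0
    -- If `m + j > n`, the power `L ^ j` already kills the primitive element, and only the zero case
    -- is needed.
    · have h1 := h.pow_succ_eq_zero hs (N := n - m) (by omega) hψG hψ0
      obtain ⟨s, rfl⟩ : ∃ s, j = s + (n - m + 1) := ⟨j - (n - m + 1), by omega⟩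
      rwa [pow_add, Module.End.mul_apply, h1, _root_.map_zero]
  | zero => exact ⟨B.zero_mem, (G k).zero_mem, hzero⟩
  | add φ ψ _ _ ihφ ihψ =>
    obtain ⟨a1, a2, a3⟩ := ihφ
    obtain ⟨b1, b2, b3⟩ := ihψ
    exact ⟨B.add_mem a1 b1, (G k).add_mem a2 b2, hadd _ _ a1 b1 a2 b2 a3 b3⟩
  | smul c φ _ ih =>
    obtain ⟨a1, a2, a3⟩ := ih
    exact ⟨B.smul_mem c a1, (G k).smul_mem c a2, hsmul c _ a1 a2 a3⟩

theorem lower_mem (h : IsLefschetzDifferential L Λ S G n B d)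
    (hs : ∀ {k φ}, 2 * (n : ℤ) < k → φ ∈ G k → φ = 0) {k : ℤ} {φ : E} (hφ : φ ∈ G k)
    (hB : φ ∈ B) : Λ φ ∈ B := by
  refine h.primitive_induction hs (P := fun φ => Λ φ ∈ B) ?_ ?_ ?_ ?_ hφ hB
  · intro m j N ψ _ _ hψB hψG hψ0
    cases j with
    | zero => simp [hψ0]
    | succ j =>
      rw [h.triple.lower_pow_succ hψG, hψ0, _root_.map_zero, zero_add]
      exact B.smul_mem _ (h.pow_mem hψB j)
  · intro φ ψ _ _ _ _ h1 h2
    rw [_root_.map_add]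
    exact B.add_mem h1 h2
  · intro c φ _ _ h1
    rw [_root_.map_smul]
    exact B.smul_mem c h1
  · simp

theorem star_mem (h : IsLefschetzDifferential L Λ S G n B d)
    (hs : ∀ {k φ}, 2 * (n : ℤ) < k → φ ∈ G k → φ = 0) {k : ℤ} {φ : E} (hφ : φ ∈ G k)
    (hB : φ ∈ B) : S φ ∈ B := by
  refine h.primitive_induction hs (P := fun φ => S φ ∈ B) ?_ ?_ ?_ ?_ hφ hB
  · intro m j N ψ _ hN hψB hψG hψ0
    rw [h.star hN hψG hψ0]
    exact B.smul_mem _ (h.pow_mem hψB N)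
  · intro φ ψ _ _ _ _ h1 h2
    rw [_root_.map_add]
    exact B.add_mem h1 h2
  · intro c φ _ _ h1
    rw [_root_.map_smul]
    exact B.smul_mem c h1
  · simp

/-- The primitive parts of the differential of a primitive element. -/
theorem exists_primitive_parts (h : IsLefschetzDifferential L Λ S G n B d)
    (hs : ∀ {k φ}, 2 * (n : ℤ) < k → φ ∈ G k → φ = 0) {m N : ℕ} (hmN : m + N = n) {ψ : E}
    (hB : ψ ∈ B) (hψ : ψ ∈ G m) (h0 : Λ ψ = 0) :
    ∃ α ∈ G (m + 1), ∃ β ∈ G (m - 1), Λ α = 0 ∧ Λ β = 0 ∧ d ψ = α + L β ∧ (L ^ N) α = 0 := by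
  have hγ := h.deg hB hψ
  -- `L ^ (N + 1)` kills the primitive `ψ` and commutes with `d`, so it also kills `d ψ`. This
  -- bounds the Lefschetz decomposition of `d ψ` to two terms.
  have hN : (L ^ (N + 1)) (d ψ) = 0 := by
    rw [← h.map_pow hB, h.pow_succ_eq_zero hs hmN hψ h0, h.map_zero']
  have h2 : Λ (Λ (d ψ)) = 0 := h.triple.lower_lower_eq_zero (by omega) hγ hN
  have hc : ((N : ℝ) + 1) ≠ 0 := by positivity
  -- For primitive `β` of degree `m - 1` one has `Λ L β = (n - m + 1) β = (N + 1) β`. This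
  -- normalization makes `d ψ - L β` primitive.
  have hβ : ((N : ℝ) + 1)⁻¹ • Λ (d ψ) ∈ G (m - 1) := by
    have := (G _).smul_mem ((N : ℝ) + 1)⁻¹ (h.triple.lower hγ)
    rwa [show (m : ℤ) + 1 - 2 = m - 1 by ring] at this
  have hβ0 : Λ (((N : ℝ) + 1)⁻¹ • Λ (d ψ)) = 0 := by rw [_root_.map_smul, h2, smul_zero]
  have hα : d ψ - L (((N : ℝ) + 1)⁻¹ • Λ (d ψ)) ∈ G (m + 1) := by
    refine (G _).sub_mem hγ ?_
    have := h.triple.raise hβ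
    rwa [show (m : ℤ) - 1 + 2 = m + 1 by ring] at this
  have hα0 : Λ (d ψ - L (((N : ℝ) + 1)⁻¹ • Λ (d ψ))) = 0 := by
    rw [map_sub, h.triple.comm hβ, hβ0, _root_.map_zero, zero_add, smul_smul, sub_eq_zero]
    have : (((n : ℤ) : ℝ) - ((m : ℤ) - 1 : ℤ)) * ((N : ℝ) + 1)⁻¹ = 1 := by
      rw [← hmN]
      push_cast
      field_simp
      ring
    rw [this, one_smul]
  refine ⟨_, hα, _, hβ, hα0, hβ0, by abel, ?_⟩
  by_cases hmn : m + 1 ≤ n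
  · exact h.triple.pow_eq_zero_of_lower_eq_zero hs (by omega) (by omega) hα hα0
  · obtain rfl : N = 0 := by omega
    exact h.triple.pow_eq_zero_of_lower_eq_zero hs (by omega) (by push_cast; omega) hα hα0

/-- `± S d S = [d, Λ]` on `B`. -/
theorem star_d_star (h : IsLefschetzDifferential L Λ S G n B d)
    (hs : ∀ {k φ}, 2 * (n : ℤ) < k → φ ∈ G k → φ = 0) {k : ℕ} {φ : E} (hφ : φ ∈ G k)
    (hB : φ ∈ B) : (-1 : ℝ) ^ k • S (d (S φ)) = d (Λ φ) - Λ (d φ) := by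
  refine h.primitive_induction hs
    (P := fun φ => (-1 : ℝ) ^ k • S (d (S φ)) = d (Λ φ) - Λ (d φ)) ?_ ?_ ?_ ?_ hφ hB
  · intro m j N ψ hk hN hψB hψG hψ0
    obtain rfl : m + 2 * j = k := by exact_mod_cast hk
    obtain ⟨α, hα, β, hβ, hα0, hβ0, hdψ, hαN⟩ :=
      h.exists_primitive_parts hs (N := N + j) (by omega) hψB hψG hψ0
    have hsβ : S ((L ^ (N + 1)) β) = -((-1 : ℝ) ^ m * starSign m * (N + 1).factorial *
        (j.factorial : ℝ)⁻¹) • (L ^ j) β := by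
      cases m with
      -- For `m = 0` the part `β` would have degree `-1`.
      | zero =>
        rw [h.triple.eq_zero_of_neg (by simp) hβ]
        simp
      | succ m =>
        have hβ' : β ∈ G m := by simpa using hβ
        rw [h.star (m := m) (N := j) (by omega) hβ' hβ0, starSign_succ]
        congr 1
        have : (-1 : ℝ) ^ (m + 1) * ((-1) ^ m * starSign m) = -starSign m := by
          rw [← mul_assoc, ← pow_add, show m + 1 + m = 2 * m + 1 by ring, pow_succ, pow_mul]
          norm_num
        rw [this]
        ring
    have hα' : α ∈ G ((m + 1 : ℕ) : ℤ) := by exact_mod_cast hα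
    have hS : S (d (S ((L ^ j) ψ))) = (starSign m * j.factorial * (N.factorial : ℝ)⁻¹) •
        (S ((L ^ N) α) + S ((L ^ (N + 1)) β)) := by
      rw [h.star hN hψG hψ0, h.map_smul _ (h.pow_mem hψB N), h.map_pow hψB, hdψ, _root_.map_smul,
        _root_.map_add, ← Module.End.mul_apply (L ^ N) L, ← pow_succ, _root_.map_add]
    have hsq := starSign_mul_self m
    have hdL : d ((L ^ j) ψ) = (L ^ j) α + (L ^ (j + 1)) β := by
      rw [h.map_pow hψB, hdψ, _root_.map_add, ← Module.End.mul_apply (L ^ j) L, ← pow_succ]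
    have hm2 : (-1 : ℝ) ^ (m + 2 * j) = (-1) ^ m := by
      rw [pow_add, pow_mul]
      norm_num
    have hmm : (-1 : ℝ) ^ m * (-1) ^ m = 1 := by
      rw [← pow_add, ← two_mul, pow_mul]
      norm_num
    have hn : (n : ℝ) = m + j + N := by exact_mod_cast hN.symm
    have hNf : (N.factorial : ℝ) ≠ 0 := by positivity
    have hLβ : Λ ((L ^ (j + 1)) β) = (((j : ℝ) + 1) * (N + 1)) • (L ^ j) β := by
      rw [h.triple.lower_pow_succ hβ, hβ0, _root_.map_zero, zero_add]
      congr 2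
      push_cast
      rw [hn]
      ring
    rw [hS, hdL, _root_.map_add Λ, hLβ, hsβ, hm2]
    -- Both sides equal `j L ^ (j - 1) α - (N + 1) L ^ j β`. For `j = 0` the first term is absent
    -- because `L ^ N α = 0`.
    cases j with
    | zero =>
      have hαN' : (L ^ N) α = 0 := by simpa using hαN
      rw [hαN']
      simp only [pow_zero, Module.End.one_apply, hα0, hψ0, _root_.map_zero, h.map_zero', zero_add,
        zero_sub, smul_smul, Nat.factorial_succ, Nat.factorial_zero, smul_neg, neg_smul]
      congr 2
      push_cast
      field_simp
      linear_combination (starSign m * starSign m) * hmm + hsq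
    | succ j =>
      have hLα : Λ ((L ^ (j + 1)) α) = (((j : ℝ) + 1) * N) • (L ^ j) α := by
        rw [h.triple.lower_pow_succ hα, hα0, _root_.map_zero, zero_add]
        congr 2
        push_cast
        rw [hn]
        push_cast
        ring
      have hLψ : Λ ((L ^ (j + 1)) ψ) = (((j : ℝ) + 1) * (N + 1)) • (L ^ j) ψ := by
        rw [h.triple.lower_pow_succ hψG, hψ0, _root_.map_zero, zero_add]
        congr 2
        push_cast
        rw [hn]
        push_cast
        ring
      have hLdψ : (L ^ j) (d ψ) = (L ^ j) α + (L ^ (j + 1)) β := by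
        rw [hdψ, _root_.map_add, ← Module.End.mul_apply (L ^ j) L, ← pow_succ]
      rw [hLα, hLψ, h.map_smul _ (h.pow_mem hψB j), h.map_pow hψB, hLdψ,
        h.star (m := m + 1) (j := N) (N := j) (by omega) hα' hα0, starSign_succ]
      have hjf : (j.factorial : ℝ) ≠ 0 := by positivity
      have e1 : (-1 : ℝ) ^ m * (starSign m * (j + 1).factorial * (N.factorial : ℝ)⁻¹) *
          ((-1) ^ m * starSign m * N.factorial * (j.factorial : ℝ)⁻¹) = j + 1 := by
        rw [Nat.factorial_succ]
        push_cast
        field_simp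
        linear_combination (starSign m * starSign m) * hmm + hsq
      have e2 : (-1 : ℝ) ^ m * (starSign m * (j + 1).factorial * (N.factorial : ℝ)⁻¹) *
          ((-1) ^ m * starSign m * (N + 1).factorial * ((j + 1).factorial : ℝ)⁻¹) = N + 1 := by
        rw [Nat.factorial_succ, Nat.factorial_succ]
        push_cast
        field_simp
        linear_combination (starSign m * starSign m) * hmm + hsq
      rw [smul_smul, smul_add, smul_smul, smul_smul, e1, mul_neg, e2]
      push_cast
      module
  · intro φ ψ hφB hψB hφ hψ h1 h2
    rw [_root_.map_add, _root_.map_add, h.map_add (h.star_mem hs hφ hφB) (h.star_mem hs hψ hψB),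
      h.map_add (h.lower_mem hs hφ hφB) (h.lower_mem hs hψ hψB), h.map_add hφB hψB,
      _root_.map_add, _root_.map_add, smul_add, h1, h2]
    abel
  · intro c φ hφB hφ h1
    rw [_root_.map_smul, _root_.map_smul, h.map_smul c (h.star_mem hs hφ hφB),
      h.map_smul c (h.lower_mem hs hφ hφB), h.map_smul c hφB, _root_.map_smul, _root_.map_smul,
      smul_comm, h1, smul_sub]
  · simp [h.map_zero']

/-- The differential of `Λ² φ`, for harmonic `φ`. -/
theorem d_lower_lower (h : IsLefschetzDifferential L Λ S G n B d)
    (hs : ∀ {k φ}, 2 * (n : ℤ) < k → φ ∈ G k → φ = 0) {k : ℤ} {φ : E} (hφ : φ ∈ G k)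
    (hB : φ ∈ B) : d (Λ (Λ φ)) = (2 : ℝ) • Λ (d (Λ φ)) - Λ (Λ (d φ)) := by
  -- The identity says that `[d, Λ]` commutes with `Λ`. On `L ^ j ψ` with `d ψ = α + L β` it becomes
  -- a comparison of coefficients; `j = 0, 1` are separate because negative powers of `L` would
  -- occur.
  refine h.primitive_induction hs
    (P := fun φ => d (Λ (Λ φ)) = (2 : ℝ) • Λ (d (Λ φ)) - Λ (Λ (d φ))) ?_ ?_ ?_ ?_ hφ hB
  · intro m j N ψ hk hN hψB hψG hψ0
    obtain ⟨α, hα, β, hβ, hα0, hβ0, hdψ, hαN⟩ :=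
      h.exists_primitive_parts hs (N := N + j) (by omega) hψB hψG hψ0
    have hn : (n : ℝ) = m + j + N := by exact_mod_cast hN.symm
    have hdL : ∀ i, d ((L ^ i) ψ) = (L ^ i) α + (L ^ (i + 1)) β := by
      intro i
      rw [h.map_pow hψB, hdψ, _root_.map_add, ← Module.End.mul_apply (L ^ i) L, ← pow_succ]
    have hΛα : ∀ i : ℕ, Λ ((L ^ (i + 1)) α) = (((i : ℝ) + 1) * (n - m - 1 - i)) • (L ^ i) α := by
      intro i
      rw [h.triple.lower_pow_succ hα, hα0, _root_.map_zero, zero_add]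
      congr 2
      push_cast
      ring
    have hΛβ : ∀ i : ℕ, Λ ((L ^ (i + 1)) β) = (((i : ℝ) + 1) * (n - m + 1 - i)) • (L ^ i) β := by
      intro i
      rw [h.triple.lower_pow_succ hβ, hβ0, _root_.map_zero, zero_add]
      congr 2
      push_cast
      ring
    have hΛψ : ∀ i : ℕ, Λ ((L ^ (i + 1)) ψ) = (((i : ℝ) + 1) * (n - m - i)) • (L ^ i) ψ := by
      intro i
      rw [h.triple.lower_pow_succ hψG, hψ0, _root_.map_zero, zero_add]
      congr 2
    match j with
    | 0 =>
      have hLβ := hΛβ 0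
      simp only [zero_add, pow_one, pow_zero, Module.End.one_apply] at hLβ
      simp [hψ0, h.map_zero', hdψ, hα0, hβ0, hLβ]
    | 1 =>
      rw [hΛψ 0, h.map_smul _ (h.pow_mem hψB 0), hdL, hdL, _root_.map_smul, _root_.map_smul,
        _root_.map_add, _root_.map_add, hΛα, hΛβ, hΛβ]
      have hLβ := hΛβ 0
      simp only [zero_add, pow_one, pow_zero, Module.End.one_apply] at hLβ
      simp only [pow_zero, Module.End.one_apply, hψ0, hα0, zero_add, _root_.map_add,
        _root_.map_smul, pow_one, hLβ, smul_zero, h.map_zero']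
      push_cast
      module
    | j + 2 =>
      rw [hΛψ (j + 1), h.map_smul _ (h.pow_mem hψB (j + 1)), hdL, hdL, _root_.map_smul,
        _root_.map_smul, _root_.map_add, _root_.map_add, hΛα, hΛβ, hΛα, hΛβ, hΛψ j, smul_smul,
        h.map_smul _ (h.pow_mem hψB j), hdL, _root_.map_add, _root_.map_smul, _root_.map_smul,
        hΛα, hΛβ]
      push_cast
      module
  · intro φ ψ hφB hψB hφ hψ h1 h2
    have a1 := h.lower_mem hs hφ hφB
    have a2 := h.lower_mem hs hψ hψB
    rw [_root_.map_add, _root_.map_add, h.map_add a1 a2, h.map_add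
      (h.lower_mem hs (h.triple.lower hφ) a1) (h.lower_mem hs (h.triple.lower hψ) a2),
      h.map_add hφB hψB, _root_.map_add, _root_.map_add, _root_.map_add, smul_add, h1, h2]
    abel
  · intro c φ hφB hφ h1
    have a1 := h.lower_mem hs hφ hφB
    rw [_root_.map_smul, _root_.map_smul, h.map_smul c a1, h.map_smul c
      (h.lower_mem hs (h.triple.lower hφ) a1), h.map_smul c hφB, _root_.map_smul, _root_.map_smul,
      _root_.map_smul, h1, smul_sub, smul_comm]
  · simp [h.map_zero']

/-- The elements `φ` of `B` with `d φ = 0` and `d Λ φ = 0`. -/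
def harmonic (h : IsLefschetzDifferential L Λ S G n B d) : Submodule ℝ E where
  -- The condition `Λ φ ∈ B` is included because `lower_mem` covers only homogeneous elements, while
  -- additivity of `d` is available only on `B`.
  carrier := {φ | φ ∈ B ∧ Λ φ ∈ B ∧ d φ = 0 ∧ d (Λ φ) = 0}
  zero_mem' := by simp [h.map_zero']
  add_mem' {φ ψ} hφ hψ := by
    obtain ⟨a1, a2, a3, a4⟩ := hφ
    obtain ⟨b1, b2, b3, b4⟩ := hψ
    refine ⟨B.add_mem a1 b1, ?_, ?_, ?_⟩
    · rw [_root_.map_add]; exact B.add_mem a2 b2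
    · rw [h.map_add a1 b1, a3, b3, add_zero]
    · rw [_root_.map_add, h.map_add a2 b2, a4, b4, add_zero]
  smul_mem' c φ hφ := by
    obtain ⟨a1, a2, a3, a4⟩ := hφ
    refine ⟨B.smul_mem c a1, ?_, ?_, ?_⟩
    · rw [_root_.map_smul]; exact B.smul_mem c a2
    · rw [h.map_smul c a1, a3, smul_zero]
    · rw [_root_.map_smul, h.map_smul c a2, a4, smul_zero]

/-- Once `d φ = 0`, the identity `± S d S = [d, Λ]` turns the coclosedness condition into `d Λ φ =
0`. -/
theorem mem_harmonic (h : IsLefschetzDifferential L Λ S G n B d)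
    (hs : ∀ {k φ}, 2 * (n : ℤ) < k → φ ∈ G k → φ = 0) {k : ℕ} {φ : E} (hφ : φ ∈ G k) :
    φ ∈ h.harmonic ↔ φ ∈ B ∧ d φ = 0 ∧ (-1 : ℝ) ^ k • S (d (S φ)) = 0 := by
  constructor
  · rintro ⟨h1, _, h3, h4⟩
    exact ⟨h1, h3, by rw [h.star_d_star hs hφ h1, h3, h4, _root_.map_zero, sub_zero]⟩
  · rintro ⟨h1, h2, h3⟩
    refine ⟨h1, h.lower_mem hs hφ h1, h2, ?_⟩
    rwa [h.star_d_star hs hφ h1, h2, _root_.map_zero, sub_zero] at h3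

theorem raise_mem_harmonic (h : IsLefschetzDifferential L Λ S G n B d) {k : ℤ} {φ : E}
    (hH : φ ∈ h.harmonic) (hφ : φ ∈ G k) : L φ ∈ h.harmonic := by
  obtain ⟨h1, h2, h3, h4⟩ := hH
  refine ⟨h.raise_mem _ h1, ?_, ?_, ?_⟩
  · rw [h.triple.comm hφ]
    exact B.add_mem (h.raise_mem _ h2) (B.smul_mem _ h1)
  · rw [h.map_raise h1, h3, _root_.map_zero]
  · rw [h.triple.comm hφ, h.map_add (h.raise_mem _ h2) (B.smul_mem _ h1), h.map_raise h2,
      h.map_smul _ h1, h3, h4, _root_.map_zero, smul_zero, add_zero]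

/-- The only new condition is `d Λ² φ = 0`; by `d_lower_lower` the form `d Λ² φ` is a combination of
`Λ d Λ φ` and `Λ² d φ`, both zero. -/
theorem lower_mem_harmonic (h : IsLefschetzDifferential L Λ S G n B d)
    (hs : ∀ {k φ}, 2 * (n : ℤ) < k → φ ∈ G k → φ = 0) {k : ℤ} {φ : E}
    (hH : φ ∈ h.harmonic) (hφ : φ ∈ G k) : Λ φ ∈ h.harmonic := by
  obtain ⟨h1, h2, h3, h4⟩ := hH
  refine ⟨h2, h.lower_mem hs (h.triple.lower hφ) h2, h4, ?_⟩
  rw [h.d_lower_lower hs hφ h1, h3, h4, _root_.map_zero, _root_.map_zero, smul_zero, sub_zero]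

theorem pow_mem_harmonic (h : IsLefschetzDifferential L Λ S G n B d) {k : ℤ} {φ : E}
    (hH : φ ∈ h.harmonic) (hφ : φ ∈ G k) (r : ℕ) : (L ^ r) φ ∈ h.harmonic := by
  induction r with
  | zero => simpa using hH
  | succ r ih =>
    rw [end_pow_succ_apply]
    exact h.raise_mem_harmonic ih (h.triple.pow_mem hφ r)

/-- The preimage supplied by `surj` need not lie in `B`. Since the harmonic elements of pure degree
are carried to harmonic ones by `L` and `Λ`, division by `L ^ r` makes it harmonic. -/
theorem exists_harmonic_pow_eq (h : IsLefschetzDifferential L Λ S G n B d)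
    (hs : ∀ {k φ}, 2 * (n : ℤ) < k → φ ∈ G k → φ = 0) (r : ℕ) {ψ : E}
    (hH : ψ ∈ h.harmonic) (hψ : ψ ∈ G (n + r)) :
    ∃ φ ∈ G (n - r), φ ∈ h.harmonic ∧ (L ^ r) φ = ψ := by
  obtain ⟨φ, hφ, rfl⟩ := h.surj r ψ hψ
  exact ⟨φ, hφ, h.triple.mem_of_pow_mem (fun k φ hφ hk => h.raise_mem_harmonic hφ hk)
    (fun k φ hφ hk => h.lower_mem_harmonic hs hφ hk) (by omega) hφ hH, rfl⟩

end IsLefschetzDifferential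

end LefschetzDifferential

/-! ### Gram matrices -/

section Gram

variable {V : Type*} [AddCommGroup V] [Module ℝ V] [TopologicalSpace V] {n : ℕ}

/-- The matrix of `Ω` on a family of vectors. -/
def gram (Ω : V [⋀^Fin 2]→L[ℝ] ℝ) (x : Fin (2 * n) → V) : Matrix (Fin (2 * n)) (Fin (2 * n)) ℝ :=
  Matrix.of fun i j => flat Ω (x i) (x j)

theorem gram_apply (Ω : V [⋀^Fin 2]→L[ℝ] ℝ) (x : Fin (2 * n) → V) (i j : Fin (2 * n)) :
    gram Ω x i j = flat Ω (x i) (x j) := rfl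

/-- The family `Ω`-dual to `x`, computed by inverting the Gram matrix. -/
def dualFamily (Ω : V [⋀^Fin 2]→L[ℝ] ℝ) (x : Fin (2 * n) → V) (k : Fin (2 * n)) : V :=
  ∑ j, (gram Ω x)⁻¹ j k • x j

theorem flat_sum_smul (Ω : V [⋀^Fin 2]→L[ℝ] ℝ) {ι : Type*} (s : Finset ι) (c : ι → ℝ) (x : ι → V)
    (v : V) : flat Ω (∑ i ∈ s, c i • x i) v = ∑ i ∈ s, c i * flat Ω (x i) v := by
  rw [← flatₗ_apply, map_sum]
  simp [sum_apply, flatₗ_apply]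

theorem flat_eq_of_flat_sub {Ω : V [⋀^Fin 2]→L[ℝ] ℝ} {a b : V} (h : flat Ω (a - b) = 0) :
    flat Ω a = flat Ω b := by
  have := map_sub (flatₗ Ω) a b
  rw [flatₗ_apply, h] at this
  exact sub_eq_zero.1 this.symm

theorem isFrame_dualFamily_of_span {Ω : V [⋀^Fin 2]→L[ℝ] ℝ} {x : Fin (2 * n) → V}
    (hx : ∀ v, ∃ c : Fin (2 * n) → ℝ, flat Ω (v - ∑ i, c i • x i) = 0)
    (hdet : (gram Ω x).det ≠ 0) : IsFrame Ω x (dualFamily Ω x) := by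
  have hu : IsUnit (gram Ω x).det := isUnit_iff_ne_zero.2 hdet
  have dual : ∀ i j, flat Ω (x i) (dualFamily Ω x j) = if i = j then 1 else 0 := by
    intro i j
    have h1 := congrFun (congrFun (Matrix.mul_nonsing_inv _ hu) i) j
    rw [Matrix.mul_apply, Matrix.one_apply] at h1
    rw [← h1, dualFamily, map_sum]
    refine Finset.sum_congr rfl fun l _ => ?_
    rw [map_smul, smul_eq_mul, mul_comm]
    rfl
  refine ⟨dual, fun v => ?_⟩
  obtain ⟨c, hc⟩ := hx v
  have hv : ∀ j, flat Ω v (dualFamily Ω x j) = c j := by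
    intro j
    rw [flat_eq_of_flat_sub hc, flat_sum_smul]
    simp [dual]
  simpa only [hv] using hc

/-- Expanding `yⱼ` in the `xₖ` shows that the pairings of the `y`'s with each other form, up to
transposition, the inverse Gram matrix. -/
theorem IsFrame.gram_det_ne_zero {Ω : V [⋀^Fin 2]→L[ℝ] ℝ} {x y : Fin (2 * n) → V}
    (h : IsFrame Ω x y) : (gram Ω x).det ≠ 0 := by
  have h1 : gram Ω x * (Matrix.of fun k j => flat Ω (y j) (y k)) = 1 := by
    ext i j
    rw [Matrix.mul_apply, Matrix.one_apply, ← h.dual, flat_swap Ω (x i) (y j),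
      flat_eq_of_flat_sub (h.expand (y j)), flat_sum_smul, ← Finset.sum_neg_distrib]
    refine Finset.sum_congr rfl fun k _ => ?_
    rw [gram_apply, Matrix.of_apply, flat_swap Ω (x i) (x k)]
    ring
  intro h0
  have h2 := congrArg Matrix.det h1
  rw [Matrix.det_mul, h0, zero_mul, Matrix.det_one] at h2
  exact zero_ne_one h2

/-- The matrix `P` expressing `x` through the known frame `x'` is a factor of the Gram matrix, hence
invertible, so `x` also spans modulo the kernel. Nondegeneracy of one determinant, an open
condition, thus keeps fixed vectors a frame nearby. -/
theorem IsFrame.isFrame_dualFamily {Ω : V [⋀^Fin 2]→L[ℝ] ℝ} {x x' y' : Fin (2 * n) → V}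
    (h : IsFrame Ω x' y') (hdet : (gram Ω x).det ≠ 0) : IsFrame Ω x (dualFamily Ω x) := by
  set P : Matrix (Fin (2 * n)) (Fin (2 * n)) ℝ := Matrix.of fun i j => flat Ω (x i) (y' j) with hP
  have hxP : ∀ i v, flat Ω (x i) v = ∑ j, P i j * flat Ω (x' j) v := by
    intro i v
    rw [flat_eq_of_flat_sub (h.expand (x i)), flat_sum_smul]
    rfl
  have hG : gram Ω x = P * (Matrix.of fun j k => flat Ω (x' j) (x k)) := by
    ext i k
    rw [gram_apply, hxP, Matrix.mul_apply]
    rfl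
  have hPdet : IsUnit P.det := by
    rw [isUnit_iff_ne_zero]
    intro h0
    rw [hG, Matrix.det_mul, h0, zero_mul] at hdet
    exact hdet rfl
  refine isFrame_dualFamily_of_span (fun v => ⟨fun i => ∑ j, flat Ω v (y' j) * P⁻¹ j i, ?_⟩) hdet
  have hx' : ∀ j w, flat Ω (x' j) w = ∑ i, P⁻¹ j i * flat Ω (x i) w := by
    intro j w
    simp only [hxP, Finset.mul_sum]
    rw [Finset.sum_comm]
    have h1 := Matrix.nonsing_inv_mul P hPdet
    have h2 : ∀ k, ∑ i, P⁻¹ j i * (P i k * flat Ω (x' k) w) =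
        (if j = k then 1 else 0) * flat Ω (x' k) w := by
      intro k
      rw [← Matrix.one_apply, ← h1, Matrix.mul_apply, Finset.sum_mul]
      exact Finset.sum_congr rfl fun i _ => by ring
    simp [h2]
  refine ContinuousLinearMap.ext fun w => ?_
  have h3 : flat Ω (v - ∑ i, (∑ j, flat Ω v (y' j) * P⁻¹ j i) • x i) w =
      flat Ω v w - flat Ω (∑ i, (∑ j, flat Ω v (y' j) * P⁻¹ j i) • x i) w := by
    rw [← flatₗ_apply, map_sub]
    rfl
  have h4 := DFunLike.congr_fun (flat_eq_of_flat_sub (h.expand v)) w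
  rw [flat_sum_smul] at h4
  rw [h3, h4, flat_sum_smul, zero_apply, sub_eq_zero]
  simp only [hx', Finset.sum_mul, Finset.mul_sum]
  rw [Finset.sum_comm]
  exact Finset.sum_congr rfl fun i _ => Finset.sum_congr rfl fun j _ => by ring

end Gram

/-! ### Calculus of forms on a normed space -/

section Calculus

variable {V : Type*} [NormedAddCommGroup V] [NormedSpace ℝ V]

-- For `A` the derivative of a form this is the coordinate formula `d = ∑ ξᵢ ∧ ∂ᵢ`.
open ContinuousAlternatingMap in
theorem alternatizeUncurryFin_eq_sum {ι : Type*} [Fintype ι] {ξ : ι → V →L[ℝ] ℝ} {x : ι → V}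
    (hx : ∀ v, ∑ i, ξ i v • x i = v) {k : ℕ} (A : V →L[ℝ] V [⋀^Fin k]→L[ℝ] ℝ) :
    alternatizeUncurryFin A = ∑ i, extMul (ξ i) k (A (x i)) := by
  refine ContinuousAlternatingMap.ext fun u => ?_
  have hA : ∀ v w, A v w = ∑ i, ξ i v * A (x i) w := by
    intro v w
    conv_lhs => rw [← hx v, _root_.map_sum]
    simp [ContinuousAlternatingMap.sum_apply]
  rw [alternatizeUncurryFin_apply, ContinuousAlternatingMap.sum_apply]
  simp only [extMul_apply]
  rw [Finset.sum_comm]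
  refine Finset.sum_congr rfl fun j _ => ?_
  rw [hA, Finset.smul_sum]
  refine Finset.sum_congr rfl fun i _ => ?_
  simp

open ContinuousAlternatingMap in
/-- The Cartan-type formula for two contractions of an exterior derivative with vector fields that
annihilate the form. -/
theorem interior_interior_alternatize {k : ℕ} {Ω : V [⋀^Fin 2]→L[ℝ] ℝ}
    {A : V →L[ℝ] V [⋀^Fin (k + 1)]→L[ℝ] ℝ} {φ : V [⋀^Fin (k + 1)]→L[ℝ] ℝ}
    (hφ : IsTransverse Ω φ) {X Y : V} (hY : flat Ω Y = 0) {X' Y' : V → V}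
    (hX' : ∀ w, interior X (A w) = -interior (X' w) φ)
    (hY' : ∀ w, interior Y (A w) = -interior (Y' w) φ) :
    interior Y (interior X (alternatizeUncurryFin A)) = interior (X' Y - Y' X) φ := by
  refine ContinuousAlternatingMap.ext fun u => ?_
  rw [interior_apply, interior_apply, alternatizeUncurryFin_apply, Fin.sum_univ_succ,
    Fin.sum_univ_succ]
  have h0 : (0 : Fin (k + 2)).removeNth (Matrix.vecCons X (Matrix.vecCons Y u)) =
      Matrix.vecCons Y u := by
    funext i
    simp [Fin.removeNth]
  have hs : ∀ i : Fin (k + 1), i.succ.removeNth (Matrix.vecCons X (Matrix.vecCons Y u)) =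
      Matrix.vecCons X (i.removeNth (Matrix.vecCons Y u)) := by
    intro i
    funext j
    refine Fin.cases ?_ (fun j => ?_) j
    · rfl
    · simp [Fin.removeNth, Fin.succ_succAbove_succ]
  have h1 : (0 : Fin (k + 1)).removeNth (Matrix.vecCons Y u) = u := by
    funext i
    simp [Fin.removeNth]
  -- When the derivative is taken in a direction other than `X` and `Y`, the vector `Y` remains
  -- among the arguments of `φ` and kills the term.
  have hz : ∀ i : Fin k, A (u i) (Matrix.vecCons X (i.succ.removeNth (Matrix.vecCons Y u))) = 0 := by
    intro i
    rw [← interior_apply, hX', ContinuousAlternatingMap.neg_apply, interior_apply]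
    cases k with
    | zero => exact i.elim0
    | succ k =>
      rw [hφ _ 1 (by simpa [Fin.removeNth] using hY), neg_zero]
  have e1 : A X (Matrix.vecCons Y u) = -φ (Matrix.vecCons (Y' X) u) :=
    DFunLike.congr_fun (hY' X) u
  have e2 : A Y (Matrix.vecCons X u) = -φ (Matrix.vecCons (X' Y) u) :=
    DFunLike.congr_fun (hX' Y) u
  have e3 : interior (X' Y - Y' X) φ u =
      φ (Matrix.vecCons (X' Y) u) - φ (Matrix.vecCons (Y' X) u) := by
    rw [sub_eq_add_neg, ← neg_one_smul ℝ (Y' X), interior_add_left, interior_smul_left]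
    simp [interior_apply, sub_eq_add_neg]
  rw [e3]
  simp only [hs, h0, Matrix.cons_val_zero, Matrix.cons_val_succ, hz, smul_zero,
    Finset.sum_const_zero, h1, e1, e2]
  simp
  ring

variable [FiniteDimensional ℝ V]

/-- The Lefschetz operator as a continuous bilinear map. -/
def lefL (k : ℕ) : (V [⋀^Fin 2]→L[ℝ] ℝ) →L[ℝ] (V [⋀^Fin k]→L[ℝ] ℝ) →L[ℝ] V [⋀^Fin (k + 2)]→L[ℝ] ℝ :=
  (lefₗ k).toContinuousBilinearMap

theorem lefL_apply (k : ℕ) (Ω : V [⋀^Fin 2]→L[ℝ] ℝ) (φ : V [⋀^Fin k]→L[ℝ] ℝ) :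
    lefL k Ω φ = lef Ω φ := lefₗ_apply k Ω φ

/-- The interior product as a continuous bilinear map. -/
def interiorL (k : ℕ) : V →L[ℝ] (V [⋀^Fin (k + 1)]→L[ℝ] ℝ) →L[ℝ] V [⋀^Fin k]→L[ℝ] ℝ :=
  (LinearMap.mk₂ ℝ (fun v φ => interior v φ) (fun v w φ => interior_add_left v w φ)
    (fun c v φ => interior_smul_left c v φ) (fun v φ ψ => map_add (interiorₗ v k) φ ψ)
    (fun c v φ => map_smul (interiorₗ v k) c φ)).toContinuousBilinearMap

/-- `Ω` and evaluation at two vectors as a continuous linear map. -/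
def flatEval (a b : V) : (V [⋀^Fin 2]→L[ℝ] ℝ) →L[ℝ] ℝ :=
  LinearMap.toContinuousLinearMap
    { toFun := fun Ω => flat Ω a b
      map_add' := fun Ω Ω' => by simp [flat_apply]
      map_smul' := fun c Ω => by simp [flat_apply] }

theorem flatEval_apply (a b : V) (Ω : V [⋀^Fin 2]→L[ℝ] ℝ) : flatEval a b Ω = flat Ω a b := rfl

theorem contDiffAt_det {W ι : Type*} [NormedAddCommGroup W] [NormedSpace ℝ W] [Fintype ι]
    [DecidableEq ι] {r : ℕ∞ω} {A : W → Matrix ι ι ℝ} {w : W}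
    (hA : ∀ i j, ContDiffAt ℝ r (fun z => A z i j) w) : ContDiffAt ℝ r (fun z => (A z).det) w := by
  simp only [Matrix.det_apply']
  exact ContDiffAt.sum fun σ _ => contDiffAt_const.mul (contDiffAt_prod fun i _ => hA _ _)

theorem contDiffAt_inv_apply {W ι : Type*} [NormedAddCommGroup W] [NormedSpace ℝ W] [Fintype ι]
    [DecidableEq ι] {r : ℕ∞ω} {A : W → Matrix ι ι ℝ} {w : W}
    (hA : ∀ i j, ContDiffAt ℝ r (fun z => A z i j) w) (hdet : (A w).det ≠ 0) (i j : ι) :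
    ContDiffAt ℝ r (fun z => (A z)⁻¹ i j) w := by
  simp only [Matrix.inv_def, Matrix.smul_apply, Ring.inverse_eq_inv', smul_eq_mul,
    Matrix.adjugate_apply]
  refine ((contDiffAt_det hA).inv hdet).mul (contDiffAt_det fun a b => ?_)
  simp only [Matrix.updateRow_apply]
  split_ifs
  · exact contDiffAt_const
  · exact hA a b

theorem contDiffAt_gram {n : ℕ} {r : ℕ∞ω} {η : V → V [⋀^Fin 2]→L[ℝ] ℝ} {z : V}
    (hη : ContDiffAt ℝ r η z) (x : Fin (2 * n) → V) (i j : Fin (2 * n)) :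
    ContDiffAt ℝ r (fun y => gram (η y) x i j) z :=
  (flatEval (x i) (x j)).contDiff.contDiffAt.comp z hη

theorem contDiffAt_dualFamily {n : ℕ} {r : ℕ∞ω} {η : V → V [⋀^Fin 2]→L[ℝ] ℝ} {z : V}
    (hη : ContDiffAt ℝ r η z) {x : Fin (2 * n) → V} (hdet : (gram (η z) x).det ≠ 0)
    (k : Fin (2 * n)) : ContDiffAt ℝ r (fun y => dualFamily (η y) x k) z := by
  unfold dualFamily
  exact ContDiffAt.sum fun j _ =>
    (contDiffAt_inv_apply (contDiffAt_gram hη x) hdet j k).smul contDiffAt_const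

/-- A frame extends to a smooth family of frames. -/
theorem eventually_isFrame_dualFamily {n : ℕ} {r : ℕ∞ω} {η : V → V [⋀^Fin 2]→L[ℝ] ℝ} {z : V}
    (hη : ContDiffAt ℝ r η z) {x : Fin (2 * n) → V} (hdet : (gram (η z) x).det ≠ 0)
    (hframe : ∀ᶠ y in nhds z, ∃ x' y' : Fin (2 * n) → V, IsFrame (η y) x' y') :
    ∀ᶠ y in nhds z, IsFrame (η y) x (dualFamily (η y) x) := by
  have h1 : ∀ᶠ y in nhds z, (gram (η y) x).det ≠ 0 :=
    (contDiffAt_det (contDiffAt_gram hη x)).continuousAt.eventually_ne hdet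
  filter_upwards [h1, hframe] with y hy ⟨x', y', hf⟩
  exact hf.isFrame_dualFamily hy

theorem contDiffAt_bilinear {W A B C : Type*} [NormedAddCommGroup W] [NormedSpace ℝ W]
    [NormedAddCommGroup A] [NormedSpace ℝ A] [NormedAddCommGroup B] [NormedSpace ℝ B]
    [NormedAddCommGroup C] [NormedSpace ℝ C] (b : A →L[ℝ] B →L[ℝ] C) {r : ℕ∞ω} {f : W → A}
    {g : W → B} {w : W} (hf : ContDiffAt ℝ r f w) (hg : ContDiffAt ℝ r g w) :
    ContDiffAt ℝ r (fun z => b (f z) (g z)) w :=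
  b.isBoundedBilinearMap.contDiff.contDiffAt.comp w (hf.prodMk hg)

theorem contDiffAt_lef {k : ℕ} {r : ℕ∞ω} {η : V → V [⋀^Fin 2]→L[ℝ] ℝ}
    {φ : V → V [⋀^Fin k]→L[ℝ] ℝ} {z : V} (hη : ContDiffAt ℝ r η z) (hφ : ContDiffAt ℝ r φ z) :
    ContDiffAt ℝ r (fun y => lef (η y) (φ y)) z := by
  simp only [← lefL_apply]
  exact contDiffAt_bilinear (lefL (V := V) k) hη hφ

theorem contDiffAt_interior {k : ℕ} {r : ℕ∞ω} {X : V → V}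
    {φ : V → V [⋀^Fin (k + 1)]→L[ℝ] ℝ} {z : V} (hX : ContDiffAt ℝ r X z)
    (hφ : ContDiffAt ℝ r φ z) : ContDiffAt ℝ r (fun y => interior (X y) (φ y)) z :=
  contDiffAt_bilinear (interiorL (V := V) k) hX hφ

theorem contDiffAt_lamOp {n k : ℕ} {r : ℕ∞ω} {x y : V → Fin (2 * n) → V} {Φ : V → GForm V}
    {z : V} (hx : ∀ i, ContDiffAt ℝ r (fun v => x v i) z)
    (hy : ∀ i, ContDiffAt ℝ r (fun v => y v i) z)
    (hΦ : ContDiffAt ℝ r (fun v => Φ v (k + 2)) z) :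
    ContDiffAt ℝ r (fun v => lamOp (x v) (y v) (Φ v) k) z := by
  simp only [lamOp_apply_apply]
  exact ContDiffAt.const_smul _ (ContDiffAt.sum fun i _ =>
    contDiffAt_interior (hy i) (contDiffAt_interior (hx i) hΦ))

/-- The Leibniz rule for the product with a closed `2`-form. -/
theorem gr_extDeriv_lef {k : ℕ} {η : V → V [⋀^Fin 2]→L[ℝ] ℝ} {φ : V → V [⋀^Fin k]→L[ℝ] ℝ} {z : V}
    (hη : DifferentiableAt ℝ η z) (hφ : DifferentiableAt ℝ φ z) (hd : extDeriv η z = 0) :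
    gr (k + 2 + 1) (extDeriv (fun y => lef (η y) (φ y)) z) =
      lefOp (η z) (gr (k + 1) (extDeriv φ z)) := by
  obtain ⟨ξ, x, hx⟩ := exists_coordinates V
  have hD := (lefL k).hasFDerivAt_of_bilinear hη.hasFDerivAt hφ.hasFDerivAt
  have hD' : ∀ w, fderiv ℝ (fun y => lef (η y) (φ y)) z w =
      lef (η z) (fderiv ℝ φ z w) + lef (fderiv ℝ η z w) (φ z) := fun w =>
    DFunLike.congr_fun hD.fderiv w
  rw [extDeriv, alternatizeUncurryFin_eq_sum hx, extDeriv, alternatizeUncurryFin_eq_sum hx]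
  rw [extDeriv, alternatizeUncurryFin_eq_sum hx] at hd
  -- This sum is `d η ∧ φ`, the half of the Leibniz rule that vanishes by closedness. The other half
  -- is `η ∧ d φ`, because `L` commutes with multiplication by each `ξᵢ`.
  have h2 : ∑ i, eps (ξ i) (gr (k + 2) (lef (fderiv ℝ η z (x i)) (φ z))) = 0 := by
    have h3 : gr (2 + 1 + k) (wedgeₗ (2 + 1) k (∑ i, extMul (ξ i) 2 (fderiv ℝ η z (x i))) (φ z)) =
        0 := by
      rw [hd, map_zero, LinearMap.zero_apply, map_zero]
    rw [map_sum, LinearMap.sum_apply, map_sum] at h3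
    rw [← h3]
    refine Finset.sum_congr rfl fun i _ => ?_
    rw [gr_lef]
    exact (gr_wedge_extMul _ _ _).symm
  rw [map_sum, map_sum, map_sum]
  have h4 : ∀ i, gr (k + 2 + 1) (extMul (ξ i) (k + 2)
      (fderiv ℝ (fun y => lef (η y) (φ y)) z (x i))) =
      lefOp (η z) (gr (k + 1) (extMul (ξ i) k (fderiv ℝ φ z (x i)))) +
        eps (ξ i) (gr (k + 2) (lef (fderiv ℝ η z (x i)) (φ z))) := by
    intro i
    rw [hD', map_add, map_add, ← eps_gr, ← eps_gr, ← lefOp_gr, ← eps_gr]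
    congr 1
    exact (LinearMap.congr_fun (lefOp_mul_eps (η z) (ξ i)) _).symm
  rw [Finset.sum_congr rfl fun i _ => h4 i, Finset.sum_add_distrib, h2, add_zero]

/-- The exterior derivative of a transverse form is annihilated by two contractions with the kernel
of a closed `2`-form. -/
theorem interior_interior_extDeriv {n k : ℕ} {η : V → V [⋀^Fin 2]→L[ℝ] ℝ}
    {φ : V → V [⋀^Fin (k + 1)]→L[ℝ] ℝ} {z : V} (hη : ContDiffAt ℝ ∞ η z)
    (hφ : DifferentiableAt ℝ φ z) (hd : extDeriv η z = 0)
    (hframe : ∀ᶠ y in nhds z, ∃ x' y' : Fin (2 * n) → V, IsFrame (η y) x' y')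
    (ht : ∀ᶠ y in nhds z, IsTransverse (η y) (φ y)) {X Y : V} (hX : flat (η z) X = 0)
    (hY : flat (η z) Y = 0) : interior Y (interior X (extDeriv φ z)) = 0 := by
  obtain ⟨x, y, hxy⟩ := hframe.self_of_nhds
  have hdet := hxy.gram_det_ne_zero
  have hf := eventually_isFrame_dualFamily hη hdet hframe
  -- Here `N X` is the constant field `X` projected along the frame to the kernel of `η`. It is
  -- differentiable at `z` and takes the value `X` at `z` if `X` lies in the kernel there.
  set N : V → V → V := fun X v => X - ∑ i, flat (η v) X (dualFamily (η v) x i) • x i with hN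
  have hN0 : ∀ X, flat (η z) X = 0 → N X z = X := by
    intro X hX
    simp [hN, hX]
  have hNdiff : ∀ X, DifferentiableAt ℝ (N X) z := by
    intro X
    have h1 : ∀ i, DifferentiableAt ℝ (fun v => flat (η v) X (dualFamily (η v) x i)) z := by
      intro i
      have h2 : ∀ v, flat (η v) X (dualFamily (η v) x i) =
          ∑ j, (gram (η v) x)⁻¹ j i * flatEval X (x j) (η v) := by
        intro v
        rw [dualFamily, map_sum]
        exact Finset.sum_congr rfl fun j _ => by rw [map_smul, smul_eq_mul, flatEval_apply]
      simp only [h2]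
      refine DifferentiableAt.fun_sum fun j _ => ?_
      exact ((contDiffAt_inv_apply (contDiffAt_gram hη x) hdet j i).differentiableAt
        (by simp)).mul ((flatEval X (x j)).differentiableAt.comp z (hη.differentiableAt (by simp)))
    exact (differentiableAt_const X).sub
      (DifferentiableAt.fun_sum fun i _ => (h1 i).smul_const (x i))
  have key : ∀ {l : ℕ} {ψ : V → V [⋀^Fin (l + 1)]→L[ℝ] ℝ}, DifferentiableAt ℝ ψ z →
      (∀ᶠ y in nhds z, IsTransverse (η y) (ψ y)) → ∀ X, flat (η z) X = 0 → ∀ w,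
      interior X (fderiv ℝ ψ z w) = -interior (fderiv ℝ (N X) z w) (ψ z) := by
    intro l ψ hψ ht X hX w
    -- Differentiating `i(N X) ψ = 0` moves the derivative from `ψ` to the field.
    have h0 : (fun v => interiorL l (N X v) (ψ v)) =ᶠ[nhds z] fun _ => 0 := by
      filter_upwards [hf, ht] with v hv hψv
      refine ContinuousAlternatingMap.ext fun u => ?_
      exact hψv _ 0 (hv.expand X)
    have h1 := (interiorL l).hasFDerivAt_of_bilinear (hNdiff X).hasFDerivAt hψ.hasFDerivAt
    have h2 := h1.fderiv
    rw [h0.fderiv_eq, fderiv_fun_const] at h2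
    have h3 : (0 : V [⋀^Fin l]→L[ℝ] ℝ) =
        interior (N X z) (fderiv ℝ ψ z w) + interior (fderiv ℝ (N X) z w) (ψ z) :=
      DFunLike.congr_fun h2 w
    rw [hN0 X hX] at h3
    exact eq_neg_of_add_eq_zero_left h3.symm
  have htη : ∀ v, IsTransverse (η v) (η v) := by
    intro v
    rw [← gr_mem_transverse]
    intro a ha
    rw [iota_gr]
    have : interior a (η v) = 0 := by
      refine ContinuousAlternatingMap.ext fun u => ?_
      have h1 : η v ![a, u 0] = 0 := (flat_apply _ _ _).symm.trans (DFunLike.congr_fun ha (u 0))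
      rw [interior_apply]
      refine (congrArg (η v) ?_).trans h1
      funext i
      fin_cases i <;> rfl
    rw [this, map_zero]
  -- The difference is the bracket `[N Y, N X]` at `z`. Taking `η` itself as the transverse form and
  -- using `d η = 0` shows that it lies in the kernel: the kernel is involutive.
  have hb : flat (η z) (fderiv ℝ (N X) z Y - fderiv ℝ (N Y) z X) = 0 := by
    have h1 := interior_interior_alternatize (htη z) hY
      (key (hη.differentiableAt (by simp)) (Filter.Eventually.of_forall htη) X hX)
      (key (hη.differentiableAt (by simp)) (Filter.Eventually.of_forall htη) Y hY)
    have h2 : ContinuousAlternatingMap.alternatizeUncurryFin (fderiv ℝ η z) = 0 := hd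
    rw [h2] at h1
    refine ContinuousLinearMap.ext fun v => ?_
    have h3 := DFunLike.congr_fun h1 ![v]
    rw [flat_apply]
    exact h3.symm
  rw [extDeriv, interior_interior_alternatize ht.self_of_nhds hY (key hφ ht X hX) (key hφ ht Y hY)]
  exact ContinuousAlternatingMap.ext fun u => ht.self_of_nhds _ 0 hb

end Calculus

/-! ### Pullback of covectors -/

section Pullback

variable {V W : Type*} [AddCommGroup V] [Module ℝ V] [TopologicalSpace V]
  [AddCommGroup W] [Module ℝ W] [TopologicalSpace W]

open ContinuousAlternatingMap (compContinuousLinearMap)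

theorem interior_compContinuousLinearMap (A : V →L[ℝ] W) (v : V) {k : ℕ}
    (φ : W [⋀^Fin (k + 1)]→L[ℝ] ℝ) :
    interior v (φ.compContinuousLinearMap A) = (interior (A v) φ).compContinuousLinearMap A := by
  refine ContinuousAlternatingMap.ext fun u => ?_
  change φ (fun i => A (Matrix.vecCons v u i)) = φ (Matrix.vecCons (A v) fun i => A (u i))
  congr 1
  funext i
  refine Fin.cases rfl (fun i => rfl) i

theorem flat_compContinuousLinearMap (A : V →L[ℝ] W) (Ω : W [⋀^Fin 2]→L[ℝ] ℝ) (v w : V) :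
    flat (Ω.compContinuousLinearMap A) v w = flat Ω (A v) (A w) := by
  rw [flat_apply, flat_apply]
  change Ω (fun i => A (![v, w] i)) = _
  congr 1
  funext i
  fin_cases i <;> rfl

theorem wedge_compContinuousLinearMap (A : V →L[ℝ] W) {k l : ℕ} (φ : W [⋀^Fin k]→L[ℝ] ℝ)
    (ψ : W [⋀^Fin l]→L[ℝ] ℝ) :
    wedge (φ.compContinuousLinearMap A) (ψ.compContinuousLinearMap A) =
      (wedge φ ψ).compContinuousLinearMap A := by
  refine ContinuousAlternatingMap.ext fun u => ?_
  have h : ∀ {U : Type _} [AddCommGroup U] [Module ℝ U] [TopologicalSpace U]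
      (φ : U [⋀^Fin k]→L[ℝ] ℝ) (ψ : U [⋀^Fin l]→L[ℝ] ℝ) (u : Fin (k + l) → U),
      wedge φ ψ u = ∑ σ : Equiv.Perm.ModSumCongr (Fin k) (Fin l), LinearMap.mul' ℝ ℝ
        (AlternatingMap.domCoprod.summand φ.toAlternatingMap ψ.toAlternatingMap σ
          (fun i => u (finSumFinEquiv i))) := by
    intro U _ _ _ φ ψ u
    rw [← map_sum, ← sum_apply]
    rfl
  rw [h]
  change _ = wedge φ ψ (fun i => A (u i))
  rw [wedge_apply]
  change _ = LinearMap.mul' ℝ ℝ ((∑ σ : Equiv.Perm.ModSumCongr (Fin k) (Fin l),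
    AlternatingMap.domCoprod.summand φ.toAlternatingMap ψ.toAlternatingMap σ)
      (fun i => A (u (finSumFinEquiv i))))
  rw [sum_apply, map_sum]
  refine Finset.sum_congr rfl fun σ _ => ?_
  induction σ using Quotient.inductionOn' with | _ σ
  rfl

theorem lef_compContinuousLinearMap (A : V →L[ℝ] W) (Ω : W [⋀^Fin 2]→L[ℝ] ℝ) {k : ℕ}
    (φ : W [⋀^Fin k]→L[ℝ] ℝ) :
    lef (Ω.compContinuousLinearMap A) (φ.compContinuousLinearMap A) =
      (lef Ω φ).compContinuousLinearMap A := by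
  rw [lef, wedge_compContinuousLinearMap]
  refine ContinuousAlternatingMap.ext fun u => ?_
  rw [castDeg_apply]
  change _ = lef Ω φ (fun i => A (u i))
  rw [lef, castDeg_apply]
  rfl

/-- Pullback of inhomogeneous forms. -/
def gpull (A : V →L[ℝ] W) : GForm W →ₗ[ℝ] GForm V where
  toFun Φ k := (Φ k).compContinuousLinearMap A
  map_add' _ _ := rfl
  map_smul' _ _ := rfl

theorem gpull_apply (A : V →L[ℝ] W) (Φ : GForm W) (k : ℕ) :
    gpull A Φ k = (Φ k).compContinuousLinearMap A := rfl

theorem gpull_gr (A : V →L[ℝ] W) {k : ℕ}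
    (φ : W [⋀^Fin k]→L[ℝ] ℝ) : gpull A (gr k φ) = gr k (φ.compContinuousLinearMap A) := by
  funext l
  rw [gpull_apply]
  by_cases h : l = k
  · subst h
    rw [gr_same, gr_same]
  · rw [gr_of_ne h, gr_of_ne h]
    rfl

theorem iota_gpull (A : V →L[ℝ] W) (v : V) (Φ : GForm W) :
    iota v (gpull A Φ) = gpull A (iota (A v) Φ) :=
  funext fun k => interior_compContinuousLinearMap A v (Φ (k + 1))

variable {n : ℕ}

theorem lamOp_gpull (A : V →L[ℝ] W) (x y : Fin (2 * n) → V) (Φ : GForm W) :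
    lamOp x y (gpull A Φ) = gpull A (lamOp (fun i => A (x i)) (fun i => A (y i)) Φ) := by
  simp only [lamOp_apply, iota_gpull, map_smul, map_sum]

theorem IsFrame.pullback {Ω : W [⋀^Fin 2]→L[ℝ] ℝ} (A : V →L[ℝ] W) {x y : Fin (2 * n) → V}
    (h : IsFrame Ω (fun i => A (x i)) (fun i => A (y i))) :
    IsFrame (Ω.compContinuousLinearMap A) x y where
  dual i j := by rw [flat_compContinuousLinearMap]; exact h.dual i j
  expand v := by
    refine ContinuousLinearMap.ext fun w => ?_
    rw [flat_compContinuousLinearMap]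
    have h1 := DFunLike.congr_fun (h.expand (A v)) (A w)
    simp only [flat_compContinuousLinearMap, map_sub, map_sum, map_smul]
    exact h1

theorem flat_eq_zero_of_surjective {Ω : W [⋀^Fin 2]→L[ℝ] ℝ} {A : V →L[ℝ] W}
    (hA : Function.Surjective A) {v : V} (hv : flat (Ω.compContinuousLinearMap A) v = 0) :
    flat Ω (A v) = 0 := by
  refine ContinuousLinearMap.ext fun w => ?_
  obtain ⟨w, rfl⟩ := hA w
  rw [← flat_compContinuousLinearMap, hv]
  rfl

theorem IsTransverse.pullback {Ω : W [⋀^Fin 2]→L[ℝ] ℝ} {A : V →L[ℝ] W}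
    (hA : Function.Surjective A) {k : ℕ} {φ : W [⋀^Fin k]→L[ℝ] ℝ} (h : IsTransverse Ω φ) :
    IsTransverse (Ω.compContinuousLinearMap A) (φ.compContinuousLinearMap A) :=
  fun u i hu => h (fun i => A (u i)) i (flat_eq_zero_of_surjective hA hu)

theorem gpull_mem_transverse {Ω : W [⋀^Fin 2]→L[ℝ] ℝ} {A : V →L[ℝ] W}
    (hA : Function.Surjective A) {Φ : GForm W} (h : Φ ∈ transverse Ω) :
    gpull A Φ ∈ transverse (Ω.compContinuousLinearMap A) := by
  intro v hv
  rw [iota_gpull, h _ (flat_eq_zero_of_surjective hA hv), map_zero]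

end Pullback

/-! ### Forms in charts -/

section Charts

variable {m : ℕ} {M : Type*} [TopologicalSpace M] [ChartedSpace (EuclideanSpace ℝ (Fin m)) M]

instance instT2SpaceTangentSpace (x : M) : T2Space (TangentSpace (𝓡 m) x) :=
  inferInstanceAs (T2Space (EuclideanSpace ℝ (Fin m)))

instance instFiniteDimensionalTangentSpace (x : M) :
    FiniteDimensional ℝ (TangentSpace (𝓡 m) x) :=
  inferInstanceAs (FiniteDimensional ℝ (EuclideanSpace ℝ (Fin m)))

/-- The derivative of the inverse of a chart. -/
def symmDeriv (e : OpenPartialHomeomorph M (EuclideanSpace ℝ (Fin m)))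
    (y : EuclideanSpace ℝ (Fin m)) :
    EuclideanSpace ℝ (Fin m) →L[ℝ] TangentSpace (𝓡 m) (e.symm y) :=
  mfderiv (𝓡 m) (𝓡 m) e.symm y

/-- The derivative at `x` of the preferred chart at `x`. -/
def chartDeriv (x : M) : TangentSpace (𝓡 m) x →L[ℝ] EuclideanSpace ℝ (Fin m) :=
  mfderiv (𝓡 m) (𝓡 m) (chartAt (EuclideanSpace ℝ (Fin m)) x) x

theorem extD_eq {k : ℕ} (φ : DForm m M k) (x : M) :
    extD φ x = (extDeriv (inChart (chartAt (EuclideanSpace ℝ (Fin m)) x) φ)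
      (chartAt (EuclideanSpace ℝ (Fin m)) x x)).compContinuousLinearMap (chartDeriv x) := rfl

theorem inChart_add (e : OpenPartialHomeomorph M (EuclideanSpace ℝ (Fin m))) {k : ℕ}
    (φ ψ : DForm m M k) : inChart e (φ + ψ) = inChart e φ + inChart e ψ := rfl

theorem inChart_smul (e : OpenPartialHomeomorph M (EuclideanSpace ℝ (Fin m))) {k : ℕ}
    (c : ℝ) (φ : DForm m M k) : inChart e (c • φ) = c • inChart e φ := rfl

theorem inChart_zero (e : OpenPartialHomeomorph M (EuclideanSpace ℝ (Fin m))) {k : ℕ} :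
    inChart e (0 : DForm m M k) = 0 := rfl

theorem IsSmoothForm.add {k : ℕ} {φ ψ : DForm m M k} (hφ : IsSmoothForm φ) (hψ : IsSmoothForm ψ) :
    IsSmoothForm (φ + ψ) := fun e he => (hφ e he).add (hψ e he)

theorem IsSmoothForm.smul {k : ℕ} {φ : DForm m M k} (c : ℝ) (hφ : IsSmoothForm φ) :
    IsSmoothForm (c • φ) := fun e he => (hφ e he).const_smul c

theorem isSmoothForm_zero {k : ℕ} : IsSmoothForm (0 : DForm m M k) :=
  fun e _ => (contDiffOn_const (c := 0)).congr fun y _ => congrFun (inChart_zero e) y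

theorem IsSmoothForm.contDiffAt {k : ℕ} {φ : DForm m M k} (hφ : IsSmoothForm φ)
    {e : OpenPartialHomeomorph M (EuclideanSpace ℝ (Fin m))}
    (he : e ∈ atlas (EuclideanSpace ℝ (Fin m)) M) {y : EuclideanSpace ℝ (Fin m)}
    (hy : y ∈ e.target) : ContDiffAt ℝ ∞ (inChart e φ) y :=
  (hφ e he).contDiffAt (e.open_target.mem_nhds hy)

theorem isSmoothForm_of_contDiffAt {k : ℕ} {φ : DForm m M k}
    (h : ∀ e ∈ atlas (EuclideanSpace ℝ (Fin m)) M, ∀ y ∈ e.target,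
      ContDiffAt ℝ ∞ (inChart e φ) y) : IsSmoothForm φ :=
  fun e he y hy => (h e he y hy).contDiffWithinAt

theorem IsSmoothForm.differentiableAt {k : ℕ} {φ : DForm m M k} (hφ : IsSmoothForm φ) (x : M) :
    DifferentiableAt ℝ (inChart (chartAt (EuclideanSpace ℝ (Fin m)) x) φ)
      (chartAt (EuclideanSpace ℝ (Fin m)) x x) :=
  (hφ.contDiffAt (chart_mem_atlas _ x) (mem_chart_target _ x)).differentiableAt (by simp)

theorem extD_add {k : ℕ} {φ ψ : DForm m M k} (hφ : IsSmoothForm φ) (hψ : IsSmoothForm ψ) :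
    extD (φ + ψ) = extD φ + extD ψ := by
  funext x
  rw [extD, inChart_add, extDeriv_add (hφ.differentiableAt x) (hψ.differentiableAt x)]
  rfl

theorem extD_smul {k : ℕ} (c : ℝ) (φ : DForm m M k) : extD (c • φ) = c • extD φ := by
  funext x
  rw [extD, inChart_smul, extDeriv_smul]
  rfl

theorem extD_zero {k : ℕ} : extD (0 : DForm m M k) = 0 := by
  have := extD_smul 0 (0 : DForm m M k)
  rwa [zero_smul, zero_smul] at this

theorem inChart_lef (e : OpenPartialHomeomorph M (EuclideanSpace ℝ (Fin m))) (Ω : DForm m M 2)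
    {k : ℕ} (φ : DForm m M k) (y : EuclideanSpace ℝ (Fin m)) :
    inChart e (fun x => lef (Ω x) (φ x)) y = lef (inChart e Ω y) (inChart e φ y) :=
  (lef_compContinuousLinearMap _ _ _).symm

theorem IsSmoothForm.lef {Ω : DForm m M 2} {k : ℕ} {φ : DForm m M k} (hΩ : IsSmoothForm Ω)
    (hφ : IsSmoothForm φ) : IsSmoothForm (fun x => lef (Ω x) (φ x)) := by
  refine isSmoothForm_of_contDiffAt fun e he y hy => ?_
  have h1 := contDiffAt_lef (hΩ.contDiffAt he hy) (hφ.contDiffAt he hy)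
  exact h1.congr_of_eventuallyEq (Filter.Eventually.of_forall fun y => inChart_lef e Ω φ y)

variable [IsManifold (𝓡 m) ∞ M]

instance instIsManifoldOne : IsManifold (𝓡 m) 1 M := IsManifold.of_le (n := ∞) (by norm_num)

theorem surjective_symmDeriv {e : OpenPartialHomeomorph M (EuclideanSpace ℝ (Fin m))}
    (he : e ∈ atlas (EuclideanSpace ℝ (Fin m)) M) {y : EuclideanSpace ℝ (Fin m)}
    (hy : y ∈ e.target) : Function.Surjective
      (symmDeriv e y) :=
  (mdifferentiable_of_mem_atlas (I := 𝓡 m) he).symm.mfderiv_surjective hy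

theorem surjective_chartDeriv (x : M) : Function.Surjective
    (chartDeriv (m := m) x) :=
  (mdifferentiable_chart (I := 𝓡 m) x).mfderiv_surjective (mem_chart_source _ x)

theorem inChart_compContinuousLinearMap (x : M) {k : ℕ} (φ : DForm m M k) :
    (inChart (chartAt (EuclideanSpace ℝ (Fin m)) x) φ
      (chartAt (EuclideanSpace ℝ (Fin m)) x x)).compContinuousLinearMap
      (chartDeriv x) = φ x := by
  have h1 := (mdifferentiable_chart (I := 𝓡 m) x).symm_comp_deriv (mem_chart_source _ x)
  have h2 := (chartAt (EuclideanSpace ℝ (Fin m)) x).left_inv (mem_chart_source _ x)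
  -- The chart followed by its inverse returns `x` only propositionally, so the two values of `φ`
  -- live on different tangent spaces, compared through the common model space.
  have key : ∀ (z : M) (_ : z = x) (u : Fin k → EuclideanSpace ℝ (Fin m)),
      (show EuclideanSpace ℝ (Fin m) [⋀^Fin k]→L[ℝ] ℝ from φ z) u =
        (show EuclideanSpace ℝ (Fin m) [⋀^Fin k]→L[ℝ] ℝ from φ x) u := by
    rintro z rfl u
    rfl
  refine ContinuousAlternatingMap.ext fun u => ?_
  refine (key _ h2 _).trans ?_
  change (φ x) _ = φ x u
  congr 1
  funext i
  exact DFunLike.congr_fun h1 (u i)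

theorem extDeriv_inChart_eq_zero {k : ℕ} {φ : DForm m M k} (h : extD φ = 0) (x : M) :
    extDeriv (inChart (chartAt (EuclideanSpace ℝ (Fin m)) x) φ)
      (chartAt (EuclideanSpace ℝ (Fin m)) x x) = 0 := by
  refine ContinuousAlternatingMap.ext fun u => ?_
  choose w hw using fun i => surjective_chartDeriv x (u i)
  have h1 := DFunLike.congr_fun (congrFun h x) w
  have h2 : (fun i => (chartDeriv x) (w i)) = u := funext hw
  rw [← h2]
  exact h1

theorem gr_extD_lef {Ω : DForm m M 2} (hΩ : IsSmoothForm Ω) (hd : extD Ω = 0) {k : ℕ}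
    {φ : DForm m M k} (hφ : IsSmoothForm φ) (x : M) :
    gr (k + 2 + 1) (extD (fun x => lef (Ω x) (φ x)) x) = lefOp (Ω x) (gr (k + 1) (extD φ x)) := by
  have h1 := gr_extDeriv_lef (hΩ.differentiableAt x) (hφ.differentiableAt x)
    (extDeriv_inChart_eq_zero hd x)
  have h2 : inChart (chartAt (EuclideanSpace ℝ (Fin m)) x) (fun x => lef (Ω x) (φ x)) =
      fun y => lef (inChart (chartAt (EuclideanSpace ℝ (Fin m)) x) Ω y)
        (inChart (chartAt (EuclideanSpace ℝ (Fin m)) x) φ y) := funext fun y => inChart_lef _ Ω φ y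
  rw [lefOp_gr] at h1 ⊢
  have h3 := congrArg (gpull (chartDeriv x)) h1
  rw [gpull_gr, gpull_gr, ← lef_compContinuousLinearMap, inChart_compContinuousLinearMap] at h3
  rw [extD_eq, h2]
  exact h3

section Frames

variable {n : ℕ} {Ω : DForm m M 2}

theorem exists_isFrame_inChart (hF : ∀ x, ∃ X Y : Fin (2 * n) → TangentSpace (𝓡 m) x,
    IsFrame (Ω x) X Y) {e : OpenPartialHomeomorph M (EuclideanSpace ℝ (Fin m))}
    (he : e ∈ atlas (EuclideanSpace ℝ (Fin m)) M) {y : EuclideanSpace ℝ (Fin m)}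
    (hy : y ∈ e.target) :
    ∃ X Y : Fin (2 * n) → EuclideanSpace ℝ (Fin m), IsFrame (inChart e Ω y) X Y := by
  obtain ⟨X, Y, h⟩ := hF (e.symm y)
  choose X' hX' using fun i => surjective_symmDeriv he hy (X i)
  choose Y' hY' using fun i => surjective_symmDeriv he hy (Y i)
  refine ⟨X', Y', IsFrame.pullback (symmDeriv e y) ?_⟩
  rwa [funext hX', funext hY']

theorem isTransverse_inChart {e : OpenPartialHomeomorph M (EuclideanSpace ℝ (Fin m))}
    (he : e ∈ atlas (EuclideanSpace ℝ (Fin m)) M) {y : EuclideanSpace ℝ (Fin m)}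
    (hy : y ∈ e.target) {k : ℕ} {φ : DForm m M k} (hφ : ∀ x, IsTransverse (Ω x) (φ x)) :
    IsTransverse (inChart e Ω y) (inChart e φ y) :=
  (hφ (e.symm y)).pullback (surjective_symmDeriv he hy)

/-- Contracting a transverse form with the Poisson bivector preserves smoothness. -/
theorem isSmoothForm_lamOp (hΩ : IsSmoothForm Ω)
    {X Y : ∀ x : M, Fin (2 * n) → TangentSpace (𝓡 m) x} (hF : ∀ x, IsFrame (Ω x) (X x) (Y x))
    {Φ : ∀ x : M, GForm (TangentSpace (𝓡 m) x)} (ht : ∀ x, Φ x ∈ transverse (Ω x)) (k : ℕ)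
    (hΦ : IsSmoothForm fun x => Φ x (k + 2)) :
    IsSmoothForm fun x => lamOp (X x) (Y x) (Φ x) k := by
  refine isSmoothForm_of_contDiffAt fun e he z hz => ?_
  have hF' : ∀ x, ∃ X Y : Fin (2 * n) → TangentSpace (𝓡 m) x, IsFrame (Ω x) X Y :=
    fun x => ⟨_, _, hF x⟩
  -- The given frames `X`, `Y` need not vary smoothly. Near `z` they are replaced by constant
  -- vectors and their smooth dual family; `IsFrame.lamOp_eq` shows that `Λ` is unchanged.
  obtain ⟨x, y, hxy⟩ := exists_isFrame_inChart hF' he hz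
  have hη := hΩ.contDiffAt he hz
  have hdet := hxy.gram_det_ne_zero
  have hnear : ∀ᶠ w in nhds z, w ∈ e.target := e.open_target.mem_nhds hz
  have hf := eventually_isFrame_dualFamily hη hdet
    (hnear.mono fun w hw => exists_isFrame_inChart hF' he hw)
  have h1 := contDiffAt_lamOp (x := fun _ => x) (fun i => contDiffAt_const (c := x i))
    (contDiffAt_dualFamily hη hdet)
    (Φ := fun w => gpull (symmDeriv e w) (Φ (e.symm w)))
    (k := k) (hΦ.contDiffAt he hz)
  refine h1.congr_of_eventuallyEq ?_
  filter_upwards [hnear, hf] with w hw hfw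
  choose X' hX' using fun i => surjective_symmDeriv he hw (X (e.symm w) i)
  choose Y' hY' using fun i => surjective_symmDeriv he hw (Y (e.symm w) i)
  have h2 : IsFrame (inChart e Ω w) X' Y' := by
    refine IsFrame.pullback (symmDeriv e w) ?_
    rw [funext hX', funext hY']
    exact hF _
  have h3 := hfw.lamOp_eq h2 (gpull_mem_transverse (surjective_symmDeriv he hw) (ht (e.symm w)))
  rw [h3, lamOp_gpull, funext hX', funext hY']
  rfl

/-- The exterior derivative of a transverse form is annihilated by two contractions with the kernel
of the closed form `Ω`. -/
theorem interior_interior_extD (hΩ : IsSmoothForm Ω) (hd : extD Ω = 0)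
    (hF : ∀ x, ∃ X Y : Fin (2 * n) → TangentSpace (𝓡 m) x, IsFrame (Ω x) X Y) {k : ℕ}
    {φ : DForm m M (k + 1)} (hφ : IsSmoothForm φ) (ht : ∀ x, IsTransverse (Ω x) (φ x)) (x : M)
    {a b : TangentSpace (𝓡 m) x} (ha : flat (Ω x) a = 0) (hb : flat (Ω x) b = 0) :
    interior b (interior a (extD φ x)) = 0 := by
  have hz := mem_chart_target (EuclideanSpace ℝ (Fin m)) x
  have he := chart_mem_atlas (EuclideanSpace ℝ (Fin m)) x
  have hnear := (chartAt (EuclideanSpace ℝ (Fin m)) x).open_target.mem_nhds hz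
  have hker : ∀ a : TangentSpace (𝓡 m) x, flat (Ω x) a = 0 →
      flat (inChart (chartAt (EuclideanSpace ℝ (Fin m)) x) Ω
        (chartAt (EuclideanSpace ℝ (Fin m)) x x))
        ((chartDeriv x) a) = 0 := by
    intro a ha
    refine flat_eq_zero_of_surjective (surjective_chartDeriv x) ?_
    rw [inChart_compContinuousLinearMap]
    exact ha
  have h1 := interior_interior_extDeriv (hΩ.contDiffAt he hz) (hφ.differentiableAt x)
    (extDeriv_inChart_eq_zero hd x)
    (Filter.mem_of_superset hnear fun w hw => exists_isFrame_inChart hF he hw)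
    (Filter.mem_of_superset hnear fun w hw => isTransverse_inChart he hw ht) (hker a ha) (hker b hb)
  rw [extD_eq, interior_compContinuousLinearMap, interior_compContinuousLinearMap, h1]
  rfl

end Frames

end Charts

/-! ### Basic forms -/

theorem isTransverse_succ_iff {V : Type*} [AddCommGroup V] [Module ℝ V] [TopologicalSpace V]
    {Ω : V [⋀^Fin 2]→L[ℝ] ℝ} {k : ℕ} {φ : V [⋀^Fin (k + 1)]→L[ℝ] ℝ} :
    IsTransverse Ω φ ↔ ∀ v, flat Ω v = 0 → interior v φ = 0 := by
  rw [← gr_mem_transverse]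
  refine forall₂_congr fun v _ => ?_
  rw [iota_gr]
  exact ⟨fun h => gr_injective k (h.trans (map_zero _).symm), fun h => by rw [h, map_zero]⟩

/-- A `2`-covector whose kernel has codimension `2 n` has a frame. -/
theorem exists_isFrame_of_ker {V : Type*} [AddCommGroup V] [Module ℝ V] [TopologicalSpace V] {n : ℕ}
    {Ω : V [⋀^Fin 2]→L[ℝ] ℝ} {π : V →ₗ[ℝ] Fin (2 * n) → ℝ} (hπ : Function.Surjective π)
    (hker : ∀ v, flat Ω v = 0 ↔ π v = 0) : ∃ x y : Fin (2 * n) → V, IsFrame Ω x y := by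
  choose x hx using fun j : Fin (2 * n) => hπ (Pi.single j 1)
  have hsum : ∀ c : Fin (2 * n) → ℝ, π (∑ i, c i • x i) = c := by
    intro c
    simp only [map_sum, map_smul, hx]
    funext j
    simp [Finset.sum_apply, Pi.single_apply]
  have hexp : ∀ v, flat Ω (v - ∑ i, π v i • x i) = 0 := by
    intro v
    rw [hker, map_sub, hsum, sub_self]
  refine ⟨x, dualFamily Ω x, isFrame_dualFamily_of_span (fun v => ⟨π v, hexp v⟩) fun h0 => ?_⟩
  -- A null vector `c` of the Gram matrix makes `∑ cᵢ xᵢ` orthogonal to all `xⱼ`, hence an element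
  -- of the kernel. Its image under `π` is `c`, which would be zero.
  obtain ⟨c, hc, hc0⟩ := Matrix.exists_vecMul_eq_zero_iff.2 h0
  refine hc ?_
  rw [← hsum c, ← hker]
  have h1 : ∀ j, flat Ω (∑ i, c i • x i) (x j) = 0 := by
    intro j
    rw [flat_sum_smul]
    exact congrFun hc0 j
  refine ContinuousLinearMap.ext fun w => ?_
  rw [flat_swap, flat_eq_of_flat_sub (hexp w), flat_sum_smul]
  simp only [flat_swap Ω (x _) (∑ i, c i • x i), h1]
  simp

/-! ### Vector fields tangent to the leaves, and transversality of basic forms -/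

section Foliation

variable {p q : ℕ} {M : Type*} [TopologicalSpace M]
  [ChartedSpace (EuclideanSpace ℝ (Fin (p + q))) M]

theorem mdifferentiable_of_mem_maximalAtlas
    {e : OpenPartialHomeomorph M (EuclideanSpace ℝ (Fin (p + q)))}
    (he : e ∈ IsManifold.maximalAtlas (𝓡 (p + q)) ∞ M) :
    e.MDifferentiable (𝓡 (p + q)) (𝓡 (p + q)) :=
  ⟨(contMDiffOn_of_mem_maximalAtlas he).mdifferentiableOn (by simp),
    (contMDiffOn_symm_of_mem_maximalAtlas he).mdifferentiableOn (by simp)⟩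

theorem lieD_of_contractVanishes {X : VField (p + q) M} {k : ℕ} {φ : DForm (p + q) M k}
    (h : contractVanishes X φ) : lieD X φ = contract X (extD φ) := by
  cases k with
  | zero => rfl
  | succ k =>
    have h' : contract X φ = 0 := h
    rw [lieD, h', extD_zero, zero_add]

variable [IsManifold (𝓡 (p + q)) ∞ M]

/-- Vectors tangent to the leaves extend to global smooth vector fields tangent to the leaves. -/
theorem Foliation.exists_field [T2Space M] (F : Foliation p q M) {x : M}
    {v : TangentSpace (𝓡 (p + q)) x} (hv : v ∈ F.tangent x) :
    ∃ X : VField (p + q) M, IsSmoothField X ∧ (∀ z, X z ∈ F.tangent z) ∧ X x = v := by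
  obtain ⟨e, he, hx, hF⟩ := F.exists_foliated_chart x
  have hM := mdifferentiable_of_mem_maximalAtlas he
  have hinv : ∀ z ∈ e.source, (mfderiv (𝓡 (p + q)) (𝓡 (p + q)) e z).IsInvertible :=
    fun z hz => ⟨hM.mfderiv hz, rfl⟩
  -- In a foliated chart the last `q` coordinates of `w` vanish, so the constant field `w` is
  -- tangent to the slices throughout the chart. Its pullback is cut off by a bump function.
  let w : EuclideanSpace ℝ (Fin (p + q)) := mfderiv (𝓡 (p + q)) (𝓡 (p + q)) e x v
  let X₀ : VField (p + q) M :=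
    VectorField.mpullback (𝓡 (p + q)) (𝓡 (p + q)) e (fun _ => w)
  obtain ⟨ψ, -, hψ⟩ := (SmoothBumpFunction.nhds_basis_tsupport (I := 𝓡 (p + q)) x).mem_iff.1
    (e.open_source.mem_nhds hx)
  have hX₀ : ContMDiffOn (𝓡 (p + q)) (𝓡 (p + q)).tangent ∞
      (fun z => (⟨z, X₀ z⟩ : TangentBundle (𝓡 (p + q)) M)) e.source := by
    intro z hz
    have hV : ContMDiffAt (𝓡 (p + q)) (𝓡 (p + q)).tangent ∞
        (fun y => (⟨y, w⟩ : TangentBundle (𝓡 (p + q)) (EuclideanSpace ℝ (Fin (p + q))))) (e z) :=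
      contMDiffAt_vectorSpace_iff_contDiffAt.2 contDiffAt_const
    exact (ContMDiffAt.mpullback_vectorField_preimage hV
      (contMDiffAt_of_mem_maximalAtlas he hz) (hinv z hz) (by simp)).contMDiffWithinAt
  refine ⟨fun z => ψ z • X₀ z, ?_, fun z => ?_, ?_⟩
  · exact ContMDiffOn.smul_section_of_tsupport ψ.contMDiff.contMDiffOn e.open_source hψ hX₀
  · by_cases hz : z ∈ e.source
    · rw [hF z hz]
      intro j
      have h1 : mfderiv (𝓡 (p + q)) (𝓡 (p + q)) e z (X₀ z) = w :=
        (hinv z hz).self_apply_inverse w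
      have h2 : mfderiv (𝓡 (p + q)) (𝓡 (p + q)) e z (ψ z • X₀ z) = ψ z • w := by
        rw [map_smul, h1]
        rfl
      have h3 : w (Fin.natAdd p j) = 0 := (hF x hx v).1 hv j
      rw [h2]
      change ψ z * w (Fin.natAdd p j) = 0
      rw [h3, mul_zero]
    · have h0 : ψ z = 0 := image_eq_zero_of_notMem_tsupport fun h => hz (hψ h)
      change ψ z • X₀ z ∈ F.tangent z
      rw [h0, zero_smul]
      exact (F.tangent z).zero_mem
  · have h1 : X₀ x = v := (hinv x hx).inverse_apply_self v
    change ψ x • X₀ x = v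
    rw [ψ.eq_one, one_smul, h1]

theorem IsTransverselySymplectic.exists_isFrame {n : ℕ} {M : Type*} [TopologicalSpace M]
    [ChartedSpace (EuclideanSpace ℝ (Fin (p + 2 * n))) M] [IsManifold (𝓡 (p + 2 * n)) ∞ M]
    {F : Foliation p (2 * n) M} {Ω : DForm (p + 2 * n) M 2} (hΩ : IsTransverselySymplectic F Ω)
    (x : M) : ∃ X Y : Fin (2 * n) → TangentSpace (𝓡 (p + 2 * n)) x, IsFrame (Ω x) X Y := by
  obtain ⟨e, he, hx, hF⟩ := F.exists_foliated_chart x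
  have hM := mdifferentiable_of_mem_maximalAtlas he
  let D : TangentSpace (𝓡 (p + 2 * n)) x →L[ℝ] EuclideanSpace ℝ (Fin (p + 2 * n)) :=
    mfderiv (𝓡 (p + 2 * n)) (𝓡 (p + 2 * n)) e x
  let π : TangentSpace (𝓡 (p + 2 * n)) x →ₗ[ℝ] Fin (2 * n) → ℝ :=
    { toFun := fun v j => D v (Fin.natAdd p j)
      map_add' := fun v w => by funext j; simp
      map_smul' := fun c v => by funext j; simp }
  have hπ : Function.Surjective π := by
    intro c
    have hD : Function.Surjective D := hM.mfderiv_surjective hx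
    obtain ⟨v, hv⟩ := hD (WithLp.toLp 2 (Fin.append (fun _ : Fin p => (0 : ℝ)) c))
    refine ⟨v, funext fun j => ?_⟩
    change D v (Fin.natAdd p j) = c j
    rw [hv]
    exact Fin.append_right (fun _ => (0 : ℝ)) c j
  refine exists_isFrame_of_ker hπ fun v => ?_
  rw [← hΩ.ker_eq, hF x hx]
  exact ⟨fun h => funext h, fun h j => congrFun h j⟩

variable {F : Foliation p q M} {Ω : DForm (p + q) M 2}

theorem contractVanishes_of_isTransverse (hΩ : IsTransverselySymplectic F Ω) {k : ℕ}
    {φ : DForm (p + q) M k} (h : ∀ x, IsTransverse (Ω x) (φ x)) {X : VField (p + q) M}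
    (hX : ∀ x, X x ∈ F.tangent x) : contractVanishes X φ := by
  cases k with
  | zero => trivial
  | succ k => exact funext fun x => isTransverse_succ_iff.1 (h x) _ ((hΩ.ker_eq x _).1 (hX x))

variable [T2Space M]

/-- Global tangent fields realize every leaf vector at a given point, so a condition on all fields
becomes a condition on each tangent space. -/
theorem isTransverse_of_contractVanishes (hΩ : IsTransverselySymplectic F Ω) {k : ℕ}
    {φ : DForm (p + q) M k}
    (h : ∀ X : VField (p + q) M, IsSmoothField X → (∀ x, X x ∈ F.tangent x) →
      contractVanishes X φ) (x : M) : IsTransverse (Ω x) (φ x) := by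
  cases k with
  | zero => exact fun _ i => i.elim0
  | succ k =>
    rw [isTransverse_succ_iff]
    intro v hv
    obtain ⟨X, hX, hXF, rfl⟩ := F.exists_field ((hΩ.ker_eq x v).2 hv)
    exact congrFun (h X hX hXF) x

/-- Basic forms are the smooth forms that are transverse together with their differential. -/
theorem isBasic_iff (hΩ : IsTransverselySymplectic F Ω) {k : ℕ} {φ : DForm (p + q) M k} :
    IsBasic F φ ↔ IsSmoothForm φ ∧ (∀ x, IsTransverse (Ω x) (φ x)) ∧
      ∀ x, IsTransverse (Ω x) (extD φ x) := by
  constructor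
  · intro h
    refine ⟨h.smooth, isTransverse_of_contractVanishes hΩ h.contract_eq,
      isTransverse_of_contractVanishes hΩ fun X hX hXF => ?_⟩
    -- Since `i(X) φ = 0`, Cartan's formula leaves `θ(X) φ = i(X) d φ`; a vanishing Lie derivative
    -- is transversality of `d φ`.
    have h1 := lieD_of_contractVanishes (h.contract_eq X hX hXF)
    rw [h.lie_eq X hX hXF] at h1
    exact h1.symm
  · rintro ⟨h1, h2, h3⟩
    refine ⟨h1, fun X _ hXF => contractVanishes_of_isTransverse hΩ h2 hXF, fun X _ hXF => ?_⟩
    rw [lieD_of_contractVanishes (contractVanishes_of_isTransverse hΩ h2 hXF)]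
    exact contractVanishes_of_isTransverse hΩ h3 hXF

end Foliation

/-! ### Inhomogeneous forms on a manifold -/

section Star

variable {V : Type*} [AddCommGroup V] [Module ℝ V] [TopologicalSpace V] {n : ℕ}

/-- The star operator in all degrees up to `2 n`. -/
def starOp (x y : Fin (2 * n) → V) (ν : GForm V) : Module.End ℝ (GForm V) :=
  ∑ k ∈ Finset.range (2 * n + 1), starAux x y ν k ∘ₗ LinearMap.proj k

theorem starOp_gr (x y : Fin (2 * n) → V) (ν : GForm V) {k : ℕ} (hk : k ≤ 2 * n)
    (φ : V [⋀^Fin k]→L[ℝ] ℝ) : starOp x y ν (gr k φ) = starAux x y ν k φ := by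
  rw [starOp, LinearMap.sum_apply, Finset.sum_eq_single k]
  · rw [LinearMap.comp_apply, LinearMap.proj_apply, gr_same]
  · intro l _ hl
    rw [LinearMap.comp_apply, LinearMap.proj_apply, gr_of_ne hl, map_zero]
  · intro h
    exact absurd (Finset.mem_range.2 (Nat.lt_succ_of_le hk)) h

theorem iota_lefOp_pow_of_flat_eq_zero [IsTopologicalAddGroup V] [ContinuousSMul ℝ V] [T2Space V]
    [FiniteDimensional ℝ V] {Ω : V [⋀^Fin 2]→L[ℝ] ℝ} {a : V} (ha : flat Ω a = 0) (r : ℕ)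
    (Φ : GForm V) : iota a ((lefOp Ω ^ r) Φ) = (lefOp Ω ^ r) (iota a Φ) := by
  have h1 : ∀ Φ, iota a (lefOp Ω Φ) = lefOp Ω (iota a Φ) := by
    intro Φ
    have h2 := LinearMap.congr_fun (iota_mul_lefOp Ω a) Φ
    refine h2.trans ?_
    rw [ha, LinearMap.add_apply, ← zero_smul ℝ (0 : V →L[ℝ] ℝ), eps_smul, zero_smul,
      LinearMap.zero_apply, zero_add, Module.End.mul_apply]
  induction r with
  | zero => rfl
  | succ r ih => rw [end_pow_succ_apply, h1, ih, ← end_pow_succ_apply]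

end Star

/-! ### The Lefschetz structure on inhomogeneous forms over the manifold -/

section Sections

variable {m : ℕ} {M : Type*} [TopologicalSpace M] [ChartedSpace (EuclideanSpace ℝ (Fin m)) M]

variable (m M) in
/-- Inhomogeneous differential forms, without any regularity. -/
abbrev GSection : Type _ := ∀ x : M, GForm (TangentSpace (𝓡 m) x)

/-- The homogeneous component of degree `k`. -/
def component (Φ : GSection m M) (k : ℕ) : DForm m M k := fun x => Φ x k

/-- A form of degree `k` as an inhomogeneous form. -/
def grForm (k : ℕ) : DForm m M k →ₗ[ℝ] GSection m M where
  toFun φ x := gr k (φ x)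
  map_add' φ ψ := funext fun x => map_add (gr k) (φ x) (ψ x)
  map_smul' c φ := funext fun x => map_smul (gr k) c (φ x)

theorem grForm_apply (k : ℕ) (φ : DForm m M k) (x : M) : grForm k φ x = gr k (φ x) := rfl

theorem grForm_injective (k : ℕ) : Function.Injective (grForm k : DForm m M k →ₗ[ℝ] _) :=
  fun _ _ h => funext fun x => gr_injective k (congrFun h x)

theorem component_grForm (k : ℕ) (φ : DForm m M k) : component (grForm k φ) k = φ :=
  funext fun _ => gr_same k _

theorem component_grForm_of_ne {k l : ℕ} (h : l ≠ k) (φ : DForm m M k) :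
    component (grForm k φ) l = 0 :=
  funext fun _ => gr_of_ne h _

/-- Operators acting pointwise. -/
def pointwise (T : ∀ x : M, Module.End ℝ (GForm (TangentSpace (𝓡 m) x))) :
    Module.End ℝ (GSection m M) where
  toFun Φ x := T x (Φ x)
  map_add' Φ Ψ := funext fun x => map_add (T x) (Φ x) (Ψ x)
  map_smul' c Φ := funext fun x => map_smul (T x) c (Φ x)

theorem pointwise_apply (T : ∀ x : M, Module.End ℝ (GForm (TangentSpace (𝓡 m) x)))
    (Φ : GSection m M) (x : M) : pointwise T Φ x = T x (Φ x) := rfl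

theorem pointwise_pow_apply (T : ∀ x : M, Module.End ℝ (GForm (TangentSpace (𝓡 m) x))) (r : ℕ)
    (Φ : GSection m M) (x : M) : (pointwise T ^ r) Φ x = (T x ^ r) (Φ x) := by
  induction r with
  | zero => rfl
  | succ r ih => rw [end_pow_succ_apply, end_pow_succ_apply, pointwise_apply, ih]

/-- The exterior derivative of inhomogeneous forms. -/
def gextD (Φ : GSection m M) : GSection m M := fun x k =>
  match k with
  | 0 => 0
  | k + 1 => extD (component Φ k) x

theorem gextD_zero (Φ : GSection m M) (x : M) : gextD Φ x 0 = 0 := rfl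

theorem gextD_succ (Φ : GSection m M) (x : M) (k : ℕ) :
    gextD Φ x (k + 1) = extD (component Φ k) x := rfl

theorem gextD_grForm {k : ℕ} (φ : DForm m M k) : gextD (grForm k φ) = grForm (k + 1) (extD φ) := by
  funext x l
  rw [grForm_apply]
  cases l with
  | zero => rw [gextD_zero, gr_of_ne (by simp)]
  | succ l =>
    rw [gextD_succ]
    by_cases h : l = k
    · subst h
      rw [component_grForm, gr_same]
    · rw [component_grForm_of_ne h, gr_of_ne (by simpa using h), extD_zero]
      rfl

variable (m M) in
/-- The smooth inhomogeneous forms. -/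
def smoothSections : Submodule ℝ (GSection m M) where
  carrier := {Φ | ∀ k, IsSmoothForm (component Φ k)}
  add_mem' h1 h2 k := (h1 k).add (h2 k)
  zero_mem' _ := isSmoothForm_zero
  smul_mem' c _ h k := (h k).smul c

theorem gextD_add {Φ Ψ : GSection m M} (hΦ : Φ ∈ smoothSections m M)
    (hΨ : Ψ ∈ smoothSections m M) : gextD (Φ + Ψ) = gextD Φ + gextD Ψ := by
  funext x k
  cases k with
  | zero => exact (add_zero _).symm
  | succ k => exact congrFun (extD_add (hΦ k) (hΨ k)) x

theorem gextD_smul (c : ℝ) (Φ : GSection m M) : gextD (c • Φ) = c • gextD Φ := by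
  funext x k
  cases k with
  | zero => exact (smul_zero (A := TangentSpace (𝓡 m) x [⋀^Fin 0]→L[ℝ] ℝ) c).symm
  | succ k => exact congrFun (extD_smul c (component Φ k)) x

theorem gextD_zero' : gextD (0 : GSection m M) = 0 := by
  have := gextD_smul 0 (0 : GSection m M)
  rwa [zero_smul, zero_smul] at this

/-- The pointwise transverse inhomogeneous forms. -/
def transverseSections (Ω : DForm m M 2) : Submodule ℝ (GSection m M) where
  carrier := {Φ | ∀ x, Φ x ∈ transverse (Ω x)}
  add_mem' h1 h2 x := (transverse (Ω x)).add_mem (h1 x) (h2 x)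
  zero_mem' x := (transverse (Ω x)).zero_mem
  smul_mem' c _ h x := (transverse (Ω x)).smul_mem c (h x)

/-- The pointwise transverse forms of degree `k`. -/
def transverseDegSections (Ω : DForm m M 2) (k : ℤ) : Submodule ℝ (GSection m M) where
  carrier := {Φ | ∀ x, Φ x ∈ transverseDeg (Ω x) k}
  add_mem' h1 h2 x := (transverseDeg (Ω x) k).add_mem (h1 x) (h2 x)
  zero_mem' x := (transverseDeg (Ω x) k).zero_mem
  smul_mem' c _ h x := (transverseDeg (Ω x) k).smul_mem c (h x)

/-- The smooth forms that are transverse together with their differential. -/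
def basicSections (Ω : DForm m M 2) : Submodule ℝ (GSection m M) where
  carrier := {Φ | Φ ∈ smoothSections m M ∧ Φ ∈ transverseSections Ω ∧
    gextD Φ ∈ transverseSections Ω}
  add_mem' h1 h2 := ⟨add_mem h1.1 h2.1, add_mem h1.2.1 h2.2.1, by
    rw [gextD_add h1.1 h2.1]
    exact add_mem h1.2.2 h2.2.2⟩
  zero_mem' := ⟨zero_mem _, zero_mem _, by
    rw [gextD_zero']
    exact zero_mem _⟩
  smul_mem' c Φ h := ⟨Submodule.smul_mem _ c h.1, Submodule.smul_mem _ c h.2.1, by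
    rw [gextD_smul]
    exact Submodule.smul_mem _ c h.2.2⟩

theorem grForm_mem_transverseSections {Ω : DForm m M 2} {k : ℕ} {φ : DForm m M k} :
    grForm k φ ∈ transverseSections Ω ↔ ∀ x, IsTransverse (Ω x) (φ x) :=
  forall_congr' fun _ => gr_mem_transverse

theorem grForm_mem_transverseDegSections {Ω : DForm m M 2} {k : ℕ} {φ : DForm m M k}
    (h : ∀ x, IsTransverse (Ω x) (φ x)) : grForm k φ ∈ transverseDegSections Ω k :=
  fun x => gr_mem_transverseDeg (h x)

theorem grForm_mem_smoothSections {k : ℕ} {φ : DForm m M k} :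
    grForm k φ ∈ smoothSections m M ↔ IsSmoothForm φ := by
  constructor
  · intro h
    have := h k
    rwa [component_grForm] at this
  · intro h l
    by_cases hl : l = k
    · subst hl
      rwa [component_grForm]
    · rw [component_grForm_of_ne hl]
      exact isSmoothForm_zero

theorem exists_grForm_eq {Ω : DForm m M 2} {k : ℕ} {Φ : GSection m M}
    (h : Φ ∈ transverseDegSections Ω k) : ∃ φ : DForm m M k, grForm k φ = Φ :=
  ⟨component Φ k, funext fun x => (eq_gr_of_mem_homog (h x).1).symm⟩

/-- The Lefschetz operator on inhomogeneous forms. -/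
def lefSection (Ω : DForm m M 2) : Module.End ℝ (GSection m M) := pointwise fun x => lefOp (Ω x)

theorem lefSection_pow_grForm (Ω : DForm m M 2) (r : ℕ) {k : ℕ} (φ : DForm m M k) :
    (lefSection Ω ^ r) (grForm k φ) = grForm (k + 2 * r) (lefschetzPow Ω r φ) := by
  funext x
  rw [lefSection, pointwise_pow_apply, grForm_apply, lefOp_pow_gr]
  rfl

theorem lefschetzPow_add (Ω : DForm m M 2) (r : ℕ) {k : ℕ} (φ ψ : DForm m M k) :
    lefschetzPow Ω r (φ + ψ) = lefschetzPow Ω r φ + lefschetzPow Ω r ψ := by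
  refine grForm_injective _ ?_
  rw [map_add, ← lefSection_pow_grForm, ← lefSection_pow_grForm, ← lefSection_pow_grForm, map_add,
    map_add]

theorem lefschetzPow_smul (Ω : DForm m M 2) (r : ℕ) {k : ℕ} (c : ℝ) (φ : DForm m M k) :
    lefschetzPow Ω r (c • φ) = c • lefschetzPow Ω r φ := by
  refine grForm_injective _ ?_
  rw [map_smul, ← lefSection_pow_grForm, ← lefSection_pow_grForm, map_smul, map_smul]

theorem lefSection_mem_transverseSections {Ω : DForm m M 2} {Φ : GSection m M}
    (h : Φ ∈ transverseSections Ω) : lefSection Ω Φ ∈ transverseSections Ω :=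
  fun x => lefOp_mem_transverse (h x)

theorem lefSection_mem_smoothSections {Ω : DForm m M 2} (hΩ : IsSmoothForm Ω) {Φ : GSection m M}
    (h : Φ ∈ smoothSections m M) : lefSection Ω Φ ∈ smoothSections m M := by
  intro k
  match k with
  | 0 => exact isSmoothForm_zero
  | 1 => exact isSmoothForm_zero
  | k + 2 => exact hΩ.lef (h k)

section Frames

variable {n : ℕ} {Ω : DForm m M 2} {X Y : ∀ x : M, Fin (2 * n) → TangentSpace (𝓡 m) x}

theorem isLefschetzTriple_sections (hF : ∀ x, IsFrame (Ω x) (X x) (Y x)) :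
    IsLefschetzTriple (lefSection Ω) (pointwise fun x => lamOp (X x) (Y x))
      (transverseDegSections Ω) n where
  raise hφ x := (hF x).triple.raise (hφ x)
  lower hφ x := (hF x).triple.lower (hφ x)
  comm hφ := funext fun x => (hF x).triple.comm (hφ x)
  eq_zero_of_neg hk hφ := funext fun x => (hF x).triple.eq_zero_of_neg hk (hφ x)

theorem gextD_mem_homog {k : ℤ} {Φ : GSection m M} (h : ∀ x, Φ x ∈ homog _ k) (x : M) :
    gextD Φ x ∈ homog _ (k + 1) := by
  intro l hl
  cases l with
  | zero => rfl
  | succ l =>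
    have h0 : component Φ l = 0 :=
      funext fun x => h x l fun hc => hl (by rw [Nat.cast_succ, hc])
    rw [gextD_succ, h0, extD_zero]
    rfl

theorem eq_zero_of_mem_transverseDegSections (hF : ∀ x, IsFrame (Ω x) (X x) (Y x)) {k : ℤ}
    {Φ : GSection m M} (hk : 2 * (n : ℤ) < k) (h : Φ ∈ transverseDegSections Ω k) : Φ = 0 :=
  funext fun x => (hF x).transverseDeg_eq_zero hk (h x)

theorem starOp_grForm (hF : ∀ x, IsFrame (Ω x) (X x) (Y x)) {k l : ℕ} (hkl : k + l = 2 * n)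
    {φ : DForm m M k} (hφ : ∀ x, IsTransverse (Ω x) (φ x)) :
    pointwise (fun x => starOp (X x) (Y x) (volForm n (Ω x))) (grForm k φ) =
      grForm l (starForm n Ω l φ) := by
  funext x
  rw [pointwise_apply, grForm_apply, starOp_gr _ _ _ (by omega)]
  exact ((hF x).gr_symplecticStar hkl (hφ x)).symm

end Frames

variable [IsManifold (𝓡 m) ∞ M]

theorem gextD_lefSection {Ω : DForm m M 2} (hΩ : IsSmoothForm Ω) (hd : extD Ω = 0)
    {Φ : GSection m M} (h : Φ ∈ smoothSections m M) :
    gextD (lefSection Ω Φ) = lefSection Ω (gextD Φ) := by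
  funext x k
  have h0 : ∀ l, extD (0 : DForm m M l) x = 0 := fun l => congrFun extD_zero x
  match k with
  | 0 => rfl
  | 1 => exact h0 0
  | 2 => exact (h0 1).trans (map_zero (lefₗ 0 (Ω x))).symm
  | k + 3 =>
    have h1 := gr_extD_lef hΩ hd (h k) x
    rw [lefOp_gr] at h1
    exact gr_injective (k + 3) h1

theorem gextD_lefSection_pow {Ω : DForm m M 2} (hΩ : IsSmoothForm Ω) (hd : extD Ω = 0)
    {Φ : GSection m M} (h : Φ ∈ smoothSections m M) (r : ℕ) :
    gextD ((lefSection Ω ^ r) Φ) = (lefSection Ω ^ r) (gextD Φ) ∧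
      (lefSection Ω ^ r) Φ ∈ smoothSections m M := by
  induction r with
  | zero => exact ⟨rfl, h⟩
  | succ r ih =>
    rw [end_pow_succ_apply, end_pow_succ_apply, gextD_lefSection hΩ hd ih.2, ih.1]
    exact ⟨rfl, lefSection_mem_smoothSections hΩ ih.2⟩

theorem grForm_mem_basicSections {p q : ℕ} {M : Type*} [TopologicalSpace M] [T2Space M]
    [ChartedSpace (EuclideanSpace ℝ (Fin (p + q))) M] [IsManifold (𝓡 (p + q)) ∞ M]
    {F : Foliation p q M} {Ω : DForm (p + q) M 2} (hΩ : IsTransverselySymplectic F Ω) {k : ℕ}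
    {φ : DForm (p + q) M k} : grForm k φ ∈ basicSections Ω ↔ IsBasic F φ := by
  rw [isBasic_iff hΩ, ← grForm_mem_smoothSections, ← grForm_mem_transverseSections,
    ← grForm_mem_transverseSections, ← gextD_grForm]
  rfl

section Frames

variable {n : ℕ} {Ω : DForm m M 2} {X Y : ∀ x : M, Fin (2 * n) → TangentSpace (𝓡 m) x}

theorem iota_gextD_mem_transverse (hF : ∀ x, IsFrame (Ω x) (X x) (Y x)) (hΩ : IsSmoothForm Ω)
    (hd : extD Ω = 0) {Φ : GSection m M} (hs : Φ ∈ smoothSections m M)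
    (ht : Φ ∈ transverseSections Ω) {x : M} {v : TangentSpace (𝓡 m) x} (hv : flat (Ω x) v = 0) :
    iota v (gextD Φ x) ∈ transverse (Ω x) := by
  intro w hw
  funext l
  exact interior_interior_extD hΩ hd (fun x => ⟨_, _, hF x⟩) (hs (l + 1))
    (fun x => apply_mem_transverse (ht x) (l + 1)) x hv hw

/-- This transfers the pointwise linear algebra to forms on `M`. The substantial field is `div_mem`:
smoothness, transversality and transversality of the differential can all be divided by `L ^ r`. -/
theorem isLefschetzDifferential_sections (hF : ∀ x, IsFrame (Ω x) (X x) (Y x))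
    (hΩ : IsSmoothForm Ω) (hd : extD Ω = 0) :
    IsLefschetzDifferential (lefSection Ω) (pointwise fun x => lamOp (X x) (Y x))
      (pointwise fun x => starOp (X x) (Y x) (volForm n (Ω x)))
      (transverseDegSections Ω) n (basicSections Ω) gextD where
  triple := isLefschetzTriple_sections hF
  surj r Ψ hΨ := by
    -- The preimages are chosen independently at each point; `surj` demands no regularity.
    choose Φ hΦ hΦΨ using fun x => (hF x).exists_pow_eq r (Ψ x) (hΨ x)
    refine ⟨Φ, hΦ, funext fun x => ?_⟩
    rw [lefSection, pointwise_pow_apply]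
    exact hΦΨ x
  raise_mem Φ h := by
    refine ⟨lefSection_mem_smoothSections hΩ h.1, lefSection_mem_transverseSections h.2.1, ?_⟩
    rw [gextD_lefSection hΩ hd h.1]
    exact lefSection_mem_transverseSections h.2.2
  div_mem k r Φ hkr hΦ hB := by
    -- Smoothness and transversality come first, by the division lemma, since both are preserved by
    -- `L` and, for transverse forms, by `Λ`.
    have hs : Φ ∈ smoothSections m M ⊓ transverseSections Ω := by
      refine (isLefschetzTriple_sections hF).mem_of_pow_mem ?_ ?_ hkr hΦ ⟨hB.1, hB.2.1⟩
      · intro k Φ h _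
        exact ⟨lefSection_mem_smoothSections hΩ h.1, lefSection_mem_transverseSections h.2⟩
      · intro k Φ h _
        exact ⟨fun l => isSmoothForm_lamOp hΩ hF h.2 l (h.1 (l + 2)),
          fun x => lamOp_mem_transverse _ _ (h.2 x)⟩
    refine ⟨hs.1, hs.2, fun x v hv => ?_⟩
    have h1 := hB.2.2 x v hv
    rw [(gextD_lefSection_pow hΩ hd hs.1 r).1, lefSection, pointwise_pow_apply,
      iota_lefOp_pow_of_flat_eq_zero hv] at h1
    -- In degree `k + 1`, where `d Φ` lives, `L ^ r` need not be injective. Contracting first with a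
    -- kernel vector returns to degree `k`; contraction commutes with `L ^ r`, and the result is
    -- transverse by involutivity, so injectivity applies.
    have h2 := iota_mem_homog v (gextD_mem_homog (fun x => (hΦ x).1) x)
    rw [add_sub_cancel_right] at h2
    exact (hF x).triple.eq_zero_of_pow_eq_zero hkr
      ⟨h2, iota_gextD_mem_transverse hF hΩ hd hs.1 hs.2 hv⟩ h1
  deg hB hΦ x := ⟨gextD_mem_homog (fun x => (hΦ x).1) x, hB.2.2 x⟩
  map_add hΦ hΨ := gextD_add hΦ.1 hΨ.1
  map_smul c Φ _ := gextD_smul c Φ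
  map_raise hΦ := gextD_lefSection hΩ hd hΦ.1
  star {m j N} hN Φ hΦ h0 := by
    obtain ⟨φ, rfl⟩ := exists_grForm_eq hΦ
    rw [lefSection_pow_grForm]
    funext x
    rw [pointwise_apply, grForm_apply, starOp_gr _ _ _ (by omega)]
    have ht := gr_mem_transverse.1 (hΦ x).2
    refine ((hF x).starAux_lefPow hN (φ x) ht (congrFun h0 x)).trans ?_
    rw [Pi.smul_apply, lefSection, pointwise_pow_apply]
    rfl

end Frames

end Sections

/-! ### Harmonic forms -/

section Harmonic

variable {p n : ℕ} {M : Type*} [TopologicalSpace M] [T2Space M]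
  [ChartedSpace (EuclideanSpace ℝ (Fin (p + 2 * n))) M] [IsManifold (𝓡 (p + 2 * n)) ∞ M]
  {F : Foliation p (2 * n) M} {Ω : DForm (p + 2 * n) M 2}
  {X Y : ∀ x : M, Fin (2 * n) → TangentSpace (𝓡 (p + 2 * n)) x}

/-- `symplecticStar` agrees with the frame star only on transverse forms. The second star is
therefore legitimate only because `⋆ φ` is again basic, which makes `d ⋆ φ` transverse. -/
theorem grForm_deltaT (hΩ : IsTransverselySymplectic F Ω)
    (hF : ∀ x, IsFrame (Ω x) (X x) (Y x)) {k : ℕ} (hk : k ≤ 2 * n) {φ : DForm (p + 2 * n) M k}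
    (hφ : IsBasic F φ) :
    (-1 : ℝ) ^ k • pointwise (fun x => starOp (X x) (Y x) (volForm n (Ω x)))
      (gextD (pointwise (fun x => starOp (X x) (Y x) (volForm n (Ω x))) (grForm k φ))) =
      grForm (k - 1) (deltaT n Ω φ) := by
  have hD := isLefschetzDifferential_sections hF hΩ.smooth hΩ.closed
  have ht := ((isBasic_iff hΩ).1 hφ).2.1
  have hB := (grForm_mem_basicSections hΩ).2 hφ
  have hmem := hD.star_mem (eq_zero_of_mem_transverseDegSections hF)
    (grForm_mem_transverseDegSections ht) hB
  have h1 := starOp_grForm hF (show k + (2 * n - k) = 2 * n by omega) ht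
  rw [h1] at hmem
  have ht' := grForm_mem_transverseSections.1 (gextD_grForm (starForm n Ω (2 * n - k) φ) ▸ hmem.2.2)
  rw [h1, gextD_grForm, deltaT, map_smul]
  congr 1
  cases k with
  | zero =>
    -- For functions `d ⋆ φ` has degree `2 n + 1` and vanishes, so the truncated degree `0 - 1 = 0`
    -- does no harm.
    have h2 : grForm (2 * n - 0 + 1) (extD (starForm n Ω (2 * n - 0) φ)) = 0 :=
      eq_zero_of_mem_transverseDegSections hF (by push_cast; omega)
        (grForm_mem_transverseDegSections ht')
    have h3 : extD (starForm n Ω (2 * n - 0) φ) = 0 := grForm_injective _ (h2.trans (map_zero _).symm)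
    rw [h2, h3, map_zero]
    have h4 : starForm n Ω (0 - 1) (0 : DForm (p + 2 * n) M (2 * n - 0 + 1)) = 0 :=
      funext fun x => map_zero (symplecticStar n (Ω x) _ _)
    rw [h4, map_zero]
  | succ k => exact starOp_grForm hF (by omega) ht'

theorem mem_harmonicST_iff (hΩ : IsTransverselySymplectic F Ω)
    (hF : ∀ x, IsFrame (Ω x) (X x) (Y x)) {k : ℕ} (hk : k ≤ 2 * n) {φ : DForm (p + 2 * n) M k} :
    φ ∈ harmonicST F Ω k ↔
      grForm k φ ∈ (isLefschetzDifferential_sections hF hΩ.smooth hΩ.closed).harmonic := by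
  have hD := isLefschetzDifferential_sections hF hΩ.smooth hΩ.closed
  have key : IsBasic F φ → (φ ∈ harmonicST F Ω k ↔ grForm k φ ∈ hD.harmonic) := by
    intro hφ
    have hG := grForm_mem_transverseDegSections ((isBasic_iff hΩ).1 hφ).2.1
    rw [hD.mem_harmonic (eq_zero_of_mem_transverseDegSections hF) hG, grForm_deltaT hΩ hF hk hφ,
      gextD_grForm, grForm_mem_basicSections hΩ, map_eq_zero_iff _ (grForm_injective _),
      map_eq_zero_iff _ (grForm_injective _)]
    rfl
  exact ⟨fun h => (key h.1).1 h, fun h => (key ((grForm_mem_basicSections hΩ).1 h.1)).2 h⟩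

/-- `L ^ r` is an isomorphism between the harmonic forms of complementary degrees. -/
theorem exists_harmonicST_equiv (hΩ : IsTransverselySymplectic F Ω) {k r : ℕ} (hk : k + r = n) :
    ∃ (H₁ : Submodule ℝ (DForm (p + 2 * n) M k)) (H₂ : Submodule ℝ (DForm (p + 2 * n) M (k + 2 * r)))
      (e : H₁ ≃ₗ[ℝ] H₂), (H₁ : Set (DForm (p + 2 * n) M k)) = harmonicST F Ω k ∧
        (H₂ : Set (DForm (p + 2 * n) M (k + 2 * r))) = harmonicST F Ω (k + 2 * r) ∧
        ∀ φ : H₁, (e φ : DForm (p + 2 * n) M (k + 2 * r)) =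
          lefschetzPow Ω r (φ : DForm (p + 2 * n) M k) := by
  choose X Y hF using hΩ.exists_isFrame
  have hD := isLefschetzDifferential_sections hF hΩ.smooth hΩ.closed
  let H₁ := hD.harmonic.comap (grForm k)
  let H₂ := hD.harmonic.comap (grForm (k + 2 * r))
  have hG : ∀ {l : ℕ} {φ : DForm (p + 2 * n) M l}, grForm l φ ∈ hD.harmonic →
      grForm l φ ∈ transverseDegSections Ω l := fun h =>
    grForm_mem_transverseDegSections (grForm_mem_transverseSections.1 h.1.2.1)
  have hmaps : ∀ φ ∈ H₁, lefschetzPow Ω r φ ∈ H₂ := by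
    intro φ hφ
    have h1 := hD.pow_mem_harmonic hφ (hG hφ) r
    rwa [lefSection_pow_grForm] at h1
  let f : H₁ →ₗ[ℝ] H₂ :=
    { toFun := fun φ => ⟨lefschetzPow Ω r φ, hmaps φ φ.2⟩
      map_add' := fun φ ψ => Subtype.ext (lefschetzPow_add Ω r _ _)
      map_smul' := fun c φ => Subtype.ext (lefschetzPow_smul Ω r c _) }
  have hinj : Function.Injective f := by
    rw [injective_iff_map_eq_zero]
    intro φ h0
    have h1 : (lefSection Ω ^ r) (grForm k φ.1) = 0 := by
      rw [lefSection_pow_grForm]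
      exact (congrArg (grForm (k + 2 * r)) (congrArg Subtype.val h0)).trans (map_zero _)
    have h2 := hD.triple.eq_zero_of_pow_eq_zero (by omega) (hG φ.2) h1
    exact Subtype.ext (grForm_injective k (h2.trans (map_zero _).symm))
  have hsurj : Function.Surjective f := by
    intro ψ
    have h1 := hG ψ.2
    have hdeg : ((k + 2 * r : ℕ) : ℤ) = n + r := by omega
    rw [hdeg] at h1
    -- Since `k + 2 r = n + r`, the harmonic preimage has degree `n - r = k`, and being homogeneous
    -- it comes from an ordinary `k`-form.
    obtain ⟨Φ, hΦG, hΦ, hΦψ⟩ := hD.exists_harmonic_pow_eq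
      (eq_zero_of_mem_transverseDegSections hF) r ψ.2 h1
    rw [show (n : ℤ) - r = k by omega] at hΦG
    obtain ⟨φ, rfl⟩ := exists_grForm_eq hΦG
    refine ⟨⟨φ, hΦ⟩, Subtype.ext (grForm_injective (k + 2 * r) ?_)⟩
    rw [← hΦψ, lefSection_pow_grForm]
    rfl
  refine ⟨H₁, H₂, LinearEquiv.ofBijective f ⟨hinj, hsurj⟩, ?_, ?_, fun φ => rfl⟩
  · ext φ
    exact (mem_harmonicST_iff hΩ hF (by omega)).symm
  · ext φ
    exact (mem_harmonicST_iff hΩ hF (by omega)).symm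

end Harmonic

end TransverseSymplectic

end

/-- Let `Ω` be transversely symplectic for a foliation of codimension `2 n` and let `k = n - r`. Then
the normally symplectic harmonic forms of degree `k` and of degree `k + 2 r = n + r` form linear
subspaces, and `L ^ r` restricts to a linear isomorphism between them. -/
theorem proposition4p7 (p n : ℕ) (M : Type*) [TopologicalSpace M] [T2Space M]
    [SecondCountableTopology M] [ChartedSpace (EuclideanSpace ℝ (Fin (p + 2 * n))) M]
    [IsManifold (𝓡 (p + 2 * n)) ∞ M]
    (F : TransverseSymplectic.Foliation p (2 * n) M)
    (Ω : TransverseSymplectic.DForm (p + 2 * n) M 2)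
    (hΩ : TransverseSymplectic.IsTransverselySymplectic F Ω)
    (k r : ℕ) (hk : k + r = n) :
    ∃ (H₁ : Submodule ℝ (TransverseSymplectic.DForm (p + 2 * n) M k))
      (H₂ : Submodule ℝ (TransverseSymplectic.DForm (p + 2 * n) M (k + 2 * r)))
      (e : H₁ ≃ₗ[ℝ] H₂),
      (H₁ : Set (TransverseSymplectic.DForm (p + 2 * n) M k)) =
          TransverseSymplectic.harmonicST F Ω k ∧
        (H₂ : Set (TransverseSymplectic.DForm (p + 2 * n) M (k + 2 * r))) =
          TransverseSymplectic.harmonicST F Ω (k + 2 * r) ∧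
        ∀ φ : H₁, (e φ : TransverseSymplectic.DForm (p + 2 * n) M (k + 2 * r)) =
          TransverseSymplectic.lefschetzPow Ω r (φ : TransverseSymplectic.DForm (p + 2 * n) M k) :=
  TransverseSymplectic.exists_harmonicST_equiv hΩ hk
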